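/- **Theorem.** Let $(M^{2n+1},g)$ be a smooth (Hausdorff) Riemannian manifold with Levi-Civita connection $\nabla$, curvature tensor $R(X,Y)Z=\nabla_X\nabla_YZ-\nabla_Y\nabla_XZ-\nabla_{[X,Y]}Z$, and a Sasakian structure $(\phi,\xi,\eta,g)$: that is, a smooth $(1,1)$-tensor field $\phi$, vector field $\xi$ and $1$-form $\eta$ with $\phi^2=-\mathrm{id}+\eta\otimes\xi$, $\eta(\xi)=1$, $g(\phi X,\phi Y)=g(X,Y)-\eta(X)\eta(Y)$, $d\eta(X,Y)=g(X,\phi Y)$ and $N_\phi=-2\,d\eta\otimes\xi$, where $2\,d\eta(X,Y)=X\eta(Y)-Y\eta(X)-\eta([X,Y])$ and $N_\phi(X,Y)=\phi^2[X,Y]+[\phi X,\phi Y]-\phi[\phi X,Y]-\phi[X,\phi Y]$. Suppose that $M=M(1)$ is a Sasakian space form with $c=1$: every plane spanned by $X$ and $\phi X$ with $X\neq 0$, $X\perp\xi$, has sectional curvature $1$. Let $I\subset\mathbb R$ be an open interval. A smooth curve $\gamma:I\to M$, parametrized by arc length, is a *Frenet curve of osculating order* $r\ge 1$ if there are smooth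 orthonormal vector fields $E_1=\gamma'=T,E_2,\dots,E_r$ along $\gamma$ and smooth positive functions $k_1,\dots,k_{r-1}$ on $I$ (the curvatures) such that $\nabla_TE_i=-k_{i-1}E_{i-1}+k_iE_{i+1}$ for $1\le i\le r$, where the terms with $E_0$ and $E_{r+1}$ are omitted. A *circle* is a Frenet curve of osculating order $2$ with $k_1$ a positive constant; a *helix* is a Frenet curve of osculating order $3$ with $k_1$ and $k_2$ positive constants. The curve is *Legendre* if $\eta(\gamma')=0$, and a *geodesic* if $\nabla_TT=0$ on $I$. For $\delta_1,\delta_2\in\mathbb R$, a smooth curve $\gamma:I\to M$ is called *interpolating sesqui-harmonic* (for $\delta_1,\delta_2$) if for every compact interval $[a,b]\subset I$ it is a critical point of $$E_{\delta_1,\delta_2}(\gamma)=\delta_1\int_a^b\|\gamma'\|^2\,dt+\delta_2\int_a^b\|\tau(\gamma)\|^2\,dt,\qquad \tau(\gamma)=\nabla_{\gamma'}\gamma',$$ with respect to all smooth variations of $\gamma$ that fix $\gamma(t)$ for every $t\in I\setminus[a,b]$. Let $\gamma:I\to M(1)$ be a non-geodesic Legendre Frenet curve of osculating order $r$, and let $\delta_1,\delta_2\in\mathbb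 R$ with $\delta_2\neq0$ and $\delta_1/\delta_2\neq 0$. Then $\gamma$ is interpolating sesqui-harmonic for $\delta_1,\delta_2$ if and only if $1-\delta_1/\delta_2>0$ and one of the following holds: 1. $\gamma$ is a Legendre circle with $k_1=\sqrt{1-\delta_1/\delta_2}$; 2. $\gamma$ is a Legendre helix with $k_1^2+k_2^2=1-\delta_1/\delta_2$. In particular, if $1-\delta_1/\delta_2<0$, then no such curve $\gamma$ is interpolating sesqui-harmonic for $\delta_1,\delta_2$. -/

import Mathlib

open Set Bundle Manifold
open scoped ContDiff Manifold Bundle Topology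

noncomputable section

/-! ## Riemannian geometry: Levi-Civita connection, curvature, calculus along a curve -/

section Riemannian

variable {m : ℕ} {M : Type*} [TopologicalSpace M]
  [ChartedSpace (EuclideanSpace ℝ (Fin m)) M] [IsManifold (𝓡 m) ∞ M]

/-- Affine connections on `M`. The value `cov Y x v` is `∇_v Y` at the point `x`. -/
abbrev AffineConnection (m : ℕ) (M : Type*) [TopologicalSpace M]
    [ChartedSpace (EuclideanSpace ℝ (Fin m)) M] [IsManifold (𝓡 m) ∞ M] :=
  CovariantDerivative (𝓡 m) (EuclideanSpace ℝ (Fin m)) (TangentSpace (𝓡 m) : M → Type _)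

/-- The vector field `X` is smooth at `x` (i.e. `C^k` near `x` for every finite `k`). -/
def SmoothFieldAt (X : ∀ x : M, TangentSpace (𝓡 m) x) (x : M) : Prop :=
  ContMDiffAt (𝓡 m) (𝓡 m).tangent ∞ (fun y => (⟨y, X y⟩ : TangentBundle (𝓡 m) M)) x

/-- The curvature tensor `R(u, v)w = ∇_X ∇_Y Z - ∇_Y ∇_X Z - ∇_{[X, Y]} Z` at `x`, where
`X, Y, Z` are local vector fields extending `u, v, w` (the value does not depend on the
extensions; those with constant components in the preferred chart at `x` are used). -/
def curvatureTensor (cov : AffineConnection m M) (x : M) (u v w : TangentSpace (𝓡 m) x) :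
    TangentSpace (𝓡 m) x :=
  let X := FiberBundle.extend (EuclideanSpace ℝ (Fin m)) u
  let Y := FiberBundle.extend (EuclideanSpace ℝ (Fin m)) v
  let Z := FiberBundle.extend (EuclideanSpace ℝ (Fin m)) w
  cov (fun y => cov Z y (Y y)) x u - cov (fun y => cov Z y (X y)) x v
    - cov Z x (VectorField.mlieBracket (𝓡 m) X Y x)

/-- The velocity vector `γ'(t)`. -/
def velocity (γ : ℝ → M) (t : ℝ) : TangentSpace (𝓡 m) (γ t) :=
  mfderiv 𝓘(ℝ, ℝ) (𝓡 m) γ t (1 : ℝ)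

/-- The covariant derivative `∇_{γ'} V` at `t` of a vector field `V` along the curve `γ`.
In the frame `e_1, …, e_m` of coordinate fields of the preferred chart at `γ t`, writing
`V = ∑ Vⁱ e_i`, it is `∑ (Vⁱ)'(t) e_i + ∑ Vⁱ(t) ∇_{γ'(t)} e_i`. -/
def covDerivAlong (cov : AffineConnection m M) (γ : ℝ → M)
    (V : ∀ t, TangentSpace (𝓡 m) (γ t)) (t : ℝ) : TangentSpace (𝓡 m) (γ t) :=
  let e := trivializationAt (EuclideanSpace ℝ (Fin m)) (TangentSpace (𝓡 m) : M → Type _) (γ t)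
  e.symmL ℝ (γ t) (deriv (fun s => (e ⟨γ s, V s⟩).2) t)
    + cov (fun y => e.symmL ℝ y (e ⟨γ t, V t⟩).2) (γ t) (velocity γ t)

/-- The curve `γ` is smooth on `J`. -/
def SmoothCurveOn (m : ℕ) {M : Type*} [TopologicalSpace M]
    [ChartedSpace (EuclideanSpace ℝ (Fin m)) M] (γ : ℝ → M) (J : Set ℝ) : Prop :=
  ContMDiffOn 𝓘(ℝ, ℝ) (𝓡 m) ∞ γ J

/-- The vector field `V` along `γ` is smooth on `J`. -/
def SmoothFieldAlongOn (γ : ℝ → M) (V : ∀ t, TangentSpace (𝓡 m) (γ t)) (J : Set ℝ) : Prop :=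
  ContMDiffOn 𝓘(ℝ, ℝ) (𝓡 m).tangent ∞ (fun t => (⟨γ t, V t⟩ : TangentBundle (𝓡 m) M)) J

/-- The tension field `τ(γ) = ∇_{γ'} γ'` of a curve. -/
def tensionField (cov : AffineConnection m M) (γ : ℝ → M) (t : ℝ) : TangentSpace (𝓡 m) (γ t) :=
  covDerivAlong cov γ (velocity γ) t

/-- `γ` is a geodesic on `J`. -/
def IsGeodesicOn (cov : AffineConnection m M) (γ : ℝ → M) (J : Set ℝ) : Prop :=
  ∀ t ∈ J, tensionField cov γ t = 0

variable [RiemannianBundle (fun x : M => TangentSpace (𝓡 m) x)]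

/-- The connection is the Levi-Civita connection of the metric: it is smooth (`∇_X Y` is smooth
where `X` and `Y` are), compatible with the metric, and torsion-free. -/
structure IsLeviCivita (cov : AffineConnection m M) : Prop where
  smooth : ∀ (X Y : ∀ x : M, TangentSpace (𝓡 m) x) (x : M),
    SmoothFieldAt X x → SmoothFieldAt Y x → SmoothFieldAt (fun y => cov Y y (X y)) x
  metric : ∀ (Y Z : ∀ x : M, TangentSpace (𝓡 m) x) (x : M) (v : TangentSpace (𝓡 m) x),
    SmoothFieldAt Y x → SmoothFieldAt Z x →
      mvfderiv (𝓡 m) (fun y => (inner ℝ (Y y) (Z y) : ℝ)) x v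
        = inner ℝ (cov Y x v) (Z x) + inner ℝ (Y x) (cov Z x v)
  torsion_free : ∀ (X Y : ∀ x : M, TangentSpace (𝓡 m) x) (x : M),
    SmoothFieldAt X x → SmoothFieldAt Y x →
      cov Y x (X x) - cov X x (Y x) = VectorField.mlieBracket (𝓡 m) X Y x

/-- The sectional curvature of the plane spanned by `u` and `v`. -/
def sectionalCurvature (cov : AffineConnection m M) (x : M) (u v : TangentSpace (𝓡 m) x) : ℝ :=
  inner ℝ (curvatureTensor cov x u v v) u / (‖u‖ ^ 2 * ‖v‖ ^ 2 - inner ℝ u v ^ 2)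

/-- `E 1, …, E r` is a Frenet frame along `γ : J → M` with curvatures `k 1, …, k (r - 1)`, which
are positive functions (the values of `E` and `k` at other indices are irrelevant). In particular
`γ` is parametrized by arc length. -/
structure IsFrenetFrame (cov : AffineConnection m M) (γ : ℝ → M) (J : Set ℝ) (r : ℕ)
    (k : ℕ → ℝ → ℝ) (E : ℕ → ∀ t, TangentSpace (𝓡 m) (γ t)) : Prop where
  one_le : 1 ≤ r
  smooth_curve : SmoothCurveOn m γ J
  smooth_frame : ∀ i, 1 ≤ i → i ≤ r → SmoothFieldAlongOn γ (E i) J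
  smooth_curvature : ∀ i, 1 ≤ i → i < r → ContDiffOn ℝ ∞ (k i) J
  curvature_pos : ∀ i, 1 ≤ i → i < r → ∀ t ∈ J, 0 < k i t
  orthonormal : ∀ t ∈ J, ∀ i j, 1 ≤ i → i ≤ r → 1 ≤ j → j ≤ r →
    inner ℝ (E i t) (E j t) = if i = j then (1 : ℝ) else 0
  tangent : ∀ t ∈ J, E 1 t = velocity γ t
  frenet : ∀ t ∈ J, ∀ i, 1 ≤ i → i ≤ r →
    covDerivAlong cov γ (E i) t =
      - (if i = 1 then 0 else k (i - 1) t • E (i - 1) t)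
      + (if i = r then 0 else k i t • E (i + 1) t)

/-- `γ : J → M` is a Frenet curve of osculating order `r` with curvatures `k 1, …, k (r - 1)`. -/
def IsFrenetCurve (cov : AffineConnection m M) (γ : ℝ → M) (J : Set ℝ) (r : ℕ)
    (k : ℕ → ℝ → ℝ) : Prop :=
  ∃ E : ℕ → ∀ t, TangentSpace (𝓡 m) (γ t), IsFrenetFrame cov γ J r k E

/-- A circle: a Frenet curve of osculating order `2` whose curvature `k₁` is a positive
constant. -/
def IsCircle (cov : AffineConnection m M) (γ : ℝ → M) (J : Set ℝ) (k₁ : ℝ) : Prop :=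
  0 < k₁ ∧ ∃ k : ℕ → ℝ → ℝ, IsFrenetCurve cov γ J 2 k ∧ ∀ t ∈ J, k 1 t = k₁

/-- A helix: a Frenet curve of osculating order `3` whose curvatures `k₁` and `k₂` are positive
constants. -/
def IsHelix (cov : AffineConnection m M) (γ : ℝ → M) (J : Set ℝ) (k₁ k₂ : ℝ) : Prop :=
  0 < k₁ ∧ 0 < k₂ ∧ ∃ k : ℕ → ℝ → ℝ,
    IsFrenetCurve cov γ J 3 k ∧ ∀ t ∈ J, k 1 t = k₁ ∧ k 2 t = k₂

/-! ### Interpolating sesqui-harmonic curves -/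

/-- The functional `δ₁ ∫ ‖dγ‖² + δ₂ ∫ ‖τ(γ)‖²` over the compact domain `[a, b]`. -/
def sesquiEnergy (cov : AffineConnection m M) (δ₁ δ₂ a b : ℝ) (γ : ℝ → M) : ℝ :=
  δ₁ * (∫ t in a..b, ‖velocity (m := m) γ t‖ ^ 2)
    + δ₂ * (∫ t in a..b, ‖tensionField cov γ t‖ ^ 2)

/-- `Γ s t`, for `|s| < ε` and `t ∈ J`, is a smooth variation of `γ : J → M` supported in
`[a, b]`. -/
structure IsVariation (m : ℕ) {M : Type*} [TopologicalSpace M]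
    [ChartedSpace (EuclideanSpace ℝ (Fin m)) M]
    (γ : ℝ → M) (J : Set ℝ) (a b ε : ℝ) (Γ : ℝ → ℝ → M) : Prop where
  smooth : ContMDiffOn 𝓘(ℝ, ℝ × ℝ) (𝓡 m) ∞ (fun p : ℝ × ℝ => Γ p.1 p.2) (Ioo (-ε) ε ×ˢ J)
  initial : ∀ t ∈ J, Γ 0 t = γ t
  support : ∀ s ∈ Ioo (-ε) ε, ∀ t ∈ J, t ∉ Icc a b → Γ s t = γ t

/-- `γ : J → M` (with `J` an open interval) is interpolating sesqui-harmonic for `δ₁, δ₂`: it is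
smooth and is a critical point of `δ₁ ∫ ‖dγ‖² + δ₂ ∫ ‖τ(γ)‖²` over every compact interval
`[a, b] ⊆ J`, with respect to the smooth variations supported in `[a, b]`. -/
def IsInterpolatingSesquiHarmonic (cov : AffineConnection m M) (δ₁ δ₂ : ℝ)
    (γ : ℝ → M) (J : Set ℝ) : Prop :=
  SmoothCurveOn m γ J ∧
  ∀ a b : ℝ, a < b → Icc a b ⊆ J → ∀ ε : ℝ, 0 < ε → ∀ Γ : ℝ → ℝ → M,
    IsVariation m γ J a b ε Γ →
      HasDerivAt (fun s => sesquiEnergy cov δ₁ δ₂ a b (Γ s)) 0 0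

end Riemannian

/-! ## Sasakian space forms -/

/-- An almost contact metric structure `(φ, ξ, η, g)` on the Riemannian manifold `(M, g)` of
dimension `2 n + 1`. -/
structure AlmostContactMetricStructure (n : ℕ) (M : Type*) [TopologicalSpace M]
    [ChartedSpace (EuclideanSpace ℝ (Fin (2 * n + 1))) M] [IsManifold (𝓡 (2 * n + 1)) ∞ M]
    [RiemannianBundle (fun x : M => TangentSpace (𝓡 (2 * n + 1)) x)] where
  φ : ∀ x : M, TangentSpace (𝓡 (2 * n + 1)) x →L[ℝ] TangentSpace (𝓡 (2 * n + 1)) x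
  ξ : ∀ x : M, TangentSpace (𝓡 (2 * n + 1)) x
  η : ∀ x : M, TangentSpace (𝓡 (2 * n + 1)) x →L[ℝ] ℝ
  smooth_φ : ∀ (X : ∀ x : M, TangentSpace (𝓡 (2 * n + 1)) x) (x : M),
    SmoothFieldAt X x → SmoothFieldAt (fun y => φ y (X y)) x
  smooth_ξ : ∀ x : M, SmoothFieldAt ξ x
  smooth_η : ∀ (X : ∀ x : M, TangentSpace (𝓡 (2 * n + 1)) x) (x : M),
    SmoothFieldAt X x → ContMDiffAt (𝓡 (2 * n + 1)) 𝓘(ℝ, ℝ) ∞ (fun y => η y (X y)) x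
  η_ξ : ∀ x, η x (ξ x) = 1
  φ_φ : ∀ x (u : TangentSpace (𝓡 (2 * n + 1)) x), φ x (φ x u) = - u + η x u • ξ x
  compatible : ∀ x (u v : TangentSpace (𝓡 (2 * n + 1)) x),
    inner ℝ (φ x u) (φ x v) = inner ℝ u v - η x u * η x v

namespace AlmostContactMetricStructure

variable {n : ℕ} {M : Type*} [TopologicalSpace M]
  [ChartedSpace (EuclideanSpace ℝ (Fin (2 * n + 1))) M] [IsManifold (𝓡 (2 * n + 1)) ∞ M]
  [RiemannianBundle (fun x : M => TangentSpace (𝓡 (2 * n + 1)) x)]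
  (S : AlmostContactMetricStructure n M)

/-- The exterior derivative of `η`, with the convention
`2 dη(X, Y) = X(η(Y)) - Y(η(X)) - η([X, Y])`. -/
def dη (X Y : ∀ x : M, TangentSpace (𝓡 (2 * n + 1)) x) (x : M) : ℝ :=
  (mvfderiv (𝓡 (2 * n + 1)) (fun y => S.η y (Y y)) x (X x)
    - mvfderiv (𝓡 (2 * n + 1)) (fun y => S.η y (X y)) x (Y x)
    - S.η x (VectorField.mlieBracket (𝓡 (2 * n + 1)) X Y x)) / 2

/-- The Nijenhuis tensor
`N_φ(X, Y) = φ²[X, Y] + [φX, φY] - φ[φX, Y] - φ[X, φY]` of `φ`. -/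
def nijenhuis (X Y : ∀ x : M, TangentSpace (𝓡 (2 * n + 1)) x) (x : M) :
    TangentSpace (𝓡 (2 * n + 1)) x :=
  let φX : ∀ x : M, TangentSpace (𝓡 (2 * n + 1)) x := fun y => S.φ y (X y)
  let φY : ∀ x : M, TangentSpace (𝓡 (2 * n + 1)) x := fun y => S.φ y (Y y)
  S.φ x (S.φ x (VectorField.mlieBracket (𝓡 (2 * n + 1)) X Y x))
    + VectorField.mlieBracket (𝓡 (2 * n + 1)) φX φY x
    - S.φ x (VectorField.mlieBracket (𝓡 (2 * n + 1)) φX Y x)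
    - S.φ x (VectorField.mlieBracket (𝓡 (2 * n + 1)) X φY x)

/-- The structure is a contact metric structure: `dη(X, Y) = g(X, φ Y)`. -/
def IsContactMetric : Prop :=
  ∀ (X Y : ∀ x : M, TangentSpace (𝓡 (2 * n + 1)) x) (x : M),
    SmoothFieldAt X x → SmoothFieldAt Y x → S.dη X Y x = inner ℝ (X x) (S.φ x (Y x))

/-- The structure is normal: `N_φ = -2 dη ⊗ ξ`. -/
def IsNormal : Prop :=
  ∀ (X Y : ∀ x : M, TangentSpace (𝓡 (2 * n + 1)) x) (x : M),
    SmoothFieldAt X x → SmoothFieldAt Y x → S.nijenhuis X Y x = (-2 * S.dη X Y x) • S.ξ x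

/-- A Sasakian structure: a normal contact metric structure. -/
structure IsSasakian : Prop where
  contactMetric : S.IsContactMetric
  normal : S.IsNormal

/-- Every `φ`-section, i.e. every plane spanned by `u` and `φ u` with `u ≠ 0` orthogonal to `ξ`,
has sectional curvature `c`. -/
def HasConstantPhiSectionalCurvature (cov : AffineConnection (2 * n + 1) M) (c : ℝ) : Prop :=
  ∀ (x : M) (u : TangentSpace (𝓡 (2 * n + 1)) x), u ≠ 0 → inner ℝ u (S.ξ x) = (0 : ℝ) →
    sectionalCurvature cov x u (S.φ x u) = c

/-- `γ : J → M` is a Legendre curve: it is a smooth integral curve of the contact distribution,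
`η(γ') = 0`. -/
def IsLegendreOn (γ : ℝ → M) (J : Set ℝ) : Prop :=
  SmoothCurveOn (2 * n + 1) γ J ∧ ∀ t ∈ J, S.η (γ t) (velocity γ t) = 0

/-- A Legendre circle of curvature `k₁`. -/
def IsLegendreCircle (cov : AffineConnection (2 * n + 1) M) (γ : ℝ → M) (J : Set ℝ)
    (k₁ : ℝ) : Prop :=
  S.IsLegendreOn γ J ∧ IsCircle cov γ J k₁

/-- A Legendre helix of curvatures `k₁` and `k₂`. -/
def IsLegendreHelix (cov : AffineConnection (2 * n + 1) M) (γ : ℝ → M) (J : Set ℝ)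
    (k₁ k₂ : ℝ) : Prop :=
  S.IsLegendreOn γ J ∧ IsHelix cov γ J k₁ k₂

end AlmostContactMetricStructure

end

/-! The hypothesis on φ-sections forces constant curvature. On a Sasakian manifold (∇_w φ)v =
g(w,v)ξ − η(v)w and ∇_w ξ = −φw. By the Ricci identity for φ, the difference D between R and the
unit-curvature tensor g(v,w)u − g(u,w)v therefore commutes with φ. Hence D annihilates ξ and behaves
on ξ^⊥ like the curvature tensor of a Kähler manifold, which is determined by its holomorphic
sectional curvatures. For c = 1 those of D vanish, so M(1) has constant curvature 1. This part rests
on `LocalSasakian.covφ_eq`, `LocalSasakian.curvature_φ`, `eq_zero_of_holomorphic_sectional_eq_zero`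
and `LocalSasakian.curvature_eq`.

In constant curvature 1, integrating the first variation of the energy by parts at a unit-speed
curve leaves the pairing of the variation field with δ₂(∇_T∇_T τ + τ) − δ₁τ; the curvature
contributes just τ because τ ⊥ T (`IsVariation.hasDerivAt_sesquiEnergy`). Bump variations inside a
chart (`exists_isVariation`) show that the critical curves are exactly the zeros of this field
(`isInterpolatingSesquiHarmonic_iff`).

Along a Frenet curve, after division by δ₂, the field has E₁ to E₄ components −3k₁k₁′, k₁″ − k₁³ −
k₁k₂² + (1 − δ₁/δ₂)k₁, 2k₁′k₂ + k₁k₂′ and k₁k₂k₃ (`IsFrenetFrame.eulerLagrangeField_eq`). A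
non-geodesic curve has r ≥ 2 and k₁ > 0, so the first equation makes k₁ constant on the interval,
and the second becomes k₁² + k₂² = 1 − δ₁/δ₂, which is therefore positive. The fourth excludes r ≥
4. What remains is r = 2, a circle, or r = 3 with k₂ constant by the third equation, a helix. The
converse is substitution into the same formula.

The differential geometry is carried out in preferred charts: `LocalLeviCivita` and `LocalSasakian`
record identities between ordinary derivatives, and `frame` and `coframe` translate them to the
manifold. The curvature tensor at a point is defined through the chart at that point, so curvatures
are compared only at chart centres. This is enough, since the curvature enters pointwise. -/

noncomputable section

/-! ## Algebraic curvature tensors -/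

section AlgebraicCurvature

/-- A quadrilinear map that is skew in each pair of arguments and satisfies the Bianchi identity
is symmetric under exchange of the two pairs. -/
theorem pair_symm_of_bianchi {E : Type*} {K : E → E → E → E → ℝ}
    (skew₁ : ∀ x y z w, K x y z w = - K y x z w) (skew₂ : ∀ x y z w, K x y z w = - K x y w z)
    (bianchi : ∀ x y z w, K x y z w + K y z x w + K z x y w = 0) (x y z w : E) :
    K x y z w = K z w x y := by
  -- The octahedron argument: the four Bianchi identities obtained by rotating the arguments, added
  -- with suitable signs, cancel everything except twice the desired difference.
  linarith [bianchi x y z w, bianchi y z w x, bianchi z w x y, bianchi w x y z,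
    skew₁ x y z w, skew₂ x y z w, skew₁ y z w x, skew₂ y z w x, skew₁ z w x y, skew₂ z w x y,
    skew₁ w x y z, skew₂ w x y z, skew₁ x z y w, skew₂ x z y w, skew₁ y w x z, skew₂ y w x z,
    skew₁ z x y w, skew₂ z x y w, skew₁ w y x z, skew₂ w y x z, skew₁ z x w y, skew₂ z x w y,
    skew₁ w y z x, skew₂ w y z x, skew₁ y z x w, skew₁ x w y z, skew₂ x w y z]

/-- A curvature-like quadrilinear map with vanishing sectional curvatures vanishes. -/
theorem eq_zero_of_sectional_eq_zero {E : Type*} [AddCommGroup E] {K : E → E → E → E → ℝ}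
    (add : ∀ x x' y z w, K (x + x') y z w = K x y z w + K x' y z w)
    (skew₁ : ∀ x y z w, K x y z w = - K y x z w) (skew₂ : ∀ x y z w, K x y z w = - K x y w z)
    (bianchi : ∀ x y z w, K x y z w + K y z x w + K z x y w = 0)
    (sec : ∀ x y, K x y x y = 0) (x y z w : E) : K x y z w = 0 := by
  have pair := pair_symm_of_bianchi skew₁ skew₂ bianchi
  have add₃ : ∀ x y z z' w, K x y (z + z') w = K x y z w + K x y z' w := fun x y z z' w => by
    rw [pair, add, pair z, pair z']
  -- Polarization of the sectional curvature in one argument; polarizing the result in the other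
  -- makes `K` invariant under cyclic permutation of its first three arguments, so Bianchi reads 3K
  -- = 0.
  have h1 : ∀ x y w, K x y x w = 0 := fun x y w => by
    have h := sec (y + w) x
    rw [add, add₃, add₃, sec, sec, pair y x w x] at h
    have := skew₁ w x y x
    have := skew₂ x w y x
    have := skew₁ x w x y
    have := pair x y x w
    have := skew₂ w x y x
    linarith
  have h2 : ∀ x y z w, K x y z w = K y z x w := fun x y z w => by
    have h := h1 (x + z) y w
    rw [add, add₃, add₃, h1, h1] at h
    linarith [skew₁ z y x w]
  linarith [bianchi x y z w, h2 x y z w, h2 y z x w]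

/-- A curvature-like quadrilinear map which is invariant under a complex structure (or, more
generally, under an endomorphism `J` with `K x (J (J y)) z w = - K x y z w`) and whose holomorphic
sectional curvatures vanish is zero. -/
theorem eq_zero_of_holomorphic_sectional_eq_zero {E : Type*} [AddCommGroup E]
    {K : E → E → E → E → ℝ} (J : E →+ E)
    (add : ∀ x x' y z w, K (x + x') y z w = K x y z w + K x' y z w)
    (skew₁ : ∀ x y z w, K x y z w = - K y x z w) (skew₂ : ∀ x y z w, K x y z w = - K x y w z)
    (bianchi : ∀ x y z w, K x y z w + K y z x w + K z x y w = 0)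
    (hJ : ∀ x y z w, K (J x) (J y) z w = K x y z w)
    (hJJ : ∀ x y z w, K x (J (J y)) z w = - K x y z w)
    (hol : ∀ x, K x (J x) x (J x) = 0) (x y z w : E) : K x y z w = 0 := by
  have pair := pair_symm_of_bianchi skew₁ skew₂ bianchi
  have add₂ : ∀ x y y' z w, K x (y + y') z w = K x y z w + K x y' z w := fun x y y' z w => by
    rw [skew₁, add, skew₁ x y, skew₁ x y']; ring
  have add₃ : ∀ x y z z' w, K x y (z + z') w = K x y z w + K x y z' w := fun x y z z' w => by
    rw [pair, add, pair z, pair z']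
  have add₄ : ∀ x y z w w', K x y z (w + w') = K x y z w + K x y z w' := fun x y z w w' => by
    rw [pair, add₂, pair z, pair z]
  have zero : ∀ y z w, K 0 y z w = 0 := fun y z w => by
    have := add 0 0 y z w
    simp only [add_zero] at this; linarith
  have neg : ∀ x y z w, K (-x) y z w = - K x y z w := fun x y z w => by
    have := add x (-x) y z w
    rw [add_neg_cancel, zero] at this; linarith
  have neg₂ : ∀ x y z w, K x (-y) z w = - K x y z w := fun x y z w => by
    rw [skew₁, neg, skew₁ x y]
  have neg₃ : ∀ x y z w, K x y (-z) w = - K x y z w := fun x y z w => by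
    rw [pair, neg, pair x y]
  have neg₄ : ∀ x y z w, K x y z (-w) = - K x y z w := fun x y z w => by
    rw [pair, neg₂, pair x y]
  have swap : ∀ x y z w, K y (J x) z w = K x (J y) z w := fun x y z w => by
    have h := hJ y (J x) z w
    rw [hJJ] at h
    rw [← h, skew₁ (J y)]; ring
  have swap' : ∀ x y z w, K z w y (J x) = K z w x (J y) := fun x y z w => by
    rw [pair z w, swap, pair z w]
  have hJ' : ∀ x y z w, K z w (J x) (J y) = K z w x y := fun x y z w => by
    rw [pair z w, hJ, pair z w]
  -- Adding the hypotheses at x + y and x − y isolates the part of bidegree (2,2); by `swap` and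
  -- `swap'` its four mixed terms coincide.
  have polar : ∀ x y, K x (J x) y (J y) + 2 * K x (J y) x (J y) = 0 := fun x y => by
    have h1 := hol (x + y)
    have h2 := hol (x + -y)
    simp only [map_add, map_neg, add, add₂, add₃, add₄, neg, neg₂, neg₃, neg₄, hol] at h1 h2
    have e1 := swap x y x (J y)
    have e2 := swap' x y x (J y)
    have e3 := swap x y y (J x)
    have e4 := swap' x y y (J x)
    have e5 := pair x (J x) y (J y)
    linarith
  -- Bianchi on x, Jx, y turns the term K(x,Jx,y,Jy) of `polar` into sectional curvatures. Replacing
  -- y by Jy gives a second, independent equation in the same two unknowns, so both vanish.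
  have key : ∀ x y, 3 * K x (J y) x (J y) + K x y x y = 0 := fun x y => by
    have h1 := bianchi x (J x) y (J y)
    have h2 := hJ' x y (J x) y
    have h3 := swap y x x (J y)
    have h4 := skew₁ (J x) y x (J y)
    have h5 := skew₁ y x (J x) (J y)
    have h6 := hJ' x y x y
    linarith [polar x y]
  refine eq_zero_of_sectional_eq_zero add skew₁ skew₂ bianchi (fun x y => ?_) x y z w
  have h1 := key x y
  have h2 := key x (J y)
  have h3 : K x (J (J y)) x (J (J y)) = K x y x y := by
    rw [hJJ, pair, hJJ, neg_neg]
  linarith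

end AlgebraicCurvature

/-! ## Calculus in a coordinate domain -/

set_option synthInstance.maxHeartbeats 400000

/-! ### Symmetry of second derivatives. -/

section SecondDerivative

variable {E F : Type*} [NormedAddCommGroup E] [NormedSpace ℝ E] [NormedAddCommGroup F]
  [NormedSpace ℝ F]

/-- Schwarz's theorem with both directions frozen. With its smooth version it drives the skewness of
the curvature, the closedness of the fundamental form, the Ricci identity and the commutation of
covariant derivatives. -/
theorem fderiv_fderiv_apply_comm_of_two {f : E → F} {p : E} (hf : ContDiffAt ℝ 2 f p) (z w : E) :
    fderiv ℝ (fun q => fderiv ℝ f q w) p z = fderiv ℝ (fun q => fderiv ℝ f q z) p w := by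
  have hd : DifferentiableAt ℝ (fderiv ℝ f) p :=
    (hf.fderiv_right (m := 1) (by norm_cast)).differentiableAt one_ne_zero
  have h : ∀ u, HasFDerivAt (fun q => fderiv ℝ f q u) ((fderiv ℝ (fderiv ℝ f) p).flip u) p :=
    fun u => by simpa using hd.hasFDerivAt.clm_apply (hasFDerivAt_const u p)
  rw [(h w).fderiv, (h z).fderiv]
  exact (hf.isSymmSndFDerivAt (by simp)).eq z w

theorem fderiv_fderiv_apply_comm {f : E → F} {p : E} (hf : ContDiffAt ℝ ∞ f p) (z w : E) :
    fderiv ℝ (fun q => fderiv ℝ f q w) p z = fderiv ℝ (fun q => fderiv ℝ f q z) p w :=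
  fderiv_fderiv_apply_comm_of_two (hf.of_le ENat.LEInfty.out) z w

end SecondDerivative

/-! ### Metric, Levi-Civita connection and curvature on an open set of a vector space. -/

section LocalGeometry

variable {E : Type*} [NormedAddCommGroup E] [NormedSpace ℝ E]

/-- A Riemannian metric `g` on the open set `U` of `E`, together with the Christoffel symbols `C`
of its Levi-Civita connection. -/
structure LocalLeviCivita (U : Set E) (g : E → E →L[ℝ] E →L[ℝ] ℝ) (C : E → E →L[ℝ] E →L[ℝ] E) :
    Prop where
  isOpen : IsOpen U
  smooth_g : ContDiffOn ℝ ∞ g U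
  smooth_C : ContDiffOn ℝ ∞ C U
  g_symm : ∀ p ∈ U, ∀ u v, g p u v = g p v u
  g_pos : ∀ p ∈ U, ∀ u, u ≠ 0 → 0 < g p u u
  C_symm : ∀ p ∈ U, ∀ u v, C p u v = C p v u
  metric : ∀ p ∈ U, ∀ w u v, fderiv ℝ g p w u v = g p (C p w u) v + g p u (C p w v)

/-- The curvature tensor of the connection with Christoffel symbols `C`. -/
def localCurvature (C : E → E →L[ℝ] E →L[ℝ] E) (p u v w : E) : E :=
  fderiv ℝ C p u v w - fderiv ℝ C p v u w + C p u (C p v w) - C p v (C p u w)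

namespace LocalLeviCivita

variable {U : Set E} {g : E → E →L[ℝ] E →L[ℝ] ℝ} {C : E → E →L[ℝ] E →L[ℝ] E}

theorem contDiffAt_g (h : LocalLeviCivita U g C) {p : E} (hp : p ∈ U) : ContDiffAt ℝ ∞ g p :=
  h.smooth_g.contDiffAt (h.isOpen.mem_nhds hp)

theorem contDiffAt_C (h : LocalLeviCivita U g C) {p : E} (hp : p ∈ U) : ContDiffAt ℝ ∞ C p :=
  h.smooth_C.contDiffAt (h.isOpen.mem_nhds hp)

theorem hasFDerivAt_g (h : LocalLeviCivita U g C) {p : E} (hp : p ∈ U) :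
    HasFDerivAt g (fderiv ℝ g p) p :=
  ((h.contDiffAt_g hp).differentiableAt (by simp)).hasFDerivAt

theorem hasFDerivAt_C (h : LocalLeviCivita U g C) {p : E} (hp : p ∈ U) :
    HasFDerivAt C (fderiv ℝ C p) p :=
  ((h.contDiffAt_C hp).differentiableAt (by simp)).hasFDerivAt

theorem eq_of_forall_inner (h : LocalLeviCivita U g C) {p : E} (hp : p ∈ U) {u v : E}
    (huv : ∀ w, g p u w = g p v w) : u = v := by
  by_contra hne
  have := h.g_pos p hp (u - v) (sub_ne_zero.2 hne)
  rw [map_sub (g p), sub_apply, huv, sub_self] at this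
  exact lt_irrefl _ this

/-- The symmetry of `C` holds throughout the open set `U`, so it can be differentiated. The first
Bianchi identity uses this form. -/
theorem fderiv_C_symm (h : LocalLeviCivita U g C) {p : E} (hp : p ∈ U) (z u v : E) :
    fderiv ℝ C p z u v = fderiv ℝ C p z v u := by
  have e : ∀ a b, HasFDerivAt (fun q => C q a b) (((fderiv ℝ C p).flip a).flip b) p := fun a b => by
    simpa using ((h.hasFDerivAt_C hp).clm_apply (hasFDerivAt_const a p)).clm_apply
      (hasFDerivAt_const b p)
  have h1 : (fun q => C q u v) =ᶠ[𝓝 p] fun q => C q v u := by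
    filter_upwards [h.isOpen.mem_nhds hp] with q hq using h.C_symm q hq u v
  have h2 := h1.fderiv_eq (𝕜 := ℝ)
  rw [(e u v).fderiv, (e v u).fderiv] at h2
  simpa using congrArg (fun T => T z) h2

theorem localCurvature_skew (u v w p : E) :
    localCurvature C p u v w = - localCurvature C p v u w := by
  simp only [localCurvature]; abel

theorem localCurvature_bianchi (h : LocalLeviCivita U g C) {p : E} (hp : p ∈ U) (u v w : E) :
    localCurvature C p u v w + localCurvature C p v w u + localCurvature C p w u v = 0 := by
  simp only [localCurvature]
  rw [h.fderiv_C_symm hp u v w, h.fderiv_C_symm hp v w u, h.fderiv_C_symm hp w u v,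
    h.C_symm p hp v w, h.C_symm p hp u w, h.C_symm p hp u v]
  abel

/-- The second derivatives of q ↦ g_q(u, v) commute. After metric compatibility has replaced every
derivative of g, their antisymmetric part is g(R(z,w)u, v) + g(u, R(z,w)v). -/
theorem localCurvature_skew_metric (h : LocalLeviCivita U g C) {p : E} (hp : p ∈ U)
    (z w u v : E) :
    g p (localCurvature C p z w u) v = - g p (localCurvature C p z w v) u := by
  have hC : ∀ a b, HasFDerivAt (fun q => C q a b) (((fderiv ℝ C p).flip a).flip b) p :=
    fun a b => by
      simpa using ((h.hasFDerivAt_C hp).clm_apply (hasFDerivAt_const a p)).clm_apply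
        (hasFDerivAt_const b p)
  have hsm : ContDiffAt ℝ ∞ (fun q => g q u v) p :=
    ((h.contDiffAt_g hp).clm_apply contDiffAt_const).clm_apply contDiffAt_const
  have hd : ∀ q ∈ U, ∀ a, fderiv ℝ (fun q => g q u v) q a
      = g q (C q a u) v + g q u (C q a v) := fun q hq a => by
    have : HasFDerivAt (fun q => g q u v) (((fderiv ℝ g q).flip u).flip v) q := by
      simpa using ((h.hasFDerivAt_g hq).clm_apply (hasFDerivAt_const u q)).clm_apply
        (hasFDerivAt_const v q)
    rw [this.fderiv]
    exact h.metric q hq a u v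
  have hdd : ∀ a b, fderiv ℝ (fun q => fderiv ℝ (fun q => g q u v) q a) p b =
      g p (C p b (C p a u)) v + g p (C p a u) (C p b v) + g p (fderiv ℝ C p b a u) v
      + (g p (C p b u) (C p a v) + g p u (C p b (C p a v)) + g p u (fderiv ℝ C p b a v)) :=
    fun a b => by
      have e : (fun q => fderiv ℝ (fun q => g q u v) q a) =ᶠ[𝓝 p]
          fun q => g q (C q a u) v + g q u (C q a v) := by
        filter_upwards [h.isOpen.mem_nhds hp] with q hq using hd q hq a
      have e1 := ((h.hasFDerivAt_g hp).clm_apply (hC a u)).clm_apply (hasFDerivAt_const v p)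
      have e2 := ((h.hasFDerivAt_g hp).clm_apply (hasFDerivAt_const u p)).clm_apply (hC a v)
      rw [e.fderiv_eq, (e1.fun_add e2).fderiv]
      simp [h.metric p hp]
      ring
  have hc := fderiv_fderiv_apply_comm hsm z w
  rw [hdd, hdd] at hc
  have e1 := h.g_symm p hp (C p w u) (C p z v)
  have e2 := h.g_symm p hp (C p z u) (C p w v)
  simp only [localCurvature]
  rw [h.g_symm p hp _ u]
  simp only [map_add, map_sub, add_apply, sub_apply]
  simp only [h.g_symm p hp _ v] at hc ⊢
  linarith

end LocalLeviCivita

end LocalGeometry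

/-! ### Sasakian identities in coordinates. -/

section LocalSasakian

variable {E : Type*} [NormedAddCommGroup E] [NormedSpace ℝ E]

/-- The coordinate form of a Sasakian structure `(φ, ξ, η, g)` on an open set `U` of `E`. -/
structure LocalSasakian (U : Set E) (g : E → E →L[ℝ] E →L[ℝ] ℝ) (C : E → E →L[ℝ] E →L[ℝ] E)
    (φ : E → E →L[ℝ] E) (ξ : E → E) (η : E → E →L[ℝ] ℝ) : Prop extends LocalLeviCivita U g C where
  smooth_φ : ContDiffOn ℝ ∞ φ U
  smooth_ξ : ContDiffOn ℝ ∞ ξ U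
  smooth_η : ContDiffOn ℝ ∞ η U
  η_ξ : ∀ p ∈ U, η p (ξ p) = 1
  φ_φ : ∀ p ∈ U, ∀ u, φ p (φ p u) = - u + η p u • ξ p
  compatible : ∀ p ∈ U, ∀ u v, g p (φ p u) (φ p v) = g p u v - η p u * η p v
  contact : ∀ p ∈ U, ∀ u v, fderiv ℝ η p u v - fderiv ℝ η p v u = 2 * g p u (φ p v)
  normal : ∀ p ∈ U, ∀ u v, fderiv ℝ φ p (φ p u) v - fderiv ℝ φ p (φ p v) u
    + φ p (fderiv ℝ φ p v u) - φ p (fderiv ℝ φ p u v) = (-2 * g p u (φ p v)) • ξ p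

namespace LocalSasakian

variable {U : Set E} {g : E → E →L[ℝ] E →L[ℝ] ℝ} {C : E → E →L[ℝ] E →L[ℝ] E}
  {φ : E → E →L[ℝ] E} {ξ : E → E} {η : E → E →L[ℝ] ℝ}

theorem contDiffAt_φ (h : LocalSasakian U g C φ ξ η) {p : E} (hp : p ∈ U) : ContDiffAt ℝ ∞ φ p :=
  h.smooth_φ.contDiffAt (h.isOpen.mem_nhds hp)

theorem contDiffAt_η (h : LocalSasakian U g C φ ξ η) {p : E} (hp : p ∈ U) : ContDiffAt ℝ ∞ η p :=
  h.smooth_η.contDiffAt (h.isOpen.mem_nhds hp)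

theorem hasFDerivAt_φ (h : LocalSasakian U g C φ ξ η) {p : E} (hp : p ∈ U) :
    HasFDerivAt φ (fderiv ℝ φ p) p :=
  ((h.contDiffAt_φ hp).differentiableAt (by simp)).hasFDerivAt

theorem hasFDerivAt_η (h : LocalSasakian U g C φ ξ η) {p : E} (hp : p ∈ U) :
    HasFDerivAt η (fderiv ℝ η p) p :=
  ((h.contDiffAt_η hp).differentiableAt (by simp)).hasFDerivAt

theorem hasFDerivAt_ξ (h : LocalSasakian U g C φ ξ η) {p : E} (hp : p ∈ U) :
    HasFDerivAt ξ (fderiv ℝ ξ p) p :=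
  ((h.smooth_ξ.contDiffAt (h.isOpen.mem_nhds hp)).differentiableAt (by simp)).hasFDerivAt

/-- Since φ²ξ = 0, the formula for φ² at φξ gives φξ = η(φξ)ξ. Applying φ again yields η(φξ)φξ = 0,
and the vanishing of either factor suffices. -/
theorem φ_ξ (h : LocalSasakian U g C φ ξ η) {p : E} (hp : p ∈ U) : φ p (ξ p) = 0 := by
  have h1 : φ p (φ p (ξ p)) = 0 := by rw [h.φ_φ p hp, h.η_ξ p hp]; simp
  have h2 := h.φ_φ p hp (φ p (ξ p))
  rw [h1, map_zero] at h2
  have h3 : φ p (ξ p) = η p (φ p (ξ p)) • ξ p := by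
    rw [neg_add_eq_sub] at h2; exact (sub_eq_zero.1 h2.symm).symm
  have h4 : η p (φ p (ξ p)) • φ p (ξ p) = 0 := by
    rw [← map_smul, ← h3, h1]
  rcases smul_eq_zero.1 h4 with h5 | h5
  · rw [h3, h5, zero_smul]
  · exact h5

/-- Computing φ³ as φ²∘φ and as φ∘φ² and using φξ = 0, the two results differ by η(φu)ξ. -/
theorem η_φ (h : LocalSasakian U g C φ ξ η) {p : E} (hp : p ∈ U) (u : E) : η p (φ p u) = 0 := by
  have h1 := h.φ_φ p hp (φ p u)
  rw [h.φ_φ p hp u, map_add, map_neg, map_smul, h.φ_ξ hp, smul_zero, add_zero] at h1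
  have h2 : η p (φ p u) • ξ p = 0 := by
    simpa using h1
  have h3 := congrArg (η p) h2
  simpa [h.η_ξ p hp] using h3

theorem η_eq (h : LocalSasakian U g C φ ξ η) {p : E} (hp : p ∈ U) (u : E) :
    η p u = g p u (ξ p) := by
  have := h.compatible p hp u (ξ p)
  rw [h.φ_ξ hp, h.η_ξ p hp, map_zero] at this
  linarith

theorem inner_φ (h : LocalSasakian U g C φ ξ η) {p : E} (hp : p ∈ U) (u v : E) :
    g p (φ p u) v = - g p u (φ p v) := by
  have h1 := h.compatible p hp u (φ p v)
  rw [h.φ_φ p hp, h.η_φ hp, map_add, map_neg, map_smul, ← h.η_eq hp, h.η_φ hp] at h1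
  simp only [smul_zero, mul_zero] at h1
  linarith

theorem inner_φ' (h : LocalSasakian U g C φ ξ η) {p : E} (hp : p ∈ U) (u v : E) :
    g p u (φ p v) = - g p v (φ p u) := by
  rw [h.g_symm p hp, h.inner_φ hp]

/-- The covariant derivative `(∇_w φ) v`. -/
def covφ (C : E → E →L[ℝ] E →L[ℝ] E) (φ : E → E →L[ℝ] E) (p w v : E) : E :=
  fderiv ℝ φ p w v + C p w (φ p v) - φ p (C p w v)

/-- The covariant derivative `∇_w ξ`. -/
def covξ (C : E → E →L[ℝ] E →L[ℝ] E) (ξ : E → E) (p w : E) : E :=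
  fderiv ℝ ξ p w + C p w (ξ p)

/-- The derivative of an identity between sections holding on an open set. -/
theorem fderiv_eq_of_eqOn {F : Type*} [NormedAddCommGroup F] [NormedSpace ℝ F] {f₁ f₂ : E → F}
    {f₁' f₂' : E →L[ℝ] F} (hU : IsOpen U) {p : E} (hp : p ∈ U) (h : ∀ q ∈ U, f₁ q = f₂ q)
    (h₁ : HasFDerivAt f₁ f₁' p) (h₂ : HasFDerivAt f₂ f₂' p) (w : E) : f₁' w = f₂' w := by
  have : f₂ =ᶠ[𝓝 p] f₁ := by
    filter_upwards [hU.mem_nhds hp] with q hq using (h q hq).symm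
  rw [(h₁.congr_of_eventuallyEq this).unique h₂]

theorem fderiv_η (h : LocalSasakian U g C φ ξ η) {p : E} (hp : p ∈ U) (w v : E) :
    fderiv ℝ η p w v = η p (C p w v) + g p v (covξ C ξ p w) := by
  have h1 := (h.hasFDerivAt_η hp).clm_apply (hasFDerivAt_const v p)
  have h2 := ((h.hasFDerivAt_g hp).clm_apply (hasFDerivAt_const v p)).clm_apply
    (h.hasFDerivAt_ξ hp)
  have h3 := fderiv_eq_of_eqOn h.isOpen hp (fun q hq => h.η_eq hq v) h1 h2 w
  simp [h.metric p hp] at h3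
  rw [h3, h.η_eq hp, covξ]
  simp
  ring

/-- The connection is torsion-free, so dη is the antisymmetrization of ∇η, and ∇η is metrically dual
to ∇ξ. -/
theorem contact_cov (h : LocalSasakian U g C φ ξ η) {p : E} (hp : p ∈ U) (u v : E) :
    g p v (covξ C ξ p u) - g p u (covξ C ξ p v) = 2 * g p u (φ p v) := by
  have := h.contact p hp u v
  rw [h.fderiv_η hp, h.fderiv_η hp, h.C_symm p hp v u] at this
  linarith

/-- φ is skew-adjoint and the metric is parallel, so each ∇_w φ is skew-adjoint as well. -/
theorem inner_covφ_skew (h : LocalSasakian U g C φ ξ η) {p : E} (hp : p ∈ U) (w u v : E) :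
    g p u (covφ C φ p w v) = - g p v (covφ C φ p w u) := by
  have hφ := fun a => (h.hasFDerivAt_φ hp).clm_apply (hasFDerivAt_const a p)
  have h1 := ((h.hasFDerivAt_g hp).clm_apply (hasFDerivAt_const u p)).clm_apply (hφ v)
  have h2 := (((h.hasFDerivAt_g hp).clm_apply (hasFDerivAt_const v p)).clm_apply (hφ u)).fun_neg
  have h3 := fderiv_eq_of_eqOn h.isOpen hp (fun q hq => h.inner_φ' hq u v) h1 h2 w
  simp [h.metric p hp] at h3
  simp only [covφ, map_add, map_sub]
  rw [← neg_eq_iff_eq_neg.2 (h.inner_φ hp u (C p w v)), ← neg_eq_iff_eq_neg.2 (h.inner_φ hp v (C p w u)),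
    h.g_symm p hp (φ p u), h.g_symm p hp (φ p v)]
  linarith

/-- The fundamental form g(·, φ·) equals dη, so this is d(dη) = 0 written with covariant
derivatives; the Christoffel terms cancel in the cyclic sum. -/
theorem covφ_closed (h : LocalSasakian U g C φ ξ η) {p : E} (hp : p ∈ U) (w u v : E) :
    g p u (covφ C φ p w v) + g p v (covφ C φ p u w) + g p w (covφ C φ p v u) = 0 := by
  -- The contact identity for the constant fields b and c, differentiated in the direction a.
  have key : ∀ a b c, fderiv ℝ (fun q => fderiv ℝ (fun q => η q c) q b) p a
      - fderiv ℝ (fun q => fderiv ℝ (fun q => η q b) q c) p a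
      = 2 * (g p (C p a b) (φ p c) + g p b (covφ C φ p a c) - g p (φ p b) (C p a c)) := by
    intro a b c
    have hη : ∀ q ∈ U, ∀ c, HasFDerivAt (fun q => η q c) ((fderiv ℝ η q).flip c) q :=
      fun q hq c => by
        simpa using (h.hasFDerivAt_η hq).clm_apply (hasFDerivAt_const c q)
    have hsm : ∀ c, ContDiffAt ℝ ∞ (fun q => η q c) p := fun c =>
      (h.contDiffAt_η hp).clm_apply contDiffAt_const
    have hd : ∀ b c, HasFDerivAt (fun q => fderiv ℝ (fun q => η q c) q b)
        (fderiv ℝ (fun q => fderiv ℝ (fun q => η q c) q b) p) p := fun b c => by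
      have : DifferentiableAt ℝ (fderiv ℝ (fun q => η q c)) p :=
        ((hsm c).fderiv_right (m := 1) (by norm_cast)).differentiableAt one_ne_zero
      exact (this.clm_apply (differentiableAt_const b)).hasFDerivAt
    have hφ := fun a => (h.hasFDerivAt_φ hp).clm_apply (hasFDerivAt_const a p)
    have h1 := (hd b c).fun_sub (hd c b)
    have h2 := (((h.hasFDerivAt_g hp).clm_apply (hasFDerivAt_const b p)).clm_apply
      (hφ c)).const_mul 2
    have h3 := fderiv_eq_of_eqOn h.isOpen hp (fun q hq => by
      rw [(hη q hq c).fderiv, (hη q hq b).fderiv]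
      exact h.contact q hq b c) h1 h2 a
    simp [h.metric p hp] at h3
    rw [h3, h.inner_φ hp]
    simp only [covφ, map_add, map_sub]
    ring
  have hsm : ∀ c, ContDiffAt ℝ ∞ (fun q => η q c) p := fun c =>
    (h.contDiffAt_η hp).clm_apply contDiffAt_const
  have h1 := key w u v
  have h2 := key u v w
  have h3 := key v w u
  have e1 := fderiv_fderiv_apply_comm (hsm v) w u
  have e2 := fderiv_fderiv_apply_comm (hsm u) w v
  have e3 := fderiv_fderiv_apply_comm (hsm w) u v
  have s1 := h.C_symm p hp u w
  have s2 := h.C_symm p hp v w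
  have s3 := h.C_symm p hp v u
  rw [h.g_symm p hp (φ p _)] at h1 h2 h3
  rw [s1] at h2
  rw [s2, s3] at h3
  linarith

/-- The Nijenhuis tensor in terms of `∇φ`. -/
theorem normal_cov (h : LocalSasakian U g C φ ξ η) {p : E} (hp : p ∈ U) (u v : E) :
    covφ C φ p (φ p u) v - covφ C φ p (φ p v) u + φ p (covφ C φ p v u) - φ p (covφ C φ p u v)
      = (-2 * g p u (φ p v)) • ξ p := by
  rw [← h.normal p hp u v]
  simp only [covφ, map_add, map_sub]
  rw [h.C_symm p hp (φ p v) (φ p u), h.C_symm p hp v (φ p u), h.C_symm p hp u (φ p v),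
    h.C_symm p hp v u]
  abel

/-- The covariant derivative of `φ² = - id + η ⊗ ξ`. -/
theorem covφ_φ (h : LocalSasakian U g C φ ξ η) {p : E} (hp : p ∈ U) (w v : E) :
    covφ C φ p w (φ p v) + φ p (covφ C φ p w v)
      = g p v (covξ C ξ p w) • ξ p + η p v • covξ C ξ p w := by
  have hφ := (h.hasFDerivAt_φ hp).clm_apply (hasFDerivAt_const v p)
  have h1 := (h.hasFDerivAt_φ hp).clm_apply hφ
  have h2 := ((h.hasFDerivAt_η hp).clm_apply (hasFDerivAt_const v p)).fun_smul
    (h.hasFDerivAt_ξ hp)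
  have h3 := fderiv_eq_of_eqOn h.isOpen hp (fun q hq => h.φ_φ q hq v) h1
    ((hasFDerivAt_const (-v) p).fun_add h2) w
  simp at h3
  rw [h.fderiv_η hp] at h3
  have e : g p v (covξ C ξ p w) • ξ p + η p v • covξ C ξ p w =
      (η p v • (fderiv ℝ ξ p) w + (η p (C p w v) + g p v (covξ C ξ p w)) • ξ p)
      + η p v • C p w (ξ p) - η p (C p w v) • ξ p := by
    rw [covξ]; module
  rw [e, ← h3]
  simp only [covφ, map_add, map_sub, h.φ_φ p hp, map_neg, map_smul]
  module

/-- Obtained by differentiating η(ξ) = 1. -/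
theorem inner_covξ_ξ (h : LocalSasakian U g C φ ξ η) {p : E} (hp : p ∈ U) (w : E) :
    g p (ξ p) (covξ C ξ p w) = 0 := by
  have h1 := (h.hasFDerivAt_η hp).clm_apply (h.hasFDerivAt_ξ hp)
  have h3 := fderiv_eq_of_eqOn h.isOpen hp (fun q hq => h.η_ξ q hq) h1 (hasFDerivAt_const 1 p) w
  simp at h3
  rw [h.fderiv_η hp] at h3
  have : η p (covξ C ξ p w) = η p (fderiv ℝ ξ p w) + η p (C p w (ξ p)) := by
    rw [covξ, map_add]
  rw [h.η_eq hp, h.g_symm p hp] at this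
  linarith

/-- Obtained by differentiating φξ = 0. -/
theorem covφ_ξ (h : LocalSasakian U g C φ ξ η) {p : E} (hp : p ∈ U) (w : E) :
    covφ C φ p w (ξ p) = - φ p (covξ C ξ p w) := by
  have h1 := (h.hasFDerivAt_φ hp).clm_apply (h.hasFDerivAt_ξ hp)
  have h3 := fderiv_eq_of_eqOn h.isOpen hp (fun q hq => h.φ_ξ hq) h1 (hasFDerivAt_const 0 p) w
  simp at h3
  simp only [covφ, covξ, h.φ_ξ hp, map_add, map_zero, add_zero]
  rw [neg_add, ← sub_eq_add_neg, ← eq_neg_of_add_eq_zero_right h3]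

/-- On a Sasakian manifold, `(∇_w φ) v = g(w, v) ξ - η(v) w`. -/
theorem covφ_eq (h : LocalSasakian U g C φ ξ η) {p : E} (hp : p ∈ U) (w v : E) :
    covφ C φ p w v = g p w v • ξ p - η p v • w := by
  refine h.eq_of_forall_inner hp fun u => ?_
  rw [h.g_symm p hp _ u, h.g_symm p hp _ u]
  have star : ∀ w u v, g p u (covφ C φ p w (φ p v)) - g p (φ p u) (covφ C φ p w v)
      = g p v (covξ C ξ p w) * η p u + η p v * g p u (covξ C ξ p w) := fun w u v => by
    have := congrArg (g p u) (h.covφ_φ hp w v)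
    simp only [map_add, map_smul, smul_eq_mul] at this
    rw [h.inner_φ hp, h.η_eq hp u]
    linarith
  have nor : ∀ u v z, g p z (covφ C φ p (φ p u) v) - g p z (covφ C φ p (φ p v) u)
      - g p (φ p z) (covφ C φ p v u) + g p (φ p z) (covφ C φ p u v)
      = -2 * g p u (φ p v) * η p z := fun u v z => by
    have := congrArg (g p z) (h.normal_cov hp u v)
    simp only [map_add, map_sub, map_smul, smul_eq_mul] at this
    rw [h.inner_φ hp, h.inner_φ hp, h.η_eq hp z]
    linarith
  have hφφ : ∀ a b, g p (φ p (φ p a)) b = - g p a b + η p a * g p (ξ p) b := fun a b => by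
    rw [h.φ_φ p hp]; simp
  have hξ : ∀ w z, g p z (covφ C φ p w (ξ p)) = g p (φ p z) (covξ C ξ p w) := fun w z => by
    rw [h.covφ_ξ hp, map_neg, h.inner_φ hp]
  -- The ingredients of a Koszul-type formula for ∇φ: normality tested against φw, where its
  -- right-hand side drops out because η∘φ = 0, and closedness at (w, u, v) and at (w, φu, φv).
  -- `star` moves φ across ∇φ at the cost of terms in ∇ξ.
  have n1 := nor u v (φ p w)
  rw [h.η_φ hp, hφφ, hφφ] at n1
  have c1 := h.covφ_closed hp w u v
  have c2 := h.covφ_closed hp w (φ p u) (φ p v)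
  have s1 := star (φ p u) w v
  have s2 := star (φ p v) w u
  have s3 := star w u (φ p v)
  rw [h.η_φ hp, h.φ_φ p hp v] at s3
  have e1 : covφ C φ p w (-v + η p v • ξ p)
      = - covφ C φ p w v + η p v • covφ C φ p w (ξ p) := by
    simp only [covφ, map_add, map_neg, map_smul]; module
  rw [e1] at s3
  simp only [map_add, map_neg, map_smul, smul_eq_mul, hξ] at s3
  have k1 := h.inner_covφ_skew hp v (ξ p) u
  have k2 := h.inner_covφ_skew hp u (ξ p) v
  rw [hξ] at k1 k2
  have t1 := h.contact_cov hp w (φ p u)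
  have t2 := h.contact_cov hp w (φ p v)
  have t3 := h.contact_cov hp v (φ p u)
  have t4 := h.contact_cov hp u (φ p v)
  have k3 := h.inner_covφ_skew hp (φ p u) w (φ p v)
  have k6 := h.inner_covφ_skew hp u w v
  simp only [h.φ_φ p hp, map_add, map_neg, map_smul, smul_eq_mul] at t1 t2 t3 t4
  rw [← h.η_eq hp] at t1 t2 t3 t4
  simp only [map_sub, map_smul, smul_eq_mul]
  rw [← h.η_eq hp]
  -- The remaining terms in ∇ξ occur multiplied by values of η. The contact identities are
  -- multiplied by these factors beforehand, so that the final step is linear.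
  have m1 : η p u * (g p (φ p v) (covξ C ξ p w)) = η p u * (g p w (covξ C ξ p (φ p v)) + 2 * (- g p w v + η p v * η p w)) := by
    rw [← t2]; ring
  have m2 : η p v * (g p (φ p u) (covξ C ξ p w)) = η p v * (g p w (covξ C ξ p (φ p u)) + 2 * (- g p w u + η p u * η p w)) := by
    rw [← t1]; ring
  have m3 : η p w * g p (φ p u) (covξ C ξ p v) = η p w * (g p v (covξ C ξ p (φ p u)) + 2 * (- g p v u + η p u * η p v)) := by
    rw [← t3]; ring
  have m4 : η p w * g p (φ p v) (covξ C ξ p u) = η p w * (g p u (covξ C ξ p (φ p v)) + 2 * (- g p u v + η p v * η p u)) := by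
    rw [← t4]; ring
  rw [k1, k2] at n1
  rw [h.g_symm p hp v u] at m3
  rw [h.g_symm p hp u w]
  linarith

/-- On a Sasakian manifold, `∇_w ξ = - φ w`. -/
theorem covξ_eq (h : LocalSasakian U g C φ ξ η) {p : E} (hp : p ∈ U) (w : E) :
    covξ C ξ p w = - φ p w := by
  have h1 := h.covφ_ξ hp w
  rw [h.covφ_eq hp, h.η_ξ p hp, one_smul] at h1
  -- So far only φ(∇_w ξ) is known. A second φ recovers ∇_w ξ itself, whose ξ-component vanishes.
  have h2 := congrArg (φ p) h1
  rw [map_sub, map_smul, h.φ_ξ hp, map_neg, h.φ_φ p hp, h.η_eq hp (covξ C ξ p w),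
    h.g_symm p hp (covξ C ξ p w), h.inner_covξ_ξ hp] at h2
  simpa using h2.symm

/-- The Ricci identity for `φ` on a Sasakian manifold. -/
theorem curvature_φ (h : LocalSasakian U g C φ ξ η) {p : E} (hp : p ∈ U) (z w v : E) :
    localCurvature C p z w (φ p v) - φ p (localCurvature C p z w v) =
      g p z v • φ p w - g p w v • φ p z + g p v (φ p z) • w - g p v (φ p w) • z := by
  have hC : ∀ a b, HasFDerivAt (fun q => C q a b) (((fderiv ℝ C p).flip a).flip b) p :=
    fun a b => by
      simpa using ((h.hasFDerivAt_C hp).clm_apply (hasFDerivAt_const a p)).clm_apply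
        (hasFDerivAt_const b p)
  have hφ : ∀ q ∈ U, HasFDerivAt (fun q => φ q v) ((fderiv ℝ φ q).flip v) q := fun q hq => by
    simpa using (h.hasFDerivAt_φ hq).clm_apply (hasFDerivAt_const v q)
  have hsm : ContDiffAt ℝ ∞ (fun q => φ q v) p := (h.contDiffAt_φ hp).clm_apply contDiffAt_const
  have hd : ∀ q ∈ U, ∀ a, fderiv ℝ φ q a v
      = g q a v • ξ q - g q v (ξ q) • a - C q a (φ q v) + φ q (C q a v) := fun q hq a => by
    have := h.covφ_eq hq a v
    rw [covφ, h.η_eq hq] at this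
    rw [← this]; abel
  have hξ : ∀ a, fderiv ℝ ξ p a = - φ p a - C p a (ξ p) := fun a => by
    rw [← h.covξ_eq hp, covξ]; abel
  -- The formula for ∇φ is a first-order equation for φ. Differentiating it once more and
  -- eliminating the first derivatives of φ, ξ and g with the known identities leaves an expression
  -- whose antisymmetrization in a and b is the claim.
  have hdd : ∀ a b, fderiv ℝ (fun q => fderiv ℝ (fun q => φ q v) q a) p b =
      (g p (C p b a) v + g p a (C p b v)) • ξ p + g p a v • (- φ p b - C p b (ξ p))
      - (g p (C p b v) (ξ p) - g p v (φ p b)) • a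
      - fderiv ℝ C p b a (φ p v)
      - C p a (g p b v • ξ p - g p v (ξ p) • b - C p b (φ p v) + φ p (C p b v))
      + (g p b (C p a v) • ξ p - g p (C p a v) (ξ p) • b - C p b (φ p (C p a v))
        + φ p (C p b (C p a v)))
      + φ p (fderiv ℝ C p b a v) := fun a b => by
    have e : (fun q => fderiv ℝ (fun q => φ q v) q a) =ᶠ[𝓝 p]
        fun q => g q a v • ξ q - g q v (ξ q) • a - C q a (φ q v) + φ q (C q a v) := by
      filter_upwards [h.isOpen.mem_nhds hp] with q hq
      rw [(hφ q hq).fderiv]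
      exact hd q hq a
    have e1 := (((h.hasFDerivAt_g hp).clm_apply (hasFDerivAt_const a p)).clm_apply
      (hasFDerivAt_const v p)).fun_smul (h.hasFDerivAt_ξ hp)
    have e2 := (((h.hasFDerivAt_g hp).clm_apply (hasFDerivAt_const v p)).clm_apply
      (h.hasFDerivAt_ξ hp)).smul_const a
    have e3 := ((h.hasFDerivAt_C hp).clm_apply (hasFDerivAt_const a p)).clm_apply (hφ p hp)
    have e4 := (h.hasFDerivAt_φ hp).clm_apply (hC a v)
    have hd' : ∀ a v, fderiv ℝ φ p a v
        = g p a v • ξ p - g p v (ξ p) • a - C p a (φ p v) + φ p (C p a v) := fun a v => by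
      have := h.covφ_eq hp a v
      rw [covφ, h.η_eq hp] at this
      rw [← this]; abel
    rw [e.fderiv_eq, (((e1.fun_sub e2).fun_sub e3).fun_add e4).fderiv]
    simp [h.metric p hp, hξ, hd']
    module
  have hc := fderiv_fderiv_apply_comm hsm z w
  rw [hdd, hdd, h.C_symm p hp w z] at hc
  have hc' := sub_eq_zero.2 hc
  rw [← sub_eq_zero, ← neg_eq_zero, ← hc']
  simp only [localCurvature, map_add, map_sub, map_smul]
  rw [h.C_symm p hp w z]
  module

/-- A Sasakian manifold whose `φ`-sectional curvature at a point is `1` has constant curvature `1`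
at this point. -/
theorem curvature_eq (h : LocalSasakian U g C φ ξ η) {p : E} (hp : p ∈ U)
    (hc : ∀ u, g p u (ξ p) = 0 → g p (localCurvature C p u (φ p u) (φ p u)) u = g p u u ^ 2)
    (u v w : E) : localCurvature C p u v w = g p v w • u - g p u w • v := by
  set D : E → E → E → E := fun u v w => localCurvature C p u v w - (g p v w • u - g p u w • v)
    with hD
  set K : E → E → E → E → ℝ := fun x y z w => g p (D x y z) w with hK
  have gs := h.g_symm p hp
  have add : ∀ x x' y z w, K (x + x') y z w = K x y z w + K x' y z w := fun x x' y z w => by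
    simp only [hK, hD, localCurvature, map_add, map_sub, map_smul, add_apply, sub_apply, smul_apply,
      smul_eq_mul]
    ring
  have add₃ : ∀ x y z z' w, K x y (z + z') w = K x y z w + K x y z' w := fun x y z z' w => by
    simp only [hK, hD, localCurvature, map_add, map_sub, map_smul, add_apply, sub_apply, smul_apply,
      smul_eq_mul]
    ring
  have smul₃ : ∀ x y (a : ℝ) z w, K x y (a • z) w = a * K x y z w := fun x y a z w => by
    simp only [hK, hD, localCurvature, map_add, map_sub, map_smul, add_apply, sub_apply, smul_apply,
      smul_eq_mul]
    ring
  have skew₁ : ∀ x y z w, K x y z w = - K y x z w := fun x y z w => by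
    simp only [hK, hD, LocalLeviCivita.localCurvature_skew x y z]
    simp only [map_sub, map_neg, map_smul, sub_apply, neg_apply, smul_apply]
    ring
  have skew₂ : ∀ x y z w, K x y z w = - K x y w z := fun x y z w => by
    have := h.localCurvature_skew_metric hp x y z w
    simp only [hK, hD, map_sub, map_smul, sub_apply, smul_apply, this, smul_eq_mul]
    ring
  have bianchi : ∀ x y z w, K x y z w + K y z x w + K z x y w = 0 := fun x y z w => by
    have := congrArg (fun a => g p a w) (h.localCurvature_bianchi hp x y z)
    simp only [map_add, add_apply, map_zero, zero_apply] at this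
    simp only [hK, hD, map_sub, map_smul, sub_apply, smul_apply, smul_eq_mul]
    rw [gs z y, gs z x, gs y x]
    linarith
  have pair := pair_symm_of_bianchi skew₁ skew₂ bianchi
  -- The right-hand side of the Ricci identity is exactly the commutator of φ with the
  -- unit-curvature tensor, so it disappears from D.
  have comm : ∀ x y z, D x y (φ p z) = φ p (D x y z) := fun x y z => by
    have h1 := h.curvature_φ hp x y z
    rw [sub_eq_iff_eq_add] at h1
    simp only [hD, h1, map_sub, map_smul]
    rw [h.inner_φ' hp y z, h.inner_φ' hp x z]
    module
  -- By `comm`, φ annihilates D(x,y)ξ, which is therefore a multiple of ξ; skewness in the last two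
  -- arguments makes that multiple zero.
  have Kξ : ∀ x y w, K x y (ξ p) w = 0 := fun x y w => by
    have h1 : φ p (D x y (ξ p)) = 0 := by
      rw [← comm, h.φ_ξ hp]
      simp [hD, localCurvature]
    have h2 := h.φ_φ p hp (D x y (ξ p))
    rw [h1, map_zero, h.η_eq hp] at h2
    have h3 : g p (D x y (ξ p)) (ξ p) = 0 := by
      have : K x y (ξ p) (ξ p) = - K x y (ξ p) (ξ p) := skew₂ x y (ξ p) (ξ p)
      have h4 : K x y (ξ p) (ξ p) = 0 := by linarith
      exact h4
    rw [h3, zero_smul, add_zero] at h2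
    simp only [hK]
    rw [neg_eq_zero.1 h2.symm]
    simp
  have hJ₃ : ∀ x y z w, K x y (φ p z) (φ p w) = K x y z w := fun x y z w => by
    have h1 := h.compatible p hp (D x y z) w
    have h2 := Kξ x y z
    rw [skew₂] at h2
    have h3 : η p (D x y z) = 0 := by rw [h.η_eq hp]; simpa using h2
    simp only [hK, comm, h1, h3, zero_mul, sub_zero]
  have hJJ₃ : ∀ x y z w, K x y (φ p (φ p z)) w = - K x y z w := fun x y z w => by
    have h1 := add₃ x y z (φ p (φ p z)) w
    have h2 : z + φ p (φ p z) = η p z • ξ p := by rw [h.φ_φ p hp]; abel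
    rw [h2, smul₃, Kξ, mul_zero] at h1
    linarith
  have K0 : ∀ x y z w, K x y z w = 0 := by
    refine eq_zero_of_holomorphic_sectional_eq_zero (φ p : E →+ E) add skew₁ skew₂ bianchi
      (fun x y z w => ?_) (fun x y z w => ?_) fun x => ?_
    · rw [pair, pair x]; exact hJ₃ z w x y
    · change K x (φ p (φ p y)) z w = _
      rw [pair, skew₂, hJJ₃, neg_neg, pair x y z w, skew₂ z w x y, neg_neg]
    · change K x (φ p x) x (φ p x) = 0
      -- The hypothesis concerns vectors orthogonal to ξ only. Since `K` ignores ξ-components, x may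
      -- be replaced by its horizontal part.
      set a := x - η p x • ξ p with ha
      have hx : x = a + η p x • ξ p := by rw [ha]; abel
      have hφa : φ p x = φ p a := by rw [hx]; simp [h.φ_ξ hp]
      have haξ : η p a = 0 := by simp [ha, h.η_ξ p hp]
      have e1 : ∀ y z w, K x y z w = K a y z w := fun y z w => by
        rw [hx, add, pair (_ • _), smul₃, Kξ, mul_zero, add_zero]
      have e2 : ∀ y z w, K y z x w = K y z a w := fun y z w => by
        rw [pair, e1, pair]
      rw [e1, e2, hφa, skew₂]
      have h1 := hc a (by rw [← h.η_eq hp, haξ])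
      have h2 := h.compatible p hp a a
      have h3 := h.inner_φ hp a a
      rw [gs] at h3
      have h4 : g p a (φ p a) = 0 := by linarith
      simp only [hK, hD, map_sub, map_smul, sub_apply, smul_apply, smul_eq_mul, h1, h2, h4, haξ]
      ring
  have := h.eq_of_forall_inner hp (u := D u v w) (v := 0) fun z => by
    rw [map_zero]; exact K0 u v w z
  exact sub_eq_zero.1 this

end LocalSasakian

end LocalSasakian

/-! ### Covariant derivatives along maps into a coordinate domain. -/

section CovariantPartialDerivatives

variable {E : Type*} [NormedAddCommGroup E] [NormedSpace ℝ E]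
  {P : Type*} [NormedAddCommGroup P] [NormedSpace ℝ P]

/-- The covariant derivative, in the direction `e`, of the field `f` along the map `c` into the
coordinate domain. -/
def covPartial (C : E → E →L[ℝ] E →L[ℝ] E) (c : P → E) (e : P) (f : P → E) (q : P) : E :=
  fderiv ℝ f q e + C (c q) (fderiv ℝ c q e) (f q)

namespace LocalLeviCivita

variable {U : Set E} {g : E → E →L[ℝ] E →L[ℝ] ℝ} {C : E → E →L[ℝ] E →L[ℝ] E}
  {c f f₁ f₂ : P → E} {q : P}

theorem contDiffAt_fderiv_apply {F : Type*} [NormedAddCommGroup F] [NormedSpace ℝ F] {f : P → F}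
    (hf : ContDiffAt ℝ ∞ f q) (e : P) :
    ContDiffAt ℝ ∞ (fun q => fderiv ℝ f q e) q :=
  (hf.fderiv_right (m := ∞) (by norm_cast)).clm_apply contDiffAt_const

theorem contDiffAt_covPartial (h : LocalLeviCivita U g C) (hc : ContDiffAt ℝ ∞ c q) (hq : c q ∈ U)
    (hf : ContDiffAt ℝ ∞ f q) (e : P) : ContDiffAt ℝ ∞ (covPartial C c e f) q :=
  (contDiffAt_fderiv_apply hf e).add
    ((((h.contDiffAt_C hq).comp q hc).clm_apply (contDiffAt_fderiv_apply hc e)).clm_apply hf)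

theorem contDiffAt_inner (h : LocalLeviCivita U g C) (hc : ContDiffAt ℝ ∞ c q) (hq : c q ∈ U)
    (hf₁ : ContDiffAt ℝ ∞ f₁ q) (hf₂ : ContDiffAt ℝ ∞ f₂ q) :
    ContDiffAt ℝ ∞ (fun q => g (c q) (f₁ q) (f₂ q)) q :=
  (((h.contDiffAt_g hq).comp q hc).clm_apply hf₁).clm_apply hf₂

/-- Metric compatibility along an arbitrary map: curves are the case `P = ℝ`, variations the case `P
= ℝ × ℝ`. -/
theorem fderiv_inner (h : LocalLeviCivita U g C) (hc : DifferentiableAt ℝ c q) (hq : c q ∈ U)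
    (hf₁ : DifferentiableAt ℝ f₁ q) (hf₂ : DifferentiableAt ℝ f₂ q) (e : P) :
    fderiv ℝ (fun q => g (c q) (f₁ q) (f₂ q)) q e
      = g (c q) (covPartial C c e f₁ q) (f₂ q) + g (c q) (f₁ q) (covPartial C c e f₂ q) := by
  have hgc : HasFDerivAt (fun q => g (c q)) ((fderiv ℝ g (c q)).comp (fderiv ℝ c q)) q :=
    HasFDerivAt.comp (g := g) q (h.hasFDerivAt_g hq) hc.hasFDerivAt
  have h1 := (hgc.clm_apply hf₁.hasFDerivAt).clm_apply hf₂.hasFDerivAt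
  rw [h1.fderiv]
  simp [h.metric _ hq, covPartial]
  ring

/-- Torsion-freeness along a map. The hypothesis is C² because a finite order of differentiability
persists near q, so the identity can be used on a neighbourhood and then differentiated. -/
theorem covPartial_comm (h : LocalLeviCivita U g C) (hc : ContDiffAt ℝ 2 c q) (hq : c q ∈ U)
    (e₁ e₂ : P) :
    covPartial C c e₁ (fun q => fderiv ℝ c q e₂) q
      = covPartial C c e₂ (fun q => fderiv ℝ c q e₁) q := by
  simp only [covPartial]
  rw [fderiv_fderiv_apply_comm_of_two hc, h.C_symm _ hq]

theorem hasFDerivAt_of_contDiffAt {F : Type*} [NormedAddCommGroup F] [NormedSpace ℝ F] {f : P → F}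
    (hf : ContDiffAt ℝ ∞ f q) : HasFDerivAt f (fderiv ℝ f q) q :=
  (hf.differentiableAt (by simp)).hasFDerivAt

/-- Second derivatives of f and of c cancel in the commutator; what survives is the derivative of C
along c and the commutator of the Christoffel operators, that is, the curvature. -/
theorem covPartial_covPartial (h : LocalLeviCivita U g C) (hc : ContDiffAt ℝ ∞ c q) (hq : c q ∈ U)
    (hf : ContDiffAt ℝ ∞ f q) (e₁ e₂ : P) :
    covPartial C c e₁ (covPartial C c e₂ f) q = covPartial C c e₂ (covPartial C c e₁ f) q
      + localCurvature C (c q) (fderiv ℝ c q e₁) (fderiv ℝ c q e₂) (f q) := by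
  have key : ∀ a b, fderiv ℝ (covPartial C c a f) q b
      = fderiv ℝ (fun q => fderiv ℝ f q a) q b
        + fderiv ℝ C (c q) (fderiv ℝ c q b) (fderiv ℝ c q a) (f q)
        + C (c q) (fderiv ℝ (fun q => fderiv ℝ c q a) q b) (f q)
        + C (c q) (fderiv ℝ c q a) (fderiv ℝ f q b) := fun a b => by
    have hCc : HasFDerivAt (fun q => C (c q)) ((fderiv ℝ C (c q)).comp (fderiv ℝ c q)) q :=
      HasFDerivAt.comp (g := C) q (h.hasFDerivAt_C hq) (hasFDerivAt_of_contDiffAt hc)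
    have h1 := (hCc.clm_apply
      (hasFDerivAt_of_contDiffAt (contDiffAt_fderiv_apply hc a))).clm_apply
      (hasFDerivAt_of_contDiffAt hf)
    have h2 := (hasFDerivAt_of_contDiffAt (contDiffAt_fderiv_apply hf a)).fun_add h1
    refine (congrArg (fun T => T b) h2.fderiv).trans ?_
    simp
    abel
  have e1 := fderiv_fderiv_apply_comm hf e₁ e₂
  have e2 := fderiv_fderiv_apply_comm hc e₁ e₂
  rw [covPartial.eq_1 C c e₁ (covPartial C c e₂ f), covPartial.eq_1 C c e₂ (covPartial C c e₁ f),
    key, key, e1, e2]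
  simp only [localCurvature, covPartial, map_add]
  abel

end LocalLeviCivita

end CovariantPartialDerivatives

/-! ### First variation of the energy density in coordinates. -/

section FirstVariation

variable {E : Type*} [NormedAddCommGroup E] [NormedSpace ℝ E]
  {U : Set E} {g : E → E →L[ℝ] E →L[ℝ] ℝ} {C : E → E →L[ℝ] E →L[ℝ] E}

/-- The covariant derivative of a field `V` along the curve `c` in the coordinate domain. -/
def localCovDeriv (C : E → E →L[ℝ] E →L[ℝ] E) (c V : ℝ → E) (t : ℝ) : E :=
  deriv V t + C (c t) (deriv c t) (V t)

theorem localCovDeriv_congr {c c' V V' : ℝ → E} {t : ℝ} (hc : c =ᶠ[𝓝 t] c') (hV : V =ᶠ[𝓝 t] V') :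
    localCovDeriv C c V =ᶠ[𝓝 t] localCovDeriv C c' V' := by
  filter_upwards [hc, hV, hc.deriv, hV.deriv] with s h1 h2 h3 h4
  simp [localCovDeriv, h1, h2, h3, h4]

theorem hasDerivAt_comp_prodMk_left {F : Type*} [NormedAddCommGroup F] [NormedSpace ℝ F]
    {f : ℝ × ℝ → F} {s t : ℝ} (hf : DifferentiableAt ℝ f (s, t)) :
    HasDerivAt (fun s => f (s, t)) (fderiv ℝ f (s, t) (1, 0)) s :=
  hf.hasFDerivAt.comp_hasDerivAt s ((hasDerivAt_id s).prodMk (hasDerivAt_const s t))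

theorem hasDerivAt_comp_prodMk_right {F : Type*} [NormedAddCommGroup F] [NormedSpace ℝ F]
    {f : ℝ × ℝ → F} {s t : ℝ} (hf : DifferentiableAt ℝ f (s, t)) :
    HasDerivAt (fun t => f (s, t)) (fderiv ℝ f (s, t) (0, 1)) t :=
  hf.hasFDerivAt.comp_hasDerivAt t ((hasDerivAt_const t s).prodMk (hasDerivAt_id t))

theorem eventually_differentiableAt {P F : Type*} [NormedAddCommGroup P] [NormedSpace ℝ P]
    [NormedAddCommGroup F] [NormedSpace ℝ F]
    {f : P → F} {q : P} (hf : ContDiffAt ℝ ∞ f q) : ∀ᶠ q' in 𝓝 q, DifferentiableAt ℝ f q' := by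
  filter_upwards [(hf.of_le (m := 1) (by norm_cast)).eventually (by simp)] with q' hq'
  exact hq'.differentiableAt one_ne_zero

theorem deriv_right_eventuallyEq {f : ℝ × ℝ → E} {q : ℝ × ℝ} (hf : ContDiffAt ℝ ∞ f q) :
    (fun p : ℝ × ℝ => deriv (fun t => f (p.1, t)) p.2) =ᶠ[𝓝 q] fun p => fderiv ℝ f p (0, 1) := by
  filter_upwards [eventually_differentiableAt hf] with p hp
  exact (hasDerivAt_comp_prodMk_right hp).deriv

theorem localCovDeriv_right_eventuallyEq {c f : ℝ × ℝ → E} {q : ℝ × ℝ}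
    (hc : ContDiffAt ℝ ∞ c q) (hf : ContDiffAt ℝ ∞ f q) :
    (fun p : ℝ × ℝ => localCovDeriv C (fun t => c (p.1, t)) (fun t => f (p.1, t)) p.2)
      =ᶠ[𝓝 q] covPartial C c (0, 1) f := by
  filter_upwards [deriv_right_eventuallyEq hc, deriv_right_eventuallyEq hf] with p h1 h2
  simp only [localCovDeriv, covPartial, h1, h2]

theorem eventually_right {p : ℝ × ℝ → Prop} {s t : ℝ} (h : ∀ᶠ q in 𝓝 (s, t), p q) :
    ∀ᶠ t' in 𝓝 t, p (s, t') :=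
  (Continuous.prodMk_right s).continuousAt.eventually h

/-- The integrand of the sesqui-harmonic energy in coordinates. -/
def localLagrangian (g : E → E →L[ℝ] E →L[ℝ] ℝ) (C : E → E →L[ℝ] E →L[ℝ] E) (δ₁ δ₂ : ℝ)
    (c : ℝ → E) (t : ℝ) : ℝ :=
  δ₁ * g (c t) (deriv c t) (deriv c t)
    + δ₂ * g (c t) (localCovDeriv C c (deriv c) t) (localCovDeriv C c (deriv c) t)

namespace LocalLeviCivita

variable {c : ℝ × ℝ → E} {s t : ℝ}

/-- Trades the derivatives of each curve t ↦ c(s, t) for derivatives of c in the direction (0, 1),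
which exhibits the density as a smooth function of both variables. -/
theorem localLagrangian_eventuallyEq (δ₁ δ₂ : ℝ) {q : ℝ × ℝ} (hc : ContDiffAt ℝ ∞ c q) :
    (fun p : ℝ × ℝ => localLagrangian g C δ₁ δ₂ (fun t => c (p.1, t)) p.2) =ᶠ[𝓝 q] fun p =>
      δ₁ * g (c p) (fderiv ℝ c p (0, 1)) (fderiv ℝ c p (0, 1))
        + δ₂ * g (c p) (covPartial C c (0, 1) (fun p => fderiv ℝ c p (0, 1)) p)
          (covPartial C c (0, 1) (fun p => fderiv ℝ c p (0, 1)) p) := by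
  have h1 := deriv_right_eventuallyEq hc
  filter_upwards [h1.eventuallyEq_nhds, localCovDeriv_right_eventuallyEq (C := C) hc
    (contDiffAt_fderiv_apply hc (0, 1))] with p hp h2
  have h3 : deriv (fun t => c (p.1, t)) =ᶠ[𝓝 p.2] fun t => fderiv ℝ c (p.1, t) (0, 1) :=
    eventually_right hp
  have h4 := (localCovDeriv_congr (C := C) (c := fun t => c (p.1, t)) Filter.EventuallyEq.rfl h3).eq_of_nhds
  simp only [localLagrangian]
  rw [h4, h2, h3.eq_of_nhds]

theorem contDiffAt_localLagrangian (h : LocalLeviCivita U g C) (δ₁ δ₂ : ℝ) {q : ℝ × ℝ}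
    (hc : ContDiffAt ℝ ∞ c q) (hq : c q ∈ U) :
    ContDiffAt ℝ ∞
      (fun p : ℝ × ℝ => localLagrangian g C δ₁ δ₂ (fun t => c (p.1, t)) p.2) q := by
  have h1 := contDiffAt_fderiv_apply hc (0, 1)
  have h2 := h.contDiffAt_covPartial hc hq h1 (0, 1)
  refine ContDiffAt.congr_of_eventuallyEq ?_ (localLagrangian_eventuallyEq δ₁ δ₂ hc)
  exact (contDiffAt_const.mul (h.contDiffAt_inner hc hq h1 h1)).add
    (contDiffAt_const.mul (h.contDiffAt_inner hc hq h2 h2))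

/-- The first variation of the integrand of the sesqui-harmonic energy. -/
theorem fderiv_localLagrangian (h : LocalLeviCivita U g C) (δ₁ δ₂ : ℝ)
    (hc : ContDiffAt ℝ ∞ c (s, t)) (hq : c (s, t) ∈ U) {c₀ V : ℝ → E}
    (hc₀ : c₀ =ᶠ[𝓝 t] fun t => c (s, t)) (hV : V =ᶠ[𝓝 t] fun t => deriv (fun s => c (s, t)) s) :
    fderiv ℝ (fun p : ℝ × ℝ => localLagrangian g C δ₁ δ₂ (fun t => c (p.1, t)) p.2) (s, t) (1, 0)
      = 2 * (δ₁ * g (c₀ t) (localCovDeriv C c₀ V t) (deriv c₀ t)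
        + δ₂ * g (c₀ t) (localCovDeriv C c₀ (localCovDeriv C c₀ V) t
            + localCurvature C (c₀ t) (V t) (deriv c₀ t) (deriv c₀ t))
          (localCovDeriv C c₀ (deriv c₀) t)) := by
  have hT := contDiffAt_fderiv_apply hc (0, 1)
  have hS := contDiffAt_fderiv_apply hc (1, 0)
  have hτ := h.contDiffAt_covPartial hc hq hT (0, 1)
  have dT := (hasFDerivAt_of_contDiffAt hT).differentiableAt
  have dτ := (hasFDerivAt_of_contDiffAt hτ).differentiableAt
  have dc := (hasFDerivAt_of_contDiffAt hc).differentiableAt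
  have e0 := hc₀.eq_of_nhds
  have eT : deriv c₀ =ᶠ[𝓝 t] fun t => fderiv ℝ c (s, t) (0, 1) := by
    have : (deriv fun t => c (s, t)) =ᶠ[𝓝 t] fun t => fderiv ℝ c (s, t) (0, 1) :=
      eventually_right (deriv_right_eventuallyEq hc)
    exact hc₀.deriv.trans this
  have eV : V =ᶠ[𝓝 t] fun t => fderiv ℝ c (s, t) (1, 0) := by
    refine hV.trans ?_
    filter_upwards [eventually_right (eventually_differentiableAt hc)] with t' ht'
    exact (hasDerivAt_comp_prodMk_left ht').deriv
  have along : ∀ {f : ℝ × ℝ → E} {W : ℝ → E}, ContDiffAt ℝ ∞ f (s, t) →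
      (W =ᶠ[𝓝 t] fun t => f (s, t)) →
      localCovDeriv C c₀ W =ᶠ[𝓝 t] fun t => covPartial C c (0, 1) f (s, t) := fun hf hW =>
    (localCovDeriv_congr hc₀ hW).trans (eventually_right (localCovDeriv_right_eventuallyEq hc hf))
  have eτ := (along hT eT).eq_of_nhds
  have eDV := along hS eV
  have eDDV := (along (h.contDiffAt_covPartial hc hq hS (0, 1)) eDV).eq_of_nhds
  -- ∇_s ∂_t = ∇_t ∂_s is needed as an equality of germs, because it is differentiated once more in
  -- t.
  have comm : covPartial C c (1, 0) (fun p => fderiv ℝ c p (0, 1)) =ᶠ[𝓝 (s, t)]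
      covPartial C c (0, 1) (fun p => fderiv ℝ c p (1, 0)) := by
    filter_upwards [(hc.of_le (m := 2) ENat.LEInfty.out).eventually (by simp),
      hc.continuousAt.eventually (h.isOpen.mem_nhds hq)] with p h1 h2
    exact h.covPartial_comm h1 h2 _ _
  have comm₂ : covPartial C c (0, 1) (covPartial C c (1, 0) fun p => fderiv ℝ c p (0, 1)) (s, t)
      = covPartial C c (0, 1) (covPartial C c (0, 1) fun p => fderiv ℝ c p (1, 0)) (s, t) := by
    simp only [covPartial.eq_1 C c (0, 1) (covPartial C c _ _)]
    rw [comm.fderiv_eq, comm.eq_of_nhds]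
  rw [(localLagrangian_eventuallyEq δ₁ δ₂ hc).fderiv_eq]
  have i1 := (hasFDerivAt_of_contDiffAt (h.contDiffAt_inner hc hq hT hT)).differentiableAt
  have i2 := (hasFDerivAt_of_contDiffAt (h.contDiffAt_inner hc hq hτ hτ)).differentiableAt
  rw [fderiv_fun_add (i1.const_mul δ₁) (i2.const_mul δ₂), fderiv_const_mul i1,
    fderiv_const_mul i2]
  simp only [add_apply, smul_apply, smul_eq_mul]
  -- ∇_s τ = ∇_s∇_t ∂_t equals ∇_t∇_t ∂_s + R(∂_s, ∂_t)∂_t by the curvature commutator and `comm₂`.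
  rw [h.fderiv_inner dc hq dT dT, h.fderiv_inner dc hq dτ dτ,
    h.covPartial_covPartial hc hq hT, comm₂, comm.eq_of_nhds, eτ, eDDV, eDV.eq_of_nhds,
    eT.eq_of_nhds, eV.eq_of_nhds, e0, h.g_symm _ hq (fderiv ℝ c (s, t) (0, 1)),
    h.g_symm _ hq (covPartial C c (0, 1) (fun p => fderiv ℝ c p (0, 1)) (s, t))]
  ring

end LocalLeviCivita

end FirstVariation

/-! ### Coordinate frames, components and brackets of vector fields. -/

section CoordinateFrames

theorem source_mem_nhds {m : ℕ} {M : Type*} [TopologicalSpace M]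
    [ChartedSpace (EuclideanSpace ℝ (Fin m)) M] {x₀ y : M}
    (hy : y ∈ (extChartAt (𝓡 m) x₀).source) : (extChartAt (𝓡 m) x₀).source ∈ 𝓝 y :=
  (isOpen_extChartAt_source x₀).mem_nhds hy

variable {m : ℕ} {M : Type*} [TopologicalSpace M]
  [ChartedSpace (EuclideanSpace ℝ (Fin m)) M] [IsManifold (𝓡 m) ∞ M]

/-- The coordinate frame at `y` of the preferred chart at `x₀`. -/
def frame (x₀ y : M) : EuclideanSpace ℝ (Fin m) →L[ℝ] TangentSpace (𝓡 m) y :=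
  (trivializationAt (EuclideanSpace ℝ (Fin m)) (TangentSpace (𝓡 m) : M → Type _) x₀).symmL ℝ y

/-- The components of tangent vectors at `y` in the coordinate frame of the preferred chart
at `x₀`. -/
def coframe (x₀ y : M) : TangentSpace (𝓡 m) y →L[ℝ] EuclideanSpace ℝ (Fin m) :=
  (trivializationAt (EuclideanSpace ℝ (Fin m)) (TangentSpace (𝓡 m) : M → Type _)
    x₀).continuousLinearMapAt ℝ y

/-- The vector field on the domain of the preferred chart at `x₀` with components `v`. -/
def coordField (x₀ : M) (v : EuclideanSpace ℝ (Fin m) → EuclideanSpace ℝ (Fin m)) (y : M) :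
    TangentSpace (𝓡 m) y :=
  frame x₀ y (v (extChartAt (𝓡 m) x₀ y))

variable {x₀ y : M} {v w : EuclideanSpace ℝ (Fin m) → EuclideanSpace ℝ (Fin m)}

theorem mem_trivializationAt_baseSet (hy : y ∈ (extChartAt (𝓡 m) x₀).source) :
    y ∈ (trivializationAt (EuclideanSpace ℝ (Fin m)) (TangentSpace (𝓡 m) : M → Type _)
      x₀).baseSet := by
  rwa [extChartAt_source] at hy

theorem coframe_frame (hy : y ∈ (extChartAt (𝓡 m) x₀).source) (a : EuclideanSpace ℝ (Fin m)) :
    coframe x₀ y (frame x₀ y a) = a :=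
  Trivialization.continuousLinearMapAt_symmL _ (mem_trivializationAt_baseSet hy) a

theorem frame_coframe (hy : y ∈ (extChartAt (𝓡 m) x₀).source) (u : TangentSpace (𝓡 m) y) :
    frame x₀ y (coframe x₀ y u) = u :=
  Trivialization.symmL_continuousLinearMapAt _ (mem_trivializationAt_baseSet hy) u

theorem coframe_injective (hy : y ∈ (extChartAt (𝓡 m) x₀).source) {u u' : TangentSpace (𝓡 m) y}
    (h : coframe x₀ y u = coframe x₀ y u') : u = u' := by
  rw [← frame_coframe hy u, h, frame_coframe hy]

theorem coframe_apply (hy : y ∈ (extChartAt (𝓡 m) x₀).source) (u : TangentSpace (𝓡 m) y) :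
    coframe x₀ y u = (trivializationAt (EuclideanSpace ℝ (Fin m))
      (TangentSpace (𝓡 m) : M → Type _) x₀ ⟨y, u⟩).2 := by
  have hy' := mem_trivializationAt_baseSet hy
  rw [coframe, Trivialization.continuousLinearMapAt_apply, Trivialization.coe_linearMapAt_of_mem _ hy']

theorem mfderiv_extChartAt_eq_coframe (hy : y ∈ (extChartAt (𝓡 m) x₀).source) :
    mfderiv (𝓡 m) 𝓘(ℝ, EuclideanSpace ℝ (Fin m)) (extChartAt (𝓡 m) x₀) y = coframe x₀ y :=
  (TangentBundle.continuousLinearMapAt_trivializationAt (I := 𝓡 m)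
    (mem_trivializationAt_baseSet hy)).symm

theorem contMDiffAt_extChartAt_of_mem (hy : y ∈ (extChartAt (𝓡 m) x₀).source) :
    ContMDiffAt (𝓡 m) 𝓘(ℝ, EuclideanSpace ℝ (Fin m)) ∞ (extChartAt (𝓡 m) x₀) y := by
  rw [extChartAt_source] at hy
  exact contMDiffAt_extChartAt' hy

theorem contMDiffAt_extChartAt_symm {p : EuclideanSpace ℝ (Fin m)}
    (hp : p ∈ (extChartAt (𝓡 m) x₀).target) :
    ContMDiffAt 𝓘(ℝ, EuclideanSpace ℝ (Fin m)) (𝓡 m) ∞ (extChartAt (𝓡 m) x₀).symm p :=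
  (contMDiffOn_extChartAt_symm x₀).contMDiffAt ((isOpen_extChartAt_target x₀).mem_nhds hp)

theorem contDiffAt_comp_extChartAt_symm {F : Type*} [NormedAddCommGroup F] [NormedSpace ℝ F]
    {f : M → F} {p : EuclideanSpace ℝ (Fin m)} (hp : p ∈ (extChartAt (𝓡 m) x₀).target)
    (hf : ContMDiffAt (𝓡 m) 𝓘(ℝ, F) ∞ f ((extChartAt (𝓡 m) x₀).symm p)) :
    ContDiffAt ℝ ∞ (fun q => f ((extChartAt (𝓡 m) x₀).symm q)) p :=
  (hf.comp p (contMDiffAt_extChartAt_symm hp)).contDiffAt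

/-- Smoothness at y may be tested in any preferred chart whose domain contains y, not only in the
one at y. -/
theorem smoothFieldAt_iff (hy : y ∈ (extChartAt (𝓡 m) x₀).source)
    {X : ∀ x : M, TangentSpace (𝓡 m) x} :
    SmoothFieldAt X y ↔ ContMDiffAt (𝓡 m) 𝓘(ℝ, EuclideanSpace ℝ (Fin m)) ∞
      (fun y => coframe x₀ y (X y)) y := by
  have h := (trivializationAt (EuclideanSpace ℝ (Fin m)) (TangentSpace (𝓡 m) : M → Type _)
    x₀).contMDiffAt_section_iff (IB := 𝓡 m) (n := ∞) (s := X) (mem_trivializationAt_baseSet hy)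
  refine h.trans (Filter.EventuallyEq.contMDiffAt_iff ?_)
  filter_upwards [source_mem_nhds hy] with z hz using (coframe_apply hz _).symm

theorem coframe_coordField (hy : y ∈ (extChartAt (𝓡 m) x₀).source) :
    coframe x₀ y (coordField x₀ v y) = v (extChartAt (𝓡 m) x₀ y) :=
  coframe_frame hy _

theorem smoothFieldAt_coordField (hy : y ∈ (extChartAt (𝓡 m) x₀).source)
    (hv : ContDiffAt ℝ ∞ v (extChartAt (𝓡 m) x₀ y)) : SmoothFieldAt (coordField x₀ v) y := by
  rw [smoothFieldAt_iff hy]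
  have h : ContMDiffAt (𝓡 m) 𝓘(ℝ, EuclideanSpace ℝ (Fin m)) ∞
      (fun y => v (extChartAt (𝓡 m) x₀ y)) y :=
    hv.contMDiffAt.comp y (contMDiffAt_extChartAt_of_mem hy)
  refine h.congr_of_eventuallyEq ?_
  filter_upwards [source_mem_nhds hy] with z hz using coframe_coordField hz

theorem SmoothFieldAt.mdifferentiableAt {X : ∀ x : M, TangentSpace (𝓡 m) x}
    (h : SmoothFieldAt X y) :
    MDifferentiableAt (𝓡 m) (𝓡 m).tangent (fun y => (⟨y, X y⟩ : TangentBundle (𝓡 m) M)) y :=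
  ContMDiffAt.mdifferentiableAt h (by simp)

/-- The components of a vector field in the preferred chart at `x₀`. -/
def components (x₀ : M) (X : ∀ x : M, TangentSpace (𝓡 m) x) (p : EuclideanSpace ℝ (Fin m)) :
    EuclideanSpace ℝ (Fin m) :=
  coframe x₀ ((extChartAt (𝓡 m) x₀).symm p) (X ((extChartAt (𝓡 m) x₀).symm p))

theorem contDiffAt_components {X : ∀ x : M, TangentSpace (𝓡 m) x}
    (hy : y ∈ (extChartAt (𝓡 m) x₀).source) (hX : SmoothFieldAt X y) :
    ContDiffAt ℝ ∞ (components x₀ X) (extChartAt (𝓡 m) x₀ y) := by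
  refine contDiffAt_comp_extChartAt_symm (f := fun y => coframe x₀ y (X y))
    ((extChartAt (𝓡 m) x₀).map_source hy) ?_
  rw [(extChartAt (𝓡 m) x₀).left_inv hy]
  exact (smoothFieldAt_iff hy).1 hX

theorem coordField_components (X : ∀ x : M, TangentSpace (𝓡 m) x)
    (hy : y ∈ (extChartAt (𝓡 m) x₀).source) : coordField x₀ (components x₀ X) y = X y := by
  have h := frame_coframe hy (X y)
  rw [coordField, components, (extChartAt (𝓡 m) x₀).left_inv hy, h]

theorem mvfderiv_comp_extChartAt {F : Type*} [NormedAddCommGroup F] [NormedSpace ℝ F]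
    (hy : y ∈ (extChartAt (𝓡 m) x₀).source) {f : M → F} {h : EuclideanSpace ℝ (Fin m) → F}
    (hh : DifferentiableAt ℝ h (extChartAt (𝓡 m) x₀ y))
    (hf : f =ᶠ[𝓝 y] fun z => h (extChartAt (𝓡 m) x₀ z)) (u : TangentSpace (𝓡 m) y) :
    mvfderiv (𝓡 m) f y u = fderiv ℝ h (extChartAt (𝓡 m) x₀ y) (coframe x₀ y u) := by
  have h1 : mfderiv (𝓡 m) 𝓘(ℝ, F) (h ∘ extChartAt (𝓡 m) x₀) y = _ :=
    mfderiv_comp y hh.mdifferentiableAt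
      ((contMDiffAt_extChartAt_of_mem hy).mdifferentiableAt (by simp))
  have h2 : mfderiv (𝓡 m) 𝓘(ℝ, F) f y = mfderiv (𝓡 m) 𝓘(ℝ, F) (h ∘ extChartAt (𝓡 m) x₀) y :=
    hf.mfderiv_eq
  change mfderiv (𝓡 m) 𝓘(ℝ, F) f y u = _
  rw [h2, h1, mfderiv_extChartAt_eq_coframe hy, mfderiv_eq_fderiv]
  rfl

/-- The derivative of the chart is the coframe and its inverse is the frame, so the field with given
components is a pullback under the chart. Naturality of the Lie bracket then applies. -/
theorem coordField_eq_mpullback (hy : y ∈ (extChartAt (𝓡 m) x₀).source) :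
    coordField x₀ v y = VectorField.mpullback (𝓡 m) 𝓘(ℝ, EuclideanSpace ℝ (Fin m))
      (extChartAt (𝓡 m) x₀) v y := by
  have h : ContinuousLinearMap.inverse (coframe (m := m) x₀ y) = frame x₀ y := by
    apply ContinuousLinearMap.inverse_eq
    · ext1 a; exact coframe_frame hy a
    · ext1 a; exact frame_coframe hy a
  change _ = (mfderiv (𝓡 m) 𝓘(ℝ, EuclideanSpace ℝ (Fin m)) (extChartAt (𝓡 m) x₀) y).inverse
    (v (extChartAt (𝓡 m) x₀ y))
  rw [mfderiv_extChartAt_eq_coframe hy]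
  exact (congrArg (fun T => T (v (extChartAt (𝓡 m) x₀ y))) h).symm

theorem mlieBracket_coordField (hy : y ∈ (extChartAt (𝓡 m) x₀).source)
    (hv : ContDiffAt ℝ ∞ v (extChartAt (𝓡 m) x₀ y))
    (hw : ContDiffAt ℝ ∞ w (extChartAt (𝓡 m) x₀ y)) :
    coframe x₀ y (VectorField.mlieBracket (𝓡 m) (coordField x₀ v) (coordField x₀ w) y)
      = fderiv ℝ w (extChartAt (𝓡 m) x₀ y) (v (extChartAt (𝓡 m) x₀ y))
        - fderiv ℝ v (extChartAt (𝓡 m) x₀ y) (w (extChartAt (𝓡 m) x₀ y)) := by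
  have ev : ∀ v, coordField x₀ v =ᶠ[𝓝 y] VectorField.mpullback (𝓡 m)
      𝓘(ℝ, EuclideanSpace ℝ (Fin m)) (extChartAt (𝓡 m) x₀) v := fun v => by
    filter_upwards [source_mem_nhds hy] with z hz using coordField_eq_mpullback hz
  have hmd : ∀ {v : EuclideanSpace ℝ (Fin m) → EuclideanSpace ℝ (Fin m)},
      ContDiffAt ℝ ∞ v (extChartAt (𝓡 m) x₀ y) →
      MDifferentiableAt 𝓘(ℝ, EuclideanSpace ℝ (Fin m)) 𝓘(ℝ, EuclideanSpace ℝ (Fin m)).tangent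
        (fun z => (⟨z, v z⟩ : TangentBundle 𝓘(ℝ, EuclideanSpace ℝ (Fin m))
          (EuclideanSpace ℝ (Fin m)))) (extChartAt (𝓡 m) x₀ y) := fun hv =>
    (contMDiffAt_vectorSpace_iff_contDiffAt.2 hv).mdifferentiableAt (by simp)
  have : IsManifold (𝓡 m) (minSmoothness ℝ 2) M :=
    IsManifold.of_le (n := ∞) (by simpa using ENat.LEInfty.out)
  have : IsManifold 𝓘(ℝ, EuclideanSpace ℝ (Fin m)) (minSmoothness ℝ 2)
      (EuclideanSpace ℝ (Fin m)) := inferInstance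
  have h1 := (ev v).mlieBracket_vectorField_eq (ev w)
  have h2 := VectorField.mpullback_mlieBracket (hmd hv) (hmd hw)
    (contMDiffAt_extChartAt_of_mem hy) (by simpa using ENat.LEInfty.out)
  have h3 : VectorField.mlieBracket 𝓘(ℝ, EuclideanSpace ℝ (Fin m)) v w
      = VectorField.lieBracket ℝ v w :=
    VectorField.mlieBracketWithin_univ.symm.trans
      (VectorField.mlieBracketWithin_eq_lieBracketWithin.trans VectorField.lieBracketWithin_univ)
  rw [h1, ← h2, h3]
  have h4 := coordField_eq_mpullback (v := VectorField.lieBracket ℝ v w) hy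
  exact (congrArg (coframe x₀ y) h4.symm).trans (coframe_coordField hy)

end CoordinateFrames

section ChartDomain

variable {m : ℕ} {M : Type*} [TopologicalSpace M]
  [ChartedSpace (EuclideanSpace ℝ (Fin m)) M] {x₀ y : M}

theorem contDiffOn_of_forall_source {F : Type*} [NormedAddCommGroup F] [NormedSpace ℝ F]
    {f : EuclideanSpace ℝ (Fin m) → F}
    (h : ∀ y ∈ (extChartAt (𝓡 m) x₀).source, ContDiffAt ℝ ∞ f (extChartAt (𝓡 m) x₀ y)) :
    ContDiffOn ℝ ∞ f (extChartAt (𝓡 m) x₀).target := fun p hp => by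
  have := h _ ((extChartAt (𝓡 m) x₀).map_target hp)
  rw [(extChartAt (𝓡 m) x₀).right_inv hp] at this
  exact this.contDiffWithinAt

theorem eventually_extChartAt {P : EuclideanSpace ℝ (Fin m) → Prop}
    (hy : y ∈ (extChartAt (𝓡 m) x₀).source)
    (h : ∀ z ∈ (extChartAt (𝓡 m) x₀).source, P (extChartAt (𝓡 m) x₀ z)) :
    ∀ᶠ p in 𝓝 (extChartAt (𝓡 m) x₀ y), P p := by
  filter_upwards [(isOpen_extChartAt_target x₀).mem_nhds
    ((extChartAt (𝓡 m) x₀).map_source hy)] with p hp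
  have := h _ ((extChartAt (𝓡 m) x₀).map_target hp)
  rwa [(extChartAt (𝓡 m) x₀).right_inv hp] at this

end ChartDomain

/-! ### Christoffel symbols of a connection. -/

section ConnectionCoefficients

variable {m : ℕ} {M : Type*} [TopologicalSpace M]
  [ChartedSpace (EuclideanSpace ℝ (Fin m)) M] [IsManifold (𝓡 m) ∞ M]

/-- The Christoffel symbols of a connection in the preferred chart at `x₀`. -/
def christoffel (cov : AffineConnection m M) (x₀ : M) (p : EuclideanSpace ℝ (Fin m)) :
    EuclideanSpace ℝ (Fin m) →L[ℝ] EuclideanSpace ℝ (Fin m) →L[ℝ] EuclideanSpace ℝ (Fin m) :=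
  (∑ i, (EuclideanSpace.proj i : EuclideanSpace ℝ (Fin m) →L[ℝ] ℝ).smulRight
    ((coframe x₀ ((extChartAt (𝓡 m) x₀).symm p)) ∘L
      (cov (coordField x₀ (fun _ => EuclideanSpace.single i 1)) ((extChartAt (𝓡 m) x₀).symm p)) ∘L
      (frame x₀ ((extChartAt (𝓡 m) x₀).symm p)))).flip

variable {x₀ y : M} {v w : EuclideanSpace ℝ (Fin m) → EuclideanSpace ℝ (Fin m)}

theorem christoffel_apply (cov : AffineConnection m M) (hy : y ∈ (extChartAt (𝓡 m) x₀).source)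
    (a b : EuclideanSpace ℝ (Fin m)) :
    christoffel cov x₀ (extChartAt (𝓡 m) x₀ y) a b = ∑ i, b i •
      coframe x₀ y (cov (coordField x₀ (fun _ => EuclideanSpace.single i 1)) y (frame x₀ y a)) := by
  rw [christoffel, (extChartAt (𝓡 m) x₀).left_inv hy]
  simp

theorem cov_congr (cov : AffineConnection m M) {X Y : ∀ x : M, TangentSpace (𝓡 m) x}
    (hX : SmoothFieldAt X y) (h : X =ᶠ[𝓝 y] Y) : cov X y = cov Y y := by
  have hY : SmoothFieldAt Y y := by
    refine ContMDiffAt.congr_of_eventuallyEq hX ?_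
    filter_upwards [h] with z hz
    rw [hz]
  exact cov.isCovariantDerivativeOn.congr_of_eventuallyEq hX.mdifferentiableAt
    hY.mdifferentiableAt Filter.univ_mem h

/-- The coordinate expression of a connection. -/
theorem cov_coordField (cov : AffineConnection m M) (hy : y ∈ (extChartAt (𝓡 m) x₀).source)
    (hv : ContDiffAt ℝ ∞ v (extChartAt (𝓡 m) x₀ y)) (a : EuclideanSpace ℝ (Fin m)) :
    coframe x₀ y (cov (coordField x₀ v) y (frame x₀ y a))
      = fderiv ℝ v (extChartAt (𝓡 m) x₀ y) a
        + christoffel cov x₀ (extChartAt (𝓡 m) x₀ y) a (v (extChartAt (𝓡 m) x₀ y)) := by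
  set p := extChartAt (𝓡 m) x₀ y with hp
  have hvi : ∀ i, ContDiffAt ℝ ∞ (fun q => v q i) p := fun i => by
    exact (EuclideanSpace.proj i : EuclideanSpace ℝ (Fin m) →L[ℝ] ℝ).contDiff.contDiffAt.comp p hv
  have term : ∀ i, coframe x₀ y (cov (coordField x₀ (fun q => v q i • EuclideanSpace.single i 1)) y
      (frame x₀ y a)) = fderiv ℝ (fun q => v q i) p a • EuclideanSpace.single i (1 : ℝ)
        + v p i • coframe x₀ y
          (cov (coordField x₀ (fun _ => EuclideanSpace.single i 1)) y (frame x₀ y a)) := fun i => by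
    have e : coordField x₀ (fun q => v q i • EuclideanSpace.single i 1)
        = (fun z => v (extChartAt (𝓡 m) x₀ z) i) •
          coordField x₀ (fun _ => EuclideanSpace.single i (1 : ℝ)) := by
      funext z
      simp [coordField]
    have hs : SmoothFieldAt (coordField x₀ (fun _ => EuclideanSpace.single i (1 : ℝ))) y :=
      smoothFieldAt_coordField hy contDiffAt_const
    have hg : ContMDiffAt (𝓡 m) 𝓘(ℝ, ℝ) ∞ (fun z => v (extChartAt (𝓡 m) x₀ z) i) y :=
      (hvi i).contMDiffAt.comp y (contMDiffAt_extChartAt_of_mem hy)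
    have h := cov.isCovariantDerivativeOn.leibniz (s := univ) hs.mdifferentiableAt
      (hg.mdifferentiableAt (by simp)) (by trivial)
    have hd := mvfderiv_comp_extChartAt hy ((hvi i).differentiableAt (by simp))
      Filter.EventuallyEq.rfl (frame x₀ y a)
    rw [coframe_frame hy] at hd
    rw [e, h]
    simp only [add_apply, smul_apply, ContinuousLinearMap.smulRight_apply, map_add, map_smul, hd,
      coframe_coordField hy]
    rw [add_comm]
  -- The connection is given only by additivity and the Leibniz rule, so the field is split as ∑
  -- vⁱeᵢ and the sum is built up one index at a time.
  have sum : ∀ s : Finset (Fin m), coframe x₀ y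
      (cov (coordField x₀ (fun q => ∑ i ∈ s, v q i • EuclideanSpace.single i 1)) y (frame x₀ y a))
      = ∑ i ∈ s, coframe x₀ y
        (cov (coordField x₀ (fun q => v q i • EuclideanSpace.single i 1)) y (frame x₀ y a)) := by
    intro s
    induction s using Finset.induction_on with
    | empty =>
      have e : coordField x₀ (fun q => ∑ i ∈ (∅ : Finset (Fin m)),
          v q i • EuclideanSpace.single i (1 : ℝ)) = 0 := by
        funext z; simp [coordField]
      rw [e, cov.zero]
      simp
    | insert j s hj ih =>
      have e : coordField x₀ (fun q => ∑ i ∈ insert j s, v q i • EuclideanSpace.single i (1 : ℝ))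
          = coordField x₀ (fun q => v q j • EuclideanSpace.single j (1 : ℝ))
            + coordField x₀ (fun q => ∑ i ∈ s, v q i • EuclideanSpace.single i (1 : ℝ)) := by
        funext z; simp [coordField, Finset.sum_insert hj]
      have h1 : SmoothFieldAt (coordField x₀
          (fun q => v q j • EuclideanSpace.single j (1 : ℝ))) y :=
        smoothFieldAt_coordField hy ((hvi j).smul contDiffAt_const)
      have h2 : SmoothFieldAt (coordField x₀
          (fun q => ∑ i ∈ s, v q i • EuclideanSpace.single i (1 : ℝ))) y :=
        smoothFieldAt_coordField hy (ContDiffAt.sum fun i _ => (hvi i).smul contDiffAt_const)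
      have h := cov.isCovariantDerivativeOn.add (s := univ) h1.mdifferentiableAt
        h2.mdifferentiableAt (by trivial)
      rw [e, h, Finset.sum_insert hj, add_apply, map_add, ih]
  have hsum : ∀ b : EuclideanSpace ℝ (Fin m), ∑ i, b i • EuclideanSpace.single i (1 : ℝ) = b :=
    fun b => by
      ext j
      simp [Pi.single_apply]
  have h := sum Finset.univ
  simp only [hsum, term, Finset.sum_add_distrib] at h
  rw [h, christoffel_apply cov hy]
  congr 1
  rw [← hsum (fderiv ℝ v p a)]
  refine Finset.sum_congr rfl fun i _ => ?_
  have := ((EuclideanSpace.proj i : EuclideanSpace ℝ (Fin m) →L[ℝ] ℝ).hasFDerivAt.comp p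
    (hv.differentiableAt (by simp)).hasFDerivAt)
  have h2 : fderiv ℝ (fun q => v q i) p = _ := this.fderiv
  rw [h2]
  simp

/-- Near y a smooth field is the coordinate field of its own components, so locality of the
connection extends the coordinate formula to it. -/
theorem cov_eq_coordField (cov : AffineConnection m M) (hy : y ∈ (extChartAt (𝓡 m) x₀).source)
    {X : ∀ x : M, TangentSpace (𝓡 m) x} (hX : SmoothFieldAt X y)
    (u : TangentSpace (𝓡 m) y) :
    coframe x₀ y (cov X y u) = fderiv ℝ (components x₀ X) (extChartAt (𝓡 m) x₀ y) (coframe x₀ y u)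
      + christoffel cov x₀ (extChartAt (𝓡 m) x₀ y) (coframe x₀ y u) (coframe x₀ y (X y)) := by
  have h1 : X =ᶠ[𝓝 y] coordField x₀ (components x₀ X) := by
    filter_upwards [source_mem_nhds hy] with z hz using (coordField_components X hz).symm
  rw [cov_congr cov hX h1]
  have h2 := cov_coordField cov hy (contDiffAt_components hy hX) (coframe x₀ y u)
  rw [frame_coframe hy] at h2
  rw [h2, components, (extChartAt (𝓡 m) x₀).left_inv hy]

theorem cov_coordField_const (cov : AffineConnection m M)
    (hy : y ∈ (extChartAt (𝓡 m) x₀).source) (a b : EuclideanSpace ℝ (Fin m)) :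
    cov (coordField x₀ fun _ => b) y (frame x₀ y a)
      = frame x₀ y (christoffel cov x₀ (extChartAt (𝓡 m) x₀ y) a b) := by
  refine coframe_injective hy ?_
  rw [cov_coordField cov hy contDiffAt_const, coframe_frame hy]
  simp

end ConnectionCoefficients

/-! ### Components of the metric. -/

section MetricCoefficients

variable {m : ℕ} {M : Type*} [TopologicalSpace M]
  [ChartedSpace (EuclideanSpace ℝ (Fin m)) M] [IsManifold (𝓡 m) ∞ M]
  [RiemannianBundle (fun x : M => TangentSpace (𝓡 m) x)]

/-- The components of the metric in the preferred chart at `x₀`. -/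
def metricCoeff (x₀ : M) (p : EuclideanSpace ℝ (Fin m)) :
    EuclideanSpace ℝ (Fin m) →L[ℝ] EuclideanSpace ℝ (Fin m) →L[ℝ] ℝ :=
  (LinearMap.mk₂ ℝ (fun a b => (inner ℝ (frame x₀ ((extChartAt (𝓡 m) x₀).symm p) a)
    (frame x₀ ((extChartAt (𝓡 m) x₀).symm p) b) : ℝ))
    (fun a b c => by rw [map_add, inner_add_left])
    (fun a b c => by rw [map_smul, real_inner_smul_left, smul_eq_mul])
    (fun a b c => by rw [map_add, inner_add_right])
    (fun a b c => by rw [map_smul, real_inner_smul_right, smul_eq_mul])).toContinuousBilinearMap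

variable {x₀ y : M}

theorem metricCoeff_apply (hy : y ∈ (extChartAt (𝓡 m) x₀).source)
    (a b : EuclideanSpace ℝ (Fin m)) :
    metricCoeff x₀ (extChartAt (𝓡 m) x₀ y) a b = inner ℝ (frame x₀ y a) (frame x₀ y b) := by
  -- The fibre and its inner product depend on the base point, so the point is generalized before it
  -- is identified with y.
  have h : ∀ z : M, z = y → (inner ℝ (frame x₀ z a) (frame x₀ z b) : ℝ)
      = inner ℝ (frame x₀ y a) (frame x₀ y b) := fun z hz => by rw [hz]
  exact h _ ((extChartAt (𝓡 m) x₀).left_inv hy)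

theorem metricCoeff_coframe (hy : y ∈ (extChartAt (𝓡 m) x₀).source)
    (u v : TangentSpace (𝓡 m) y) :
    metricCoeff x₀ (extChartAt (𝓡 m) x₀ y) (coframe x₀ y u) (coframe x₀ y v) = inner ℝ u v := by
  rw [metricCoeff_apply hy, frame_coframe hy, frame_coframe hy]

end MetricCoefficients

/-! ### Levi-Civita connection and curvature tensor in charts. -/

section LeviCivitaCoordinates

variable {m : ℕ} {M : Type*} [TopologicalSpace M]
  [ChartedSpace (EuclideanSpace ℝ (Fin m)) M] [IsManifold (𝓡 m) ∞ M]
  {x₀ y : M}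

theorem mlieBracket_coordField_const (hy : y ∈ (extChartAt (𝓡 m) x₀).source)
    (a b : EuclideanSpace ℝ (Fin m)) :
    VectorField.mlieBracket (𝓡 m) (coordField x₀ fun _ => a) (coordField x₀ fun _ => b) y = 0 := by
  refine coframe_injective hy ?_
  rw [mlieBracket_coordField hy contDiffAt_const contDiffAt_const]
  simp

variable [RiemannianBundle (fun x : M => TangentSpace (𝓡 m) x)]

theorem contDiffOn_metricCoeff
    [IsContMDiffRiemannianBundle (𝓡 m) ∞ (EuclideanSpace ℝ (Fin m))
      (fun x : M => TangentSpace (𝓡 m) x)] (x₀ : M) :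
    ContDiffOn ℝ ∞ (metricCoeff x₀) (extChartAt (𝓡 m) x₀).target := by
  refine contDiffOn_clm_apply.2 fun a => contDiffOn_clm_apply.2 fun b => ?_
  intro p hp
  have hy := (extChartAt (𝓡 m) x₀).map_target hp
  have h : ∀ a : EuclideanSpace ℝ (Fin m),
      SmoothFieldAt (coordField x₀ fun _ => a) ((extChartAt (𝓡 m) x₀).symm p) := fun a =>
    smoothFieldAt_coordField hy contDiffAt_const
  have h1 : ContMDiffAt (𝓡 m) 𝓘(ℝ, ℝ) ∞ (fun z : M => (inner ℝ
      (coordField x₀ (fun _ => a) z) (coordField x₀ (fun _ => b) z) : ℝ))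
      ((extChartAt (𝓡 m) x₀).symm p) :=
    ContMDiffAt.inner_bundle (h a) (h b)
  exact (contDiffAt_comp_extChartAt_symm hp h1).contDiffWithinAt

/-- Evaluated at constant a and b, the symbol gives the components of ∇_{e_a} e_b, which are smooth
because the connection is; in finite dimension these evaluations determine smoothness. -/
theorem IsLeviCivita.contDiffOn_christoffel {cov : AffineConnection m M} (hcov : IsLeviCivita cov)
    (x₀ : M) : ContDiffOn ℝ ∞ (christoffel cov x₀) (extChartAt (𝓡 m) x₀).target := by
  refine contDiffOn_clm_apply.2 fun a => contDiffOn_clm_apply.2 fun b => ?_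
  refine contDiffOn_of_forall_source fun y hy => ?_
  have h : ∀ a : EuclideanSpace ℝ (Fin m), SmoothFieldAt (coordField x₀ fun _ => a) y := fun a =>
    smoothFieldAt_coordField hy contDiffAt_const
  refine (contDiffAt_components hy (hcov.smooth _ _ y (h a) (h b))).congr_of_eventuallyEq ?_
  refine eventually_extChartAt hy fun z hz => ?_
  rw [components, (extChartAt (𝓡 m) x₀).left_inv hz, coordField, cov_coordField_const cov hz,
    coframe_frame hz]

/-- The coordinate expressions of the metric and of its Levi-Civita connection. -/
theorem IsLeviCivita.localLeviCivita
    [IsContMDiffRiemannianBundle (𝓡 m) ∞ (EuclideanSpace ℝ (Fin m))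
      (fun x : M => TangentSpace (𝓡 m) x)]
    {cov : AffineConnection m M} (hcov : IsLeviCivita cov)
    (x₀ : M) :
    LocalLeviCivita (extChartAt (𝓡 m) x₀).target (metricCoeff x₀) (christoffel cov x₀) where
  isOpen := isOpen_extChartAt_target x₀
  smooth_g := contDiffOn_metricCoeff x₀
  smooth_C := hcov.contDiffOn_christoffel x₀
  g_symm p hp u v := by
    obtain ⟨y, hy, rfl⟩ : ∃ y ∈ (extChartAt (𝓡 m) x₀).source, extChartAt (𝓡 m) x₀ y = p :=
      ⟨_, (extChartAt (𝓡 m) x₀).map_target hp, (extChartAt (𝓡 m) x₀).right_inv hp⟩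
    rw [metricCoeff_apply hy, metricCoeff_apply hy, real_inner_comm]
  g_pos p hp u hu := by
    obtain ⟨y, hy, rfl⟩ : ∃ y ∈ (extChartAt (𝓡 m) x₀).source, extChartAt (𝓡 m) x₀ y = p :=
      ⟨_, (extChartAt (𝓡 m) x₀).map_target hp, (extChartAt (𝓡 m) x₀).right_inv hp⟩
    rw [metricCoeff_apply hy]
    refine real_inner_self_pos.2 fun h => hu ?_
    rw [← coframe_frame hy u, h, map_zero]
  C_symm p hp u v := by
    obtain ⟨y, hy, rfl⟩ : ∃ y ∈ (extChartAt (𝓡 m) x₀).source, extChartAt (𝓡 m) x₀ y = p :=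
      ⟨_, (extChartAt (𝓡 m) x₀).map_target hp, (extChartAt (𝓡 m) x₀).right_inv hp⟩
    have h : ∀ a : EuclideanSpace ℝ (Fin m), SmoothFieldAt (coordField x₀ fun _ => a) y := fun a =>
      smoothFieldAt_coordField hy contDiffAt_const
    have h1 := hcov.torsion_free _ _ y (h u) (h v)
    rw [mlieBracket_coordField_const hy, sub_eq_zero] at h1
    have h2 := congrArg (coframe x₀ y) h1
    rwa [coordField, coordField, cov_coordField_const cov hy, cov_coordField_const cov hy,
      coframe_frame hy, coframe_frame hy] at h2
  metric p hp w u v := by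
    obtain ⟨y, hy, rfl⟩ : ∃ y ∈ (extChartAt (𝓡 m) x₀).source, extChartAt (𝓡 m) x₀ y = p :=
      ⟨_, (extChartAt (𝓡 m) x₀).map_target hp, (extChartAt (𝓡 m) x₀).right_inv hp⟩
    have h : ∀ a : EuclideanSpace ℝ (Fin m), SmoothFieldAt (coordField x₀ fun _ => a) y := fun a =>
      smoothFieldAt_coordField hy contDiffAt_const
    have h1 := hcov.metric _ _ y (frame x₀ y w) (h u) (h v)
    have hg := ((contDiffOn_metricCoeff x₀).contDiffAt
      ((isOpen_extChartAt_target x₀).mem_nhds hp)).differentiableAt (by simp)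
    have hd := (hg.hasFDerivAt.clm_apply (hasFDerivAt_const u _)).clm_apply (hasFDerivAt_const v _)
    rw [mvfderiv_comp_extChartAt hy hd.differentiableAt ?_, coframe_frame hy, hd.fderiv,
      coordField, coordField, cov_coordField_const cov hy, cov_coordField_const cov hy] at h1
    · rw [metricCoeff_apply hy, metricCoeff_apply hy, ← h1]
      simp
    · filter_upwards [source_mem_nhds hy] with z hz
      rw [metricCoeff_apply hz]
      rfl

/-- The coordinate expression of the curvature tensor. -/
theorem IsLeviCivita.coframe_curvatureTensor {cov : AffineConnection m M} (hcov : IsLeviCivita cov)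
    (x₀ : M) (u v w : TangentSpace (𝓡 m) x₀) :
    coframe x₀ x₀ (curvatureTensor cov x₀ u v w)
      = localCurvature (christoffel cov x₀) (extChartAt (𝓡 m) x₀ x₀) (coframe x₀ x₀ u)
        (coframe x₀ x₀ v) (coframe x₀ x₀ w) := by
  have hy : x₀ ∈ (extChartAt (𝓡 m) x₀).source := mem_extChartAt_source x₀
  have hC := ((hcov.contDiffOn_christoffel x₀).contDiffAt
    ((isOpen_extChartAt_target x₀).mem_nhds ((extChartAt (𝓡 m) x₀).map_source hy)))
  -- The extensions used to define the curvature at x₀ are, on the chart domain, the fields with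
  -- constant components. This is why the formula is stated at the chart centre.
  have hext : ∀ (u : TangentSpace (𝓡 m) x₀), ∀ z ∈ (extChartAt (𝓡 m) x₀).source,
      coordField x₀ (fun _ => coframe x₀ x₀ u) z
        = FiberBundle.extend (EuclideanSpace ℝ (Fin m)) u z := fun u z hz => by
    rw [coordField, coframe_apply hy, frame,
      Trivialization.symmL_apply _ (mem_trivializationAt_baseSet hz)]
    rfl
  have hext' : ∀ (u : TangentSpace (𝓡 m) x₀), ∀ z ∈ (extChartAt (𝓡 m) x₀).source,
      (coordField x₀ fun _ => coframe x₀ x₀ u) =ᶠ[𝓝 z]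
        (FiberBundle.extend (EuclideanSpace ℝ (Fin m)) u : ∀ y : M, TangentSpace (𝓡 m) y) :=
      fun u z hz => by
    filter_upwards [source_mem_nhds hz] with z' hz' using hext u z' hz'
  have key : ∀ a b c : EuclideanSpace ℝ (Fin m), coframe x₀ x₀
      (cov (fun y => cov (coordField x₀ fun _ => c) y (coordField x₀ (fun _ => b) y)) x₀
        (frame x₀ x₀ a))
      = fderiv ℝ (christoffel cov x₀) (extChartAt (𝓡 m) x₀ x₀) a b c
        + christoffel cov x₀ (extChartAt (𝓡 m) x₀ x₀) a
          (christoffel cov x₀ (extChartAt (𝓡 m) x₀ x₀) b c) := fun a b c => by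
    have hs : ∀ a : EuclideanSpace ℝ (Fin m), SmoothFieldAt (coordField x₀ fun _ => a) x₀ :=
      fun a => smoothFieldAt_coordField hy contDiffAt_const
    have e : (fun y => cov (coordField x₀ fun _ => c) y (coordField x₀ (fun _ => b) y))
        =ᶠ[𝓝 x₀] coordField x₀ (fun p => christoffel cov x₀ p b c) := by
      filter_upwards [source_mem_nhds hy] with z hz
      rw [coordField, cov_coordField_const cov hz, coordField]
    have hd := ((hC.differentiableAt (by simp)).hasFDerivAt.clm_apply
      (hasFDerivAt_const b _)).clm_apply (hasFDerivAt_const c _)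
    rw [cov_congr cov (hcov.smooth _ _ x₀ (hs b) (hs c)) e, cov_coordField cov hy
      ((hC.clm_apply contDiffAt_const).clm_apply contDiffAt_const), hd.fderiv]
    simp
  have hcov₂ : ∀ v w : TangentSpace (𝓡 m) x₀,
      cov (fun y => cov (coordField x₀ fun _ => coframe x₀ x₀ w) y
        (coordField x₀ (fun _ => coframe x₀ x₀ v) y)) x₀
      = cov (fun y => cov (FiberBundle.extend (EuclideanSpace ℝ (Fin m)) w) y
        (FiberBundle.extend (EuclideanSpace ℝ (Fin m)) v y)) x₀ := fun v w => by
    refine cov_congr cov (hcov.smooth _ _ x₀ (smoothFieldAt_coordField hy contDiffAt_const)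
      (smoothFieldAt_coordField hy contDiffAt_const)) ?_
    filter_upwards [source_mem_nhds hy] with z hz
    rw [cov_congr cov (smoothFieldAt_coordField hz contDiffAt_const) (hext' w z hz), hext v z hz]
  rw [curvatureTensor, ← hcov₂, ← hcov₂,
    ← (hext' u x₀ hy).mlieBracket_vectorField_eq (hext' v x₀ hy),
    mlieBracket_coordField_const hy, map_zero, sub_zero, map_sub]
  have h1 := key (coframe x₀ x₀ u) (coframe x₀ x₀ v) (coframe x₀ x₀ w)
  have h2 := key (coframe x₀ x₀ v) (coframe x₀ x₀ u) (coframe x₀ x₀ w)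
  rw [frame_coframe hy] at h1 h2
  rw [h1, h2, localCurvature]
  abel

end LeviCivitaCoordinates

/-! ### Sasakian structures in charts and the resulting constant curvature. -/

namespace AlmostContactMetricStructure

variable {n : ℕ} {M : Type*} [TopologicalSpace M]
  [ChartedSpace (EuclideanSpace ℝ (Fin (2 * n + 1))) M] [IsManifold (𝓡 (2 * n + 1)) ∞ M]
  [RiemannianBundle (fun x : M => TangentSpace (𝓡 (2 * n + 1)) x)]
  (S : AlmostContactMetricStructure n M)

/-- The components of `φ` in the preferred chart at `x₀`. -/
def coordφ (x₀ : M) (p : EuclideanSpace ℝ (Fin (2 * n + 1))) :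
    EuclideanSpace ℝ (Fin (2 * n + 1)) →L[ℝ] EuclideanSpace ℝ (Fin (2 * n + 1)) :=
  (coframe x₀ ((extChartAt (𝓡 (2 * n + 1)) x₀).symm p)) ∘L
    (S.φ ((extChartAt (𝓡 (2 * n + 1)) x₀).symm p)) ∘L
    (frame x₀ ((extChartAt (𝓡 (2 * n + 1)) x₀).symm p))

/-- The components of `η` in the preferred chart at `x₀`. -/
def coordη (x₀ : M) (p : EuclideanSpace ℝ (Fin (2 * n + 1))) :
    EuclideanSpace ℝ (Fin (2 * n + 1)) →L[ℝ] ℝ :=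
  (S.η ((extChartAt (𝓡 (2 * n + 1)) x₀).symm p)) ∘L
    (frame x₀ ((extChartAt (𝓡 (2 * n + 1)) x₀).symm p))

variable {x₀ y : M}

theorem coordφ_apply (hy : y ∈ (extChartAt (𝓡 (2 * n + 1)) x₀).source)
    (a : EuclideanSpace ℝ (Fin (2 * n + 1))) :
    S.coordφ x₀ (extChartAt (𝓡 (2 * n + 1)) x₀ y) a = coframe x₀ y (S.φ y (frame x₀ y a)) := by
  rw [coordφ, (extChartAt (𝓡 (2 * n + 1)) x₀).left_inv hy]
  rfl

theorem coordη_apply (hy : y ∈ (extChartAt (𝓡 (2 * n + 1)) x₀).source)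
    (a : EuclideanSpace ℝ (Fin (2 * n + 1))) :
    S.coordη x₀ (extChartAt (𝓡 (2 * n + 1)) x₀ y) a = S.η y (frame x₀ y a) := by
  rw [coordη, (extChartAt (𝓡 (2 * n + 1)) x₀).left_inv hy]
  rfl

theorem coordξ_apply (hy : y ∈ (extChartAt (𝓡 (2 * n + 1)) x₀).source) :
    components x₀ S.ξ (extChartAt (𝓡 (2 * n + 1)) x₀ y) = coframe x₀ y (S.ξ y) := by
  rw [components, (extChartAt (𝓡 (2 * n + 1)) x₀).left_inv hy]

theorem contDiffOn_coordφ (x₀ : M) :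
    ContDiffOn ℝ ∞ (S.coordφ x₀) (extChartAt (𝓡 (2 * n + 1)) x₀).target := by
  refine contDiffOn_clm_apply.2 fun a => contDiffOn_of_forall_source fun y hy => ?_
  have h : SmoothFieldAt (coordField x₀ fun _ => a) y :=
    smoothFieldAt_coordField hy contDiffAt_const
  exact contDiffAt_components hy (S.smooth_φ _ y h)

theorem contDiffOn_coordη (x₀ : M) :
    ContDiffOn ℝ ∞ (S.coordη x₀) (extChartAt (𝓡 (2 * n + 1)) x₀).target := by
  refine contDiffOn_clm_apply.2 fun a p hp => ?_
  have h : SmoothFieldAt (coordField x₀ fun _ => a) ((extChartAt (𝓡 (2 * n + 1)) x₀).symm p) :=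
    smoothFieldAt_coordField ((extChartAt (𝓡 (2 * n + 1)) x₀).map_target hp) contDiffAt_const
  exact (contDiffAt_comp_extChartAt_symm hp (S.smooth_η _ _ h)).contDiffWithinAt

theorem φ_coordField_eventuallyEq (hy : y ∈ (extChartAt (𝓡 (2 * n + 1)) x₀).source)
    (a : EuclideanSpace ℝ (Fin (2 * n + 1))) :
    (fun z => S.φ z (coordField x₀ (fun _ => a) z)) =ᶠ[𝓝 y]
      coordField x₀ (fun p => S.coordφ x₀ p a) := by
  filter_upwards [source_mem_nhds hy] with z hz
  rw [coordField, coordField, S.coordφ_apply hz, frame_coframe hz]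

variable [IsContMDiffRiemannianBundle (𝓡 (2 * n + 1)) ∞ (EuclideanSpace ℝ (Fin (2 * n + 1)))
      (fun x : M => TangentSpace (𝓡 (2 * n + 1)) x)]

/-- The coordinate expression of a Sasakian structure. -/
theorem localSasakian {cov : AffineConnection (2 * n + 1) M} (hcov : IsLeviCivita cov)
    (hS : S.IsSasakian) (x₀ : M) :
    LocalSasakian (extChartAt (𝓡 (2 * n + 1)) x₀).target (metricCoeff x₀) (christoffel cov x₀)
      (S.coordφ x₀) (components x₀ S.ξ) (S.coordη x₀) where
  toLocalLeviCivita := hcov.localLeviCivita x₀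
  smooth_φ := S.contDiffOn_coordφ x₀
  smooth_ξ := contDiffOn_of_forall_source fun y hy => contDiffAt_components hy (S.smooth_ξ y)
  smooth_η := S.contDiffOn_coordη x₀
  η_ξ p hp := by
    obtain ⟨y, hy, rfl⟩ : ∃ y ∈ (extChartAt (𝓡 (2 * n + 1)) x₀).source,
        extChartAt (𝓡 (2 * n + 1)) x₀ y = p :=
      ⟨_, (extChartAt (𝓡 _) x₀).map_target hp, (extChartAt (𝓡 _) x₀).right_inv hp⟩
    rw [S.coordξ_apply hy, S.coordη_apply hy, frame_coframe hy, S.η_ξ]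
  φ_φ p hp u := by
    obtain ⟨y, hy, rfl⟩ : ∃ y ∈ (extChartAt (𝓡 (2 * n + 1)) x₀).source,
        extChartAt (𝓡 (2 * n + 1)) x₀ y = p :=
      ⟨_, (extChartAt (𝓡 _) x₀).map_target hp, (extChartAt (𝓡 _) x₀).right_inv hp⟩
    rw [S.coordξ_apply hy, S.coordη_apply hy, S.coordφ_apply hy, S.coordφ_apply hy,
      frame_coframe hy, S.φ_φ, map_add, map_neg, map_smul, coframe_frame hy]
  compatible p hp u v := by
    obtain ⟨y, hy, rfl⟩ : ∃ y ∈ (extChartAt (𝓡 (2 * n + 1)) x₀).source,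
        extChartAt (𝓡 (2 * n + 1)) x₀ y = p :=
      ⟨_, (extChartAt (𝓡 _) x₀).map_target hp, (extChartAt (𝓡 _) x₀).right_inv hp⟩
    rw [S.coordη_apply hy, S.coordη_apply hy, S.coordφ_apply hy, S.coordφ_apply hy,
      metricCoeff_coframe hy, S.compatible, metricCoeff_apply hy]
  contact p hp u v := by
    obtain ⟨y, hy, rfl⟩ : ∃ y ∈ (extChartAt (𝓡 (2 * n + 1)) x₀).source,
        extChartAt (𝓡 (2 * n + 1)) x₀ y = p :=
      ⟨_, (extChartAt (𝓡 _) x₀).map_target hp, (extChartAt (𝓡 _) x₀).right_inv hp⟩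
    have h : ∀ a : EuclideanSpace ℝ (Fin (2 * n + 1)),
        SmoothFieldAt (coordField x₀ fun _ => a) y := fun a =>
      smoothFieldAt_coordField hy contDiffAt_const
    have hη := ((S.contDiffOn_coordη x₀).contDiffAt
      ((isOpen_extChartAt_target x₀).mem_nhds hp)).differentiableAt (by simp)
    have hd : ∀ a b, mvfderiv (𝓡 (2 * n + 1)) (fun z => S.η z (coordField x₀ (fun _ => a) z)) y
        (coordField x₀ (fun _ => b) y)
        = fderiv ℝ (S.coordη x₀) (extChartAt (𝓡 (2 * n + 1)) x₀ y) b a := fun a b => by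
      have hd := hη.hasFDerivAt.clm_apply (hasFDerivAt_const a _)
      rw [mvfderiv_comp_extChartAt hy hd.differentiableAt, coframe_coordField hy, hd.fderiv]
      · simp
      · filter_upwards [source_mem_nhds hy] with z hz
        rw [S.coordη_apply hz]
        rfl
    have h1 := hS.contactMetric _ _ y (h u) (h v)
    rw [dη, hd, hd, mlieBracket_coordField_const hy, map_zero] at h1
    rw [S.coordφ_apply hy]
    have h2 : (inner ℝ (coordField x₀ (fun _ => u) y) (S.φ y (coordField x₀ (fun _ => v) y)) : ℝ)
        = metricCoeff x₀ (extChartAt (𝓡 (2 * n + 1)) x₀ y) u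
          (coframe x₀ y (S.φ y (frame x₀ y v))) := by
      rw [metricCoeff_apply hy, frame_coframe hy]
      rfl
    rw [← h2, ← h1]
    ring
  normal p hp u v := by
    obtain ⟨y, hy, rfl⟩ : ∃ y ∈ (extChartAt (𝓡 (2 * n + 1)) x₀).source,
        extChartAt (𝓡 (2 * n + 1)) x₀ y = p :=
      ⟨_, (extChartAt (𝓡 _) x₀).map_target hp, (extChartAt (𝓡 _) x₀).right_inv hp⟩
    have h : ∀ a : EuclideanSpace ℝ (Fin (2 * n + 1)),
        SmoothFieldAt (coordField x₀ fun _ => a) y := fun a =>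
      smoothFieldAt_coordField hy contDiffAt_const
    have hφ := (S.contDiffOn_coordφ x₀).contDiffAt ((isOpen_extChartAt_target x₀).mem_nhds hp)
    have hφa : ∀ a, ContDiffAt ℝ ∞ (fun p => S.coordφ x₀ p a)
        (extChartAt (𝓡 (2 * n + 1)) x₀ y) := fun a => hφ.clm_apply contDiffAt_const
    have hd : ∀ a b, fderiv ℝ (fun p => S.coordφ x₀ p a) (extChartAt (𝓡 (2 * n + 1)) x₀ y) b
        = fderiv ℝ (S.coordφ x₀) (extChartAt (𝓡 (2 * n + 1)) x₀ y) b a := fun a b => by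
      have := (hφ.differentiableAt (by simp)).hasFDerivAt.clm_apply (hasFDerivAt_const a _)
      rw [this.fderiv]
      simp
    have e := S.φ_coordField_eventuallyEq hy
    have b1 := mlieBracket_coordField hy (hφa u) (hφa v)
    have b2 := mlieBracket_coordField (w := fun _ => v) hy (hφa u) contDiffAt_const
    have b3 := mlieBracket_coordField (v := fun _ => u) hy contDiffAt_const (hφa v)
    rw [← (e u).mlieBracket_vectorField_eq (e v), hd, hd] at b1
    rw [← (e u).mlieBracket_vectorField_eq
      (Filter.EventuallyEq.refl (𝓝 y) (coordField x₀ fun _ => v)), hd] at b2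
    rw [← (Filter.EventuallyEq.refl (𝓝 y) (coordField x₀ fun _ => u)).mlieBracket_vectorField_eq
      (e v), hd] at b3
    have h1 := hS.normal _ _ y (h u) (h v)
    simp only [nijenhuis] at h1
    rw [hS.contactMetric _ _ y (h u) (h v), mlieBracket_coordField_const hy, map_zero, map_zero,
      zero_add] at h1
    have h2 := congrArg (coframe x₀ y) h1
    have comp : ∀ a : TangentSpace (𝓡 (2 * n + 1)) y, coframe x₀ y (S.φ y a)
        = S.coordφ x₀ (extChartAt (𝓡 (2 * n + 1)) x₀ y) (coframe x₀ y a) := fun a => by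
      rw [S.coordφ_apply hy, frame_coframe hy]
    rw [map_sub, map_sub, map_smul, comp, comp, b1, b2, b3, ← S.coordξ_apply hy,
      ← metricCoeff_coframe hy, comp, coframe_coordField hy, coframe_coordField hy] at h2
    rw [← h2]
    simp

/-- A Sasakian space form with `c = 1` has constant sectional curvature `1`. -/
theorem curvatureTensor_eq {cov : AffineConnection (2 * n + 1) M} (hcov : IsLeviCivita cov)
    (hS : S.IsSasakian) (hc : S.HasConstantPhiSectionalCurvature cov 1) (x₀ : M)
    (u v w : EuclideanSpace ℝ (Fin (2 * n + 1))) :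
    localCurvature (christoffel cov x₀) (extChartAt (𝓡 (2 * n + 1)) x₀ x₀) u v w
      = metricCoeff x₀ (extChartAt (𝓡 (2 * n + 1)) x₀ x₀) v w • u
        - metricCoeff x₀ (extChartAt (𝓡 (2 * n + 1)) x₀ x₀) u w • v := by
  have hy : x₀ ∈ (extChartAt (𝓡 (2 * n + 1)) x₀).source := mem_extChartAt_source x₀
  have hp := (extChartAt (𝓡 (2 * n + 1)) x₀).map_source hy
  have hL := S.localSasakian hcov hS x₀
  refine hL.curvature_eq hp (fun a ha => ?_) u v w
  by_cases h0 : a = 0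
  · simp [h0]
  set u := frame x₀ x₀ a with hu
  have hau : a = coframe x₀ x₀ u := (coframe_frame hy a).symm
  have hu0 : u ≠ 0 := fun h => h0 (by rw [hau, h, map_zero])
  have huξ : (inner ℝ u (S.ξ x₀) : ℝ) = 0 := by
    rw [← metricCoeff_coframe hy, ← hau, ← S.coordξ_apply hy, ha]
  have h1 := hc x₀ u hu0 huξ
  have hη : S.η x₀ u = 0 := by
    have := hL.η_eq hp a
    rw [ha, S.coordη_apply hy] at this
    exact this
  have hφ : coframe x₀ x₀ (S.φ x₀ u)
      = S.coordφ x₀ (extChartAt (𝓡 (2 * n + 1)) x₀ x₀) a := (S.coordφ_apply hy a).symm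
  have h2 : ‖S.φ x₀ u‖ ^ 2 = ‖u‖ ^ 2 := by
    rw [← real_inner_self_eq_norm_sq, ← real_inner_self_eq_norm_sq, S.compatible, hη]
    ring
  have h3 : (inner ℝ u (S.φ x₀ u) : ℝ) = 0 := by
    have h4 := hL.inner_φ hp a a
    rw [hL.g_symm _ hp] at h4
    rw [← metricCoeff_coframe hy, hφ, ← hau]
    linarith
  have h5 : ‖u‖ ≠ 0 := norm_ne_zero_iff.2 hu0
  -- Since φu has the length of u and is orthogonal to it, the denominator is ‖u‖⁴, which is
  -- nonzero.
  rw [sectionalCurvature, h2, h3, div_eq_one_iff_eq (by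
    have := pow_ne_zero 2 h5
    simp [this])] at h1
  have h6 : metricCoeff x₀ (extChartAt (𝓡 (2 * n + 1)) x₀ x₀) a a = ‖u‖ ^ 2 := by
    rw [metricCoeff_apply hy, real_inner_self_eq_norm_sq]
  rw [← metricCoeff_coframe hy, hcov.coframe_curvatureTensor, hφ, ← hau] at h1
  rw [h1, h6]
  ring

end AlmostContactMetricStructure

/-! ### Smooth fields along curves and their covariant derivatives. -/

section AlongCurves

variable {m : ℕ} {M : Type*} [TopologicalSpace M]
  [ChartedSpace (EuclideanSpace ℝ (Fin m)) M] [IsManifold (𝓡 m) ∞ M]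
  {γ : ℝ → M} {V W : ∀ t, TangentSpace (𝓡 m) (γ t)} {J : Set ℝ} {x₀ : M} {t : ℝ}

/-- The components of the field `V` along the curve `γ` in the preferred chart at `x₀`. -/
def coordAlong (x₀ : M) (γ : ℝ → M) (V : ∀ t, TangentSpace (𝓡 m) (γ t)) (t : ℝ) :
    EuclideanSpace ℝ (Fin m) :=
  coframe x₀ (γ t) (V t)

theorem SmoothCurveOn.contMDiffAt {m : ℕ} {M : Type*} [TopologicalSpace M]
    [ChartedSpace (EuclideanSpace ℝ (Fin m)) M] {γ : ℝ → M} {J : Set ℝ} {t : ℝ}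
    (h : SmoothCurveOn m γ J) (hJ : IsOpen J) (ht : t ∈ J) :
    ContMDiffAt 𝓘(ℝ, ℝ) (𝓡 m) ∞ γ t :=
  ContMDiffOn.contMDiffAt h (hJ.mem_nhds ht)

theorem ContMDiffAt.eventually_source {m : ℕ} {M : Type*} [TopologicalSpace M]
    [ChartedSpace (EuclideanSpace ℝ (Fin m)) M] {x₀ : M}
    {P : Type*} [NormedAddCommGroup P] [NormedSpace ℝ P] {f : P → M} {q : P}
    (hf : ContMDiffAt 𝓘(ℝ, P) (𝓡 m) ∞ f q) (hq : f q ∈ (extChartAt (𝓡 m) x₀).source) :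
    ∀ᶠ q' in 𝓝 q, f q' ∈ (extChartAt (𝓡 m) x₀).source :=
  hf.continuousAt.eventually (source_mem_nhds hq)

theorem ContMDiffAt.contDiffAt_extChartAt
    {P : Type*} [NormedAddCommGroup P] [NormedSpace ℝ P] {f : P → M} {q : P}
    (hf : ContMDiffAt 𝓘(ℝ, P) (𝓡 m) ∞ f q) (hq : f q ∈ (extChartAt (𝓡 m) x₀).source) :
    ContDiffAt ℝ ∞ (fun q => extChartAt (𝓡 m) x₀ (f q)) q :=
  ((contMDiffAt_extChartAt_of_mem hq).comp q hf).contDiffAt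

theorem coframe_velocity (hγ : MDifferentiableAt 𝓘(ℝ, ℝ) (𝓡 m) γ t)
    (ht : γ t ∈ (extChartAt (𝓡 m) x₀).source) :
    coframe x₀ (γ t) (velocity γ t) = deriv (fun s => extChartAt (𝓡 m) x₀ (γ s)) t := by
  have h1 := (contMDiffAt_extChartAt_of_mem ht).mdifferentiableAt (by simp)
  have h2 : mfderiv 𝓘(ℝ, ℝ) 𝓘(ℝ, EuclideanSpace ℝ (Fin m))
      (fun s => extChartAt (𝓡 m) x₀ (γ s)) t = _ := mfderiv_comp t h1 hγ
  rw [mfderiv_eq_fderiv, mfderiv_extChartAt_eq_coframe ht] at h2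
  rw [← fderiv_apply_one_eq_deriv, h2]
  rfl

theorem smoothFieldAlongOn_iff (hJ : IsOpen J) :
    SmoothFieldAlongOn γ V J ↔ SmoothCurveOn m γ J ∧
      ∀ t ∈ J, ContDiffAt ℝ ∞ (coordAlong (γ t) γ V) t := by
  have key : ∀ t ∈ J, ContMDiffAt 𝓘(ℝ, ℝ) (𝓡 m).tangent ∞
      (fun t => (⟨γ t, V t⟩ : TangentBundle (𝓡 m) M)) t ↔ ContMDiffAt 𝓘(ℝ, ℝ) (𝓡 m) ∞ γ t ∧
      ContDiffAt ℝ ∞ (coordAlong (γ t) γ V) t := fun t ht => by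
    rw [contMDiffAt_totalSpace]
    refine and_congr_right fun h => ?_
    rw [← contMDiffAt_iff_contDiffAt]
    refine Filter.EventuallyEq.contMDiffAt_iff ?_
    filter_upwards [h.eventually_source (mem_extChartAt_source (γ t))] with s hs
    exact (coframe_apply hs _).symm
  refine ⟨fun h => ⟨fun t ht => ?_, fun t ht => ?_⟩, fun h t ht => ?_⟩
  · exact ((key t ht).1 (ContMDiffOn.contMDiffAt h (hJ.mem_nhds ht))).1.contMDiffWithinAt
  · exact ((key t ht).1 (ContMDiffOn.contMDiffAt h (hJ.mem_nhds ht))).2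
  · exact ((key t ht).2 ⟨h.1.contMDiffAt hJ ht, h.2 t ht⟩).contMDiffWithinAt

theorem SmoothFieldAlongOn.smoothCurveOn (h : SmoothFieldAlongOn γ V J) (hJ : IsOpen J) :
    SmoothCurveOn m γ J :=
  ((smoothFieldAlongOn_iff hJ).1 h).1

theorem SmoothFieldAlongOn.contMDiffAt (h : SmoothFieldAlongOn γ V J) (hJ : IsOpen J)
    (ht : t ∈ J) : ContMDiffAt 𝓘(ℝ, ℝ) (𝓡 m) ∞ γ t :=
  (h.smoothCurveOn hJ).contMDiffAt hJ ht

/-- The change of components between the preferred charts at `x₁` and at `x₀`. -/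
def frameChange (x₀ x₁ : M) (p : EuclideanSpace ℝ (Fin m)) :
    EuclideanSpace ℝ (Fin m) →L[ℝ] EuclideanSpace ℝ (Fin m) :=
  (coframe x₀ ((extChartAt (𝓡 m) x₀).symm p)) ∘L (frame x₁ ((extChartAt (𝓡 m) x₀).symm p))

theorem frameChange_apply {x₁ y : M} (hy : y ∈ (extChartAt (𝓡 m) x₀).source)
    (w : EuclideanSpace ℝ (Fin m)) :
    frameChange x₀ x₁ (extChartAt (𝓡 m) x₀ y) w = coframe x₀ y (frame x₁ y w) := by
  rw [frameChange, (extChartAt (𝓡 m) x₀).left_inv hy]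
  rfl

/-- Applied to a constant w, the transition map gives the components in one chart of a coordinate
field of the other, and such a field is smooth. -/
theorem contDiffAt_frameChange {x₁ y : M} (hy : y ∈ (extChartAt (𝓡 m) x₀).source)
    (hy₁ : y ∈ (extChartAt (𝓡 m) x₁).source) :
    ContDiffAt ℝ ∞ (frameChange x₀ x₁) (extChartAt (𝓡 m) x₀ y) := by
  have hs : IsOpen ((extChartAt (𝓡 m) x₀).target ∩
      (extChartAt (𝓡 m) x₀).symm ⁻¹' (extChartAt (𝓡 m) x₁).source) :=
    (continuousOn_extChartAt_symm x₀).isOpen_inter_preimage (isOpen_extChartAt_target x₀)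
      (isOpen_extChartAt_source x₁)
  refine ContDiffOn.contDiffAt (contDiffOn_clm_apply.2 fun w p hp => ?_) (hs.mem_nhds
    ⟨(extChartAt (𝓡 m) x₀).map_source hy, by rwa [mem_preimage, (extChartAt (𝓡 m) x₀).left_inv hy]⟩)
  have h := contDiffAt_components (x₀ := x₀) (X := coordField x₁ fun _ => w)
    ((extChartAt (𝓡 m) x₀).map_target hp.1) (smoothFieldAt_coordField hp.2 contDiffAt_const)
  rw [(extChartAt (𝓡 m) x₀).right_inv hp.1] at h
  exact h.contDiffWithinAt

theorem coordAlong_eventuallyEq {x₁ : M} (hγ : ContMDiffAt 𝓘(ℝ, ℝ) (𝓡 m) ∞ γ t)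
    (h₀ : γ t ∈ (extChartAt (𝓡 m) x₀).source) (h₁ : γ t ∈ (extChartAt (𝓡 m) x₁).source) :
    coordAlong x₀ γ V =ᶠ[𝓝 t] fun s =>
      frameChange x₀ x₁ (extChartAt (𝓡 m) x₀ (γ s)) (coordAlong x₁ γ V s) := by
  filter_upwards [hγ.eventually_source h₀, hγ.eventually_source h₁] with s hs₀ hs₁
  rw [frameChange_apply hs₀, coordAlong, coordAlong, frame_coframe hs₁]

theorem SmoothFieldAlongOn.contDiffAt_coordAlong (h : SmoothFieldAlongOn γ V J) (hJ : IsOpen J)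
    (ht : t ∈ J) (h₀ : γ t ∈ (extChartAt (𝓡 m) x₀).source) :
    ContDiffAt ℝ ∞ (coordAlong x₀ γ V) t := by
  have hγ := h.contMDiffAt hJ ht
  have h₁ := mem_extChartAt_source (I := 𝓡 m) (γ t)
  refine ContDiffAt.congr_of_eventuallyEq ?_ (coordAlong_eventuallyEq hγ h₀ h₁)
  exact (ContDiffAt.comp (g := frameChange x₀ (γ t)) t (contDiffAt_frameChange h₀ h₁)
    (hγ.contDiffAt_extChartAt h₀)).clm_apply (((smoothFieldAlongOn_iff hJ).1 h).2 t ht)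

/-- The coordinate expression of the covariant derivative along a curve. -/
theorem coframe_covDerivAlong (cov : AffineConnection m M) (hJ : IsOpen J)
    (h : SmoothFieldAlongOn γ V J) (ht : t ∈ J) (h₀ : γ t ∈ (extChartAt (𝓡 m) x₀).source) :
    coframe x₀ (γ t) (covDerivAlong cov γ V t)
      = localCovDeriv (christoffel cov x₀) (fun s => extChartAt (𝓡 m) x₀ (γ s))
        (coordAlong x₀ γ V) t := by
  have hγ := h.contMDiffAt hJ ht
  have h₁ := mem_extChartAt_source (I := 𝓡 m) (γ t)
  have hv := coframe_velocity (hγ.mdifferentiableAt (by simp)) h₀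
  have hc := hγ.contDiffAt_extChartAt h₀
  have hB := contDiffAt_frameChange h₀ h₁
  have hW := h.contDiffAt_coordAlong hJ ht h₁
  have e1 : (fun s => (trivializationAt (EuclideanSpace ℝ (Fin m))
      (TangentSpace (𝓡 m) : M → Type _) (γ t) ⟨γ s, V s⟩).2) =ᶠ[𝓝 t] coordAlong (γ t) γ V := by
    filter_upwards [hγ.eventually_source h₁] with s hs using (coframe_apply hs _).symm
  have e2 : covDerivAlong cov γ V t = frame (γ t) (γ t) (deriv (coordAlong (γ t) γ V) t)
      + cov (coordField (γ t) fun _ => coordAlong (γ t) γ V t) (γ t) (velocity γ t) := by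
    rw [← e1.deriv_eq, ← e1.eq_of_nhds]
    rfl
  -- The definition of the derivative uses the chart at γ t. The components in the chart at x₀ are
  -- the transition map along γ applied to those components; its derivative, from the product rule,
  -- is the inhomogeneous term in the transformation of the Christoffel symbols.
  have e3 := (coordAlong_eventuallyEq (V := V) hγ h₀ h₁)
  have hBc : HasDerivAt (fun s => frameChange x₀ (γ t) (extChartAt (𝓡 m) x₀ (γ s)))
      (fderiv ℝ (frameChange x₀ (γ t)) (extChartAt (𝓡 m) x₀ (γ t))
        (deriv (fun s => extChartAt (𝓡 m) x₀ (γ s)) t)) t :=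
    HasFDerivAt.comp_hasDerivAt (l := frameChange x₀ (γ t)) t
      (hB.differentiableAt (by simp)).hasFDerivAt (hc.differentiableAt (by simp)).hasDerivAt
  have e4 := hBc.clm_apply (hW.differentiableAt (by simp)).hasDerivAt
  have hcomp : components x₀ (coordField (γ t) fun _ => coordAlong (γ t) γ V t)
      = fun p => frameChange x₀ (γ t) p (coordAlong (γ t) γ V t) := rfl
  have e5 := (hB.differentiableAt (by simp)).hasFDerivAt.clm_apply
    (hasFDerivAt_const (coordAlong (γ t) γ V t) _)
  have e6 : coframe x₀ (γ t) (coordField (γ t) (fun _ => coordAlong (γ t) γ V t) (γ t))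
      = coordAlong x₀ γ V t := by
    rw [coordField, coordAlong, frame_coframe h₁, coordAlong]
  rw [e2, map_add, cov_eq_coordField cov h₀ (smoothFieldAt_coordField h₁ contDiffAt_const), hcomp,
    e5.fderiv, e6, hv, localCovDeriv, e3.deriv_eq, e4.deriv, ← frameChange_apply h₀]
  simp
  abel

theorem smoothFieldAlongOn_velocity (hγ : SmoothCurveOn m γ J) (hJ : IsOpen J) :
    SmoothFieldAlongOn (m := m) γ (velocity γ) J := by
  refine (smoothFieldAlongOn_iff hJ).2 ⟨hγ, fun t ht => ?_⟩
  have h := hγ.contMDiffAt hJ ht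
  have h₁ := mem_extChartAt_source (I := 𝓡 m) (γ t)
  refine ((h.contDiffAt_extChartAt h₁).derivWithin (m := ∞) (by norm_cast)).congr_of_eventuallyEq ?_
  filter_upwards [h.eventually_source h₁, hJ.mem_nhds ht] with s hs hsJ
  exact coframe_velocity ((hγ.contMDiffAt hJ hsJ).mdifferentiableAt (by simp)) hs

theorem coordAlong_velocity_eventuallyEq (hγ : SmoothCurveOn m γ J) (hJ : IsOpen J) (ht : t ∈ J)
    (h₀ : γ t ∈ (extChartAt (𝓡 m) x₀).source) :
    coordAlong x₀ γ (velocity γ) =ᶠ[𝓝 t] deriv fun s => extChartAt (𝓡 m) x₀ (γ s) := by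
  filter_upwards [(hγ.contMDiffAt hJ ht).eventually_source h₀, hJ.mem_nhds ht] with s hs hsJ
  exact coframe_velocity ((hγ.contMDiffAt hJ hsJ).mdifferentiableAt (by simp)) hs

theorem coordAlong_covDerivAlong_eventuallyEq (cov : AffineConnection m M) (hJ : IsOpen J)
    (h : SmoothFieldAlongOn γ V J) (ht : t ∈ J) (h₀ : γ t ∈ (extChartAt (𝓡 m) x₀).source) :
    coordAlong x₀ γ (covDerivAlong cov γ V) =ᶠ[𝓝 t]
      localCovDeriv (christoffel cov x₀) (fun s => extChartAt (𝓡 m) x₀ (γ s))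
        (coordAlong x₀ γ V) := by
  filter_upwards [(h.contMDiffAt hJ ht).eventually_source h₀, hJ.mem_nhds ht] with s hs hsJ
  exact coframe_covDerivAlong cov hJ h hsJ hs

theorem covDerivAlong_congr (cov : AffineConnection m M) (h : ∀ᶠ s in 𝓝 t, V s = W s) :
    covDerivAlong cov γ V t = covDerivAlong cov γ W t := by
  have e : (fun s => (trivializationAt (EuclideanSpace ℝ (Fin m))
      (TangentSpace (𝓡 m) : M → Type _) (γ t) ⟨γ s, V s⟩).2) =ᶠ[𝓝 t]
      fun s => (trivializationAt (EuclideanSpace ℝ (Fin m))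
      (TangentSpace (𝓡 m) : M → Type _) (γ t) ⟨γ s, W s⟩).2 := by
    filter_upwards [h] with s hs
    rw [hs]
  simp only [covDerivAlong]
  rw [e.deriv_eq, h.self_of_nhds]

theorem SmoothFieldAlongOn.congr (h : SmoothFieldAlongOn γ V J) (hVW : ∀ t ∈ J, V t = W t) :
    SmoothFieldAlongOn γ W J :=
  ContMDiffOn.congr h fun t ht => by rw [hVW t ht]

theorem SmoothFieldAlongOn.smul {f : ℝ → ℝ} (h : SmoothFieldAlongOn γ V J) (hJ : IsOpen J)
    (hf : ContDiffOn ℝ ∞ f J) : SmoothFieldAlongOn γ (fun t => f t • V t) J := by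
  refine (smoothFieldAlongOn_iff hJ).2 ⟨h.smoothCurveOn hJ, fun t ht => ?_⟩
  have e : coordAlong (γ t) γ (fun t => f t • V t) = fun s => f s • coordAlong (γ t) γ V s := by
    funext s
    exact map_smul _ _ _
  rw [e]
  exact (hf.contDiffAt (hJ.mem_nhds ht)).smul (((smoothFieldAlongOn_iff hJ).1 h).2 t ht)

theorem SmoothFieldAlongOn.add (hV : SmoothFieldAlongOn γ V J) (hJ : IsOpen J)
    (hW : SmoothFieldAlongOn γ W J) : SmoothFieldAlongOn γ (fun t => V t + W t) J := by
  refine (smoothFieldAlongOn_iff hJ).2 ⟨hV.smoothCurveOn hJ, fun t ht => ?_⟩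
  have e : coordAlong (γ t) γ (fun t => V t + W t)
      = fun s => coordAlong (γ t) γ V s + coordAlong (γ t) γ W s := by
    funext s
    exact map_add _ _ _
  rw [e]
  exact (((smoothFieldAlongOn_iff hJ).1 hV).2 t ht).add (((smoothFieldAlongOn_iff hJ).1 hW).2 t ht)

theorem covDerivAlong_smul (cov : AffineConnection m M) {f : ℝ → ℝ}
    (h : SmoothFieldAlongOn γ V J) (hJ : IsOpen J) (hf : ContDiffOn ℝ ∞ f J) (ht : t ∈ J) :
    covDerivAlong cov γ (fun t => f t • V t) t
      = deriv f t • V t + f t • covDerivAlong cov γ V t := by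
  have h₁ := mem_extChartAt_source (I := 𝓡 m) (γ t)
  refine coframe_injective h₁ ?_
  rw [coframe_covDerivAlong cov hJ (h.smul hJ hf) ht h₁, map_add, map_smul, map_smul,
    coframe_covDerivAlong cov hJ h ht h₁]
  have e : coordAlong (γ t) γ (fun t => f t • V t) = fun s => f s • coordAlong (γ t) γ V s := by
    funext s
    exact map_smul _ _ _
  have hd := ((hf.contDiffAt (hJ.mem_nhds ht)).differentiableAt (by simp)).hasDerivAt.fun_smul
    ((h.contDiffAt_coordAlong hJ ht h₁).differentiableAt (by simp)).hasDerivAt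
  simp only [localCovDeriv]
  rw [e, hd.deriv, map_smul, smul_add]
  simp only [coordAlong]
  abel

theorem covDerivAlong_add (cov : AffineConnection m M)
    (hV : SmoothFieldAlongOn γ V J) (hJ : IsOpen J) (hW : SmoothFieldAlongOn γ W J) (ht : t ∈ J) :
    covDerivAlong cov γ (fun t => V t + W t) t
      = covDerivAlong cov γ V t + covDerivAlong cov γ W t := by
  have h₁ := mem_extChartAt_source (I := 𝓡 m) (γ t)
  refine coframe_injective h₁ ?_
  rw [coframe_covDerivAlong cov hJ (hV.add hJ hW) ht h₁, map_add,
    coframe_covDerivAlong cov hJ hV ht h₁, coframe_covDerivAlong cov hJ hW ht h₁]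
  have e : coordAlong (γ t) γ (fun t => V t + W t)
      = fun s => coordAlong (γ t) γ V s + coordAlong (γ t) γ W s := by
    funext s
    exact map_add _ _ _
  have hd := ((hV.contDiffAt_coordAlong hJ ht h₁).differentiableAt (by simp)).hasDerivAt.fun_add
    ((hW.contDiffAt_coordAlong hJ ht h₁).differentiableAt (by simp)).hasDerivAt
  simp only [localCovDeriv]
  rw [e, hd.deriv, map_add]
  abel

end AlongCurves

/-! ### Metric compatibility along curves. -/

section MetricAlongCurves

variable {m : ℕ} {M : Type*} [TopologicalSpace M]
  [ChartedSpace (EuclideanSpace ℝ (Fin m)) M] [IsManifold (𝓡 m) ∞ M]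
  [RiemannianBundle (fun x : M => TangentSpace (𝓡 m) x)]
  {γ : ℝ → M} {V W : ∀ t, TangentSpace (𝓡 m) (γ t)} {J : Set ℝ} {x₀ : M} {t : ℝ}

theorem smoothFieldAlongOn_covDerivAlong {cov : AffineConnection m M} (hcov : IsLeviCivita cov)
    (hJ : IsOpen J) (h : SmoothFieldAlongOn γ V J) :
    SmoothFieldAlongOn γ (covDerivAlong cov γ V) J := by
  refine (smoothFieldAlongOn_iff hJ).2 ⟨h.smoothCurveOn hJ, fun t ht => ?_⟩
  have hγ := h.contMDiffAt hJ ht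
  have h₁ := mem_extChartAt_source (I := 𝓡 m) (γ t)
  refine ContDiffAt.congr_of_eventuallyEq ?_ (coordAlong_covDerivAlong_eventuallyEq cov hJ h ht h₁)
  have hc := hγ.contDiffAt_extChartAt h₁
  have hV := h.contDiffAt_coordAlong hJ ht h₁
  have hC := (hcov.contDiffOn_christoffel (γ t)).contDiffAt
    ((isOpen_extChartAt_target (γ t)).mem_nhds ((extChartAt (𝓡 m) (γ t)).map_source h₁))
  exact (hV.derivWithin (m := ∞) (by norm_cast)).add
    (((ContDiffAt.comp (g := christoffel cov (γ t)) t hC hc).clm_apply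
      (hc.derivWithin (m := ∞) (by norm_cast))).clm_apply hV)

theorem smoothFieldAlongOn_tensionField {cov : AffineConnection m M} (hcov : IsLeviCivita cov)
    (hJ : IsOpen J) (hγ : SmoothCurveOn m γ J) :
    SmoothFieldAlongOn γ (tensionField cov γ) J :=
  smoothFieldAlongOn_covDerivAlong hcov hJ (smoothFieldAlongOn_velocity hγ hJ)

theorem inner_eventuallyEq (hγ : ContMDiffAt 𝓘(ℝ, ℝ) (𝓡 m) ∞ γ t)
    (h₀ : γ t ∈ (extChartAt (𝓡 m) x₀).source) :
    (fun s => (inner ℝ (V s) (W s) : ℝ)) =ᶠ[𝓝 t] fun s =>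
      metricCoeff x₀ (extChartAt (𝓡 m) x₀ (γ s)) (coordAlong x₀ γ V s) (coordAlong x₀ γ W s) := by
  filter_upwards [hγ.eventually_source h₀] with s hs using (metricCoeff_coframe hs _ _).symm

variable [IsContMDiffRiemannianBundle (𝓡 m) ∞ (EuclideanSpace ℝ (Fin m))
      (fun x : M => TangentSpace (𝓡 m) x)]

theorem SmoothFieldAlongOn.contDiffOn_inner (hV : SmoothFieldAlongOn γ V J) (hJ : IsOpen J)
    (hW : SmoothFieldAlongOn γ W J) :
    ContDiffOn ℝ ∞ (fun t => (inner ℝ (V t) (W t) : ℝ)) J := fun t ht => by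
  have hγ := hV.contMDiffAt hJ ht
  have h₁ := mem_extChartAt_source (I := 𝓡 m) (γ t)
  have hg := (contDiffOn_metricCoeff (γ t)).contDiffAt
    ((isOpen_extChartAt_target (γ t)).mem_nhds ((extChartAt (𝓡 m) (γ t)).map_source h₁))
  refine (ContDiffAt.congr_of_eventuallyEq ?_ (inner_eventuallyEq hγ h₁)).contDiffWithinAt
  exact ((ContDiffAt.comp (g := metricCoeff (γ t)) t hg (hγ.contDiffAt_extChartAt h₁)).clm_apply
    (hV.contDiffAt_coordAlong hJ ht h₁)).clm_apply (hW.contDiffAt_coordAlong hJ ht h₁)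

/-- Metric compatibility of the Levi-Civita connection along a curve. -/
theorem IsLeviCivita.hasDerivAt_inner {cov : AffineConnection m M} (hcov : IsLeviCivita cov)
    (hJ : IsOpen J) (hV : SmoothFieldAlongOn γ V J) (hW : SmoothFieldAlongOn γ W J) (ht : t ∈ J) :
    HasDerivAt (fun t => (inner ℝ (V t) (W t) : ℝ))
      (inner ℝ (covDerivAlong cov γ V t) (W t) + inner ℝ (V t) (covDerivAlong cov γ W t)) t := by
  have hγ := hV.contMDiffAt hJ ht
  have h₁ := mem_extChartAt_source (I := 𝓡 m) (γ t)
  have hd := (((hV.contDiffOn_inner hJ hW).contDiffAt (hJ.mem_nhds ht)).differentiableAt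
    (by simp)).hasDerivAt
  refine hd.congr_deriv ?_
  rw [(inner_eventuallyEq hγ h₁).deriv_eq, ← fderiv_apply_one_eq_deriv,
    (hcov.localLeviCivita (γ t)).fderiv_inner
      ((hγ.contDiffAt_extChartAt h₁).differentiableAt (by simp))
      ((extChartAt (𝓡 m) (γ t)).map_source h₁)
      ((hV.contDiffAt_coordAlong hJ ht h₁).differentiableAt (by simp))
      ((hW.contDiffAt_coordAlong hJ ht h₁).differentiableAt (by simp))]
  have key : ∀ {X : ∀ t, TangentSpace (𝓡 m) (γ t)}, SmoothFieldAlongOn γ X J →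
      covPartial (christoffel cov (γ t)) (fun s => extChartAt (𝓡 m) (γ t) (γ s)) 1
        (coordAlong (γ t) γ X) t = coframe (γ t) (γ t) (covDerivAlong cov γ X t) := fun hX => by
    rw [coframe_covDerivAlong cov hJ hX ht h₁, covPartial, localCovDeriv,
      fderiv_apply_one_eq_deriv, fderiv_apply_one_eq_deriv]
  rw [key hV, key hW, coordAlong, coordAlong, metricCoeff_coframe h₁, metricCoeff_coframe h₁]

end MetricAlongCurves

/-! ### Differentiation under the integral sign. -/

section DifferentiationUnderIntegral

theorem continuousOn_fderiv_apply {L : ℝ × ℝ → ℝ} {S : Set (ℝ × ℝ)}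
    (hL : ∀ q ∈ S, ContDiffAt ℝ ∞ L q) (e : ℝ × ℝ) :
    ContinuousOn (fun q => fderiv ℝ L q e) S := fun q hq =>
  (LocalLeviCivita.contDiffAt_fderiv_apply (hL q hq) e).continuousAt.continuousWithinAt

/-- Differentiation under the integral sign for a smooth integrand. -/
theorem hasDerivAt_integral_of_contDiffAt {L : ℝ × ℝ → ℝ} {ε a b : ℝ} (hε : 0 < ε) (hab : a ≤ b)
    (hL : ∀ q ∈ Ioo (-ε) ε ×ˢ Icc a b, ContDiffAt ℝ ∞ L q) :
    HasDerivAt (fun s => ∫ t in a..b, L (s, t)) (∫ t in a..b, fderiv ℝ L (0, t) (1, 0)) 0 := by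
  have hc : ∀ s ∈ Ioo (-ε) ε, ContinuousOn (fun t => L (s, t)) (Icc a b) := fun s hs t ht =>
    ((hL (s, t) ⟨hs, ht⟩).continuousAt.comp
      (Continuous.prodMk_right s).continuousAt).continuousWithinAt
  have h0 : (0 : ℝ) ∈ Ioo (-ε) ε := ⟨by linarith, hε⟩
  -- Halving ε makes the parameter rectangle compact, so the s-derivative of the integrand is
  -- bounded there by a constant, which serves as dominating function.
  have hsub : Icc (-(ε / 2)) (ε / 2) ⊆ Ioo (-ε) ε := fun s hs =>
    ⟨by linarith [hs.1], by linarith [hs.2]⟩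
  have hd := continuousOn_fderiv_apply (S := Icc (-(ε / 2)) (ε / 2) ×ˢ Icc a b)
    (fun q hq => hL q ⟨hsub hq.1, hq.2⟩) (1, 0)
  obtain ⟨B, hB⟩ := (isCompact_Icc.prod isCompact_Icc).exists_bound_of_continuousOn hd
  have hmeas : ∀ {f : ℝ → ℝ}, ContinuousOn f (Icc a b) →
      MeasureTheory.AEStronglyMeasurable f (MeasureTheory.volume.restrict (uIoc a b)) := fun hf => by
    rw [uIoc_of_le hab]
    exact (hf.mono Ioc_subset_Icc_self).aestronglyMeasurable measurableSet_Ioc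
  have hd0 : ContinuousOn (fun t => fderiv ℝ L (0, t) (1, 0)) (Icc a b) :=
    hd.comp (Continuous.prodMk_right (0 : ℝ)).continuousOn
      fun t ht => ⟨⟨by linarith, by linarith⟩, ht⟩
  refine (intervalIntegral.hasDerivAt_integral_of_dominated_loc_of_deriv_le
    (F := fun s t => L (s, t)) (F' := fun s t => fderiv ℝ L (s, t) (1, 0)) (bound := fun _ => B)
    (Icc_mem_nhds (by linarith : -(ε / 2) < 0) (by linarith : 0 < ε / 2)) ?_ ?_ (hmeas hd0) ?_
    intervalIntegrable_const ?_).2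
  · filter_upwards [isOpen_Ioo.mem_nhds h0] with s hs using hmeas (hc s hs)
  · exact ContinuousOn.intervalIntegrable (by rw [uIcc_of_le hab]; exact hc 0 h0)
  · refine Filter.Eventually.of_forall fun t ht s hs => ?_
    rw [uIoc_of_le hab] at ht
    exact hB (s, t) ⟨hs, Ioc_subset_Icc_self ht⟩
  · refine Filter.Eventually.of_forall fun t ht s hs => ?_
    rw [uIoc_of_le hab] at ht
    exact hasDerivAt_comp_prodMk_left
      ((hL (s, t) ⟨hsub hs, Ioc_subset_Icc_self ht⟩).differentiableAt (by simp))

end DifferentiationUnderIntegral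

/-! ### Variations of a curve and their variation fields. -/

section Variations

variable {m : ℕ} {M : Type*} [TopologicalSpace M]
  [ChartedSpace (EuclideanSpace ℝ (Fin m)) M]
  {γ : ℝ → M} {J : Set ℝ} {a b ε s t : ℝ} {Γ : ℝ → ℝ → M} {x₀ : M}

theorem IsVariation.contMDiffAt (h : IsVariation m γ J a b ε Γ) (hJ : IsOpen J)
    (hs : s ∈ Ioo (-ε) ε) (ht : t ∈ J) :
    ContMDiffAt 𝓘(ℝ, ℝ × ℝ) (𝓡 m) ∞ (fun p : ℝ × ℝ => Γ p.1 p.2) (s, t) :=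
  h.smooth.contMDiffAt ((isOpen_Ioo.prod hJ).mem_nhds ⟨hs, ht⟩)

theorem IsVariation.smoothCurveOn (h : IsVariation m γ J a b ε Γ)
    (hs : s ∈ Ioo (-ε) ε) : SmoothCurveOn m (Γ s) J := by
  have h1 : ContMDiff 𝓘(ℝ, ℝ) 𝓘(ℝ, ℝ × ℝ) ∞ fun t : ℝ => (s, t) :=
    ((contDiff_prodMk_right s : ContDiff ℝ ∞ fun t : ℝ => (s, t))).contMDiff
  exact h.smooth.comp h1.contMDiffOn fun t ht => ⟨hs, ht⟩

/-- The variation field of the variation `Γ` of `γ`. -/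
def variationField [IsManifold (𝓡 m) ∞ M] (γ : ℝ → M) (Γ : ℝ → ℝ → M) (t : ℝ) :
    TangentSpace (𝓡 m) (γ t) :=
  frame (γ t) (γ t) (deriv (fun s => extChartAt (𝓡 m) (γ t) (Γ s t)) 0)

variable [IsManifold (𝓡 m) ∞ M]

/-- For a variation, Γ 0 t and γ t are equal only by hypothesis. With the base point y as a variable
this equality can be substituted, after which both sides are components of the velocity of σ at 0.
-/
theorem coframe_frame_deriv {σ : ℝ → M} {y : M} (hσ : MDifferentiableAt 𝓘(ℝ, ℝ) (𝓡 m) σ 0)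
    (hy : σ 0 = y) (h₀ : y ∈ (extChartAt (𝓡 m) x₀).source) :
    coframe x₀ y (frame y y (deriv (fun s => extChartAt (𝓡 m) y (σ s)) 0))
      = deriv (fun s => extChartAt (𝓡 m) x₀ (σ s)) 0 := by
  subst hy
  rw [← coframe_velocity hσ (mem_extChartAt_source (σ 0)), frame_coframe (mem_extChartAt_source _),
    coframe_velocity hσ h₀]

theorem IsVariation.coordAlong_variationField (h : IsVariation m γ J a b ε Γ) (hJ : IsOpen J)
    (hε : 0 < ε) (ht : t ∈ J) (h₀ : γ t ∈ (extChartAt (𝓡 m) x₀).source) :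
    coordAlong (m := m) x₀ γ (variationField γ Γ) t = deriv (fun s => extChartAt (𝓡 m) x₀ (Γ s t)) 0 := by
  have hs : (0 : ℝ) ∈ Ioo (-ε) ε := ⟨by linarith, hε⟩
  have h1 : ContMDiffAt 𝓘(ℝ, ℝ) (𝓡 m) ∞ (fun s => Γ s t) 0 :=
    ContMDiffAt.comp (g := fun p : ℝ × ℝ => Γ p.1 p.2) (f := fun s : ℝ => (s, t)) (0 : ℝ)
      (h.contMDiffAt hJ hs ht)
      (contDiff_prodMk_left t : ContDiff ℝ ∞ fun s : ℝ => (s, t)).contMDiff.contMDiffAt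
  exact coframe_frame_deriv (h1.mdifferentiableAt (by simp)) (h.initial t ht) h₀

theorem IsVariation.contDiffAt_extChartAt (h : IsVariation m γ J a b ε Γ) (hJ : IsOpen J)
    (hs : s ∈ Ioo (-ε) ε) (ht : t ∈ J) (h₀ : Γ s t ∈ (extChartAt (𝓡 m) x₀).source) :
    ContDiffAt ℝ ∞ (fun p : ℝ × ℝ => extChartAt (𝓡 m) x₀ (Γ p.1 p.2)) (s, t) :=
  (h.contMDiffAt hJ hs ht).contDiffAt_extChartAt h₀

theorem IsVariation.coordAlong_variationField_eventuallyEq (h : IsVariation m γ J a b ε Γ)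
    (hJ : IsOpen J) (hε : 0 < ε) (hγ : SmoothCurveOn m γ J) (ht : t ∈ J)
    (h₀ : γ t ∈ (extChartAt (𝓡 m) x₀).source) :
    coordAlong (m := m) x₀ γ (variationField γ Γ)
      =ᶠ[𝓝 t] fun t => deriv (fun s => extChartAt (𝓡 m) x₀ (Γ s t)) 0 := by
  filter_upwards [(hγ.contMDiffAt hJ ht).eventually_source h₀, hJ.mem_nhds ht] with t' h1 h2
  exact h.coordAlong_variationField hJ hε h2 h1

theorem IsVariation.smoothFieldAlongOn (h : IsVariation m γ J a b ε Γ) (hJ : IsOpen J)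
    (hε : 0 < ε) (hγ : SmoothCurveOn m γ J) : SmoothFieldAlongOn (m := m) γ (variationField γ Γ) J := by
  refine (smoothFieldAlongOn_iff hJ).2 ⟨hγ, fun t ht => ?_⟩
  have hs : (0 : ℝ) ∈ Ioo (-ε) ε := ⟨by linarith, hε⟩
  have h₁ := mem_extChartAt_source (I := 𝓡 m) (γ t)
  have hc := h.contDiffAt_extChartAt hJ hs ht (x₀ := γ t) (by rwa [h.initial t ht])
  have h2 : ContDiffAt ℝ ∞ (fun t' : ℝ =>
      fderiv ℝ (fun p : ℝ × ℝ => extChartAt (𝓡 m) (γ t) (Γ p.1 p.2)) (0, t') (1, 0)) t :=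
    (LocalLeviCivita.contDiffAt_fderiv_apply hc (1, 0)).comp t
      (contDiff_prodMk_right (0 : ℝ)).contDiffAt
  refine h2.congr_of_eventuallyEq ?_
  filter_upwards [h.coordAlong_variationField_eventuallyEq hJ hε hγ ht h₁,
    eventually_right (eventually_differentiableAt hc)] with t' h3 h4
  rw [h3]
  exact (hasDerivAt_comp_prodMk_left h4).deriv

theorem IsVariation.variationField_eq_zero (h : IsVariation m γ J a b ε Γ) (hε : 0 < ε)
    (ht : t ∈ J) (hab : t ∉ Icc a b) : variationField (m := m) γ Γ t = 0 := by
  have h1 : (fun s => extChartAt (𝓡 m) (γ t) (Γ s t)) =ᶠ[𝓝 0]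
      fun _ => extChartAt (𝓡 m) (γ t) (γ t) := by
    filter_upwards [Ioo_mem_nhds (by linarith : -ε < 0) hε] with s hs
    rw [h.support s hs t ht hab]
  rw [variationField, h1.deriv_eq, deriv_const, map_zero]

end Variations

/-! ### First variation formula in constant curvature 1. -/

section FirstVariationFormula

variable {m : ℕ} {M : Type*} [TopologicalSpace M]
  [ChartedSpace (EuclideanSpace ℝ (Fin m)) M] [IsManifold (𝓡 m) ∞ M]
  [RiemannianBundle (fun x : M => TangentSpace (𝓡 m) x)]
  {γ : ℝ → M} {J : Set ℝ} {a b ε s t : ℝ} {Γ : ℝ → ℝ → M} {x₀ : M}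

theorem lagrangian_eq_localLagrangian (cov : AffineConnection m M) (δ₁ δ₂ : ℝ)
    (hγ : SmoothCurveOn m γ J) (hJ : IsOpen J) (ht : t ∈ J)
    (h₀ : γ t ∈ (extChartAt (𝓡 m) x₀).source) :
    δ₁ * ‖velocity (m := m) γ t‖ ^ 2 + δ₂ * ‖tensionField cov γ t‖ ^ 2
      = localLagrangian (metricCoeff x₀) (christoffel cov x₀) δ₁ δ₂
        (fun s => extChartAt (𝓡 m) x₀ (γ s)) t := by
  have h1 := coordAlong_velocity_eventuallyEq hγ hJ ht h₀
  have h2 : coframe x₀ (γ t) (tensionField cov γ t) = _ :=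
    coframe_covDerivAlong cov hJ (smoothFieldAlongOn_velocity hγ hJ) ht h₀
  rw [(localCovDeriv_congr Filter.EventuallyEq.rfl h1).eq_of_nhds] at h2
  rw [localLagrangian, ← h2, ← h1.eq_of_nhds, coordAlong, metricCoeff_coframe h₀,
    metricCoeff_coframe h₀, real_inner_self_eq_norm_sq, real_inner_self_eq_norm_sq]

/-- The integrand of the energy of the curves of a variation. -/
def variationDensity (cov : AffineConnection m M) (δ₁ δ₂ : ℝ) (Γ : ℝ → ℝ → M) (p : ℝ × ℝ) : ℝ :=
  δ₁ * ‖velocity (m := m) (Γ p.1) p.2‖ ^ 2 + δ₂ * ‖tensionField cov (Γ p.1) p.2‖ ^ 2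

theorem IsVariation.variationDensity_eventuallyEq (h : IsVariation m γ J a b ε Γ)
    (cov : AffineConnection m M) (δ₁ δ₂ : ℝ) (hJ : IsOpen J) (hs : s ∈ Ioo (-ε) ε) (ht : t ∈ J)
    (h₀ : Γ s t ∈ (extChartAt (𝓡 m) x₀).source) :
    variationDensity cov δ₁ δ₂ Γ =ᶠ[𝓝 (s, t)] fun p =>
      localLagrangian (metricCoeff x₀) (christoffel cov x₀) δ₁ δ₂
        (fun t => extChartAt (𝓡 m) x₀ (Γ p.1 t)) p.2 := by
  filter_upwards [(isOpen_Ioo.prod hJ).mem_nhds ⟨hs, ht⟩,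
    (h.contMDiffAt hJ hs ht).eventually_source h₀] with p hp h1
  exact lagrangian_eq_localLagrangian cov δ₁ δ₂ (h.smoothCurveOn hp.1) hJ hp.2 h1

/-- The left-hand side of the Euler-Lagrange equation of the sesqui-harmonic energy for curves
parametrized by arc length in a space of constant curvature `1`. -/
def eulerLagrangeField (cov : AffineConnection m M) (δ₁ δ₂ : ℝ) (γ : ℝ → M) (t : ℝ) :
    TangentSpace (𝓡 m) (γ t) :=
  δ₂ • (covDerivAlong cov γ (covDerivAlong cov γ (tensionField cov γ)) t + tensionField cov γ t)
    - δ₁ • tensionField cov γ t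

theorem smoothFieldAlongOn_eulerLagrangeField {cov : AffineConnection m M}
    (hcov : IsLeviCivita cov) (δ₁ δ₂ : ℝ) (hJ : IsOpen J) (hγ : SmoothCurveOn m γ J) :
    SmoothFieldAlongOn γ (eulerLagrangeField cov δ₁ δ₂ γ) J := by
  have hτ := smoothFieldAlongOn_tensionField hcov hJ hγ
  have hDD := smoothFieldAlongOn_covDerivAlong hcov hJ (smoothFieldAlongOn_covDerivAlong hcov hJ hτ)
  refine (((hDD.add hJ hτ).smul hJ (contDiffOn_const (c := δ₂))).add hJ
    (hτ.smul hJ (contDiffOn_const (c := -δ₁)))).congr fun t _ => ?_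
  rw [eulerLagrangeField, neg_smul, sub_eq_add_neg]

variable [IsContMDiffRiemannianBundle (𝓡 m) ∞ (EuclideanSpace ℝ (Fin m))
      (fun x : M => TangentSpace (𝓡 m) x)]

theorem IsVariation.contDiffAt_variationDensity (h : IsVariation m γ J a b ε Γ)
    {cov : AffineConnection m M} (hcov : IsLeviCivita cov) (δ₁ δ₂ : ℝ) (hJ : IsOpen J)
    (hs : s ∈ Ioo (-ε) ε) (ht : t ∈ J) :
    ContDiffAt ℝ ∞ (variationDensity cov δ₁ δ₂ Γ) (s, t) := by
  have h₁ := mem_extChartAt_source (I := 𝓡 m) (Γ s t)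
  refine ContDiffAt.congr_of_eventuallyEq ?_
    (h.variationDensity_eventuallyEq cov δ₁ δ₂ hJ hs ht h₁)
  exact (hcov.localLeviCivita (Γ s t)).contDiffAt_localLagrangian δ₁ δ₂
    (c := fun p => extChartAt (𝓡 m) (Γ s t) (Γ p.1 p.2))
    (h.contDiffAt_extChartAt hJ hs ht h₁) ((extChartAt (𝓡 m) (Γ s t)).map_source h₁)

theorem IsVariation.sesquiEnergy_eq (h : IsVariation m γ J a b ε Γ)
    {cov : AffineConnection m M} (hcov : IsLeviCivita cov) (δ₁ δ₂ : ℝ) (hJ : IsOpen J)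
    (hs : s ∈ Ioo (-ε) ε) (hab : a ≤ b) (habJ : Icc a b ⊆ J) :
    sesquiEnergy cov δ₁ δ₂ a b (Γ s) = ∫ t in a..b, variationDensity cov δ₁ δ₂ Γ (s, t) := by
  -- Splitting the integral requires each term to be integrable on its own; the weights (1, 0) and
  -- (0, 1) isolate the two terms.
  have hc : ∀ δ₁ δ₂, ContinuousOn (fun t => variationDensity cov δ₁ δ₂ Γ (s, t)) (uIcc a b) :=
    fun δ₁ δ₂ t ht => by
    rw [uIcc_of_le hab] at ht
    exact ((h.contDiffAt_variationDensity hcov δ₁ δ₂ hJ hs (habJ ht)).continuousAt.comp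
      (Continuous.prodMk_right s).continuousAt).continuousWithinAt
  have h1 := (hc 1 0).intervalIntegrable (μ := MeasureTheory.volume)
  have h2 := (hc 0 1).intervalIntegrable (μ := MeasureTheory.volume)
  simp only [variationDensity, one_mul, zero_mul, add_zero, zero_add] at h1 h2
  simp only [variationDensity]
  rw [intervalIntegral.integral_add (h1.const_mul δ₁) (h2.const_mul δ₂),
    intervalIntegral.integral_const_mul, intervalIntegral.integral_const_mul, sesquiEnergy]

/-- The connection has constant sectional curvature `1`, expressed in the preferred charts. -/
def HasUnitCurvature (cov : AffineConnection m M) : Prop :=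
  ∀ (x₀ : M) (u v w : EuclideanSpace ℝ (Fin m)),
    localCurvature (christoffel cov x₀) (extChartAt (𝓡 m) x₀ x₀) u v w
      = metricCoeff x₀ (extChartAt (𝓡 m) x₀ x₀) v w • u
        - metricCoeff x₀ (extChartAt (𝓡 m) x₀ x₀) u w • v

/-- The coordinate first variation is read in the chart centred at γ t, where `HasUnitCurvature`
replaces R(V,T)T by ⟨T,T⟩V − ⟨V,T⟩T. -/
theorem IsVariation.fderiv_variationDensity (h : IsVariation m γ J a b ε Γ)
    {cov : AffineConnection m M} (hcov : IsLeviCivita cov) (hR : HasUnitCurvature cov) (δ₁ δ₂ : ℝ)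
    (hJ : IsOpen J) (hε : 0 < ε) (hγ : SmoothCurveOn m γ J) (ht : t ∈ J)
    {V : ∀ t, TangentSpace (𝓡 m) (γ t)} (hV : V = variationField γ Γ) :
    fderiv ℝ (variationDensity cov δ₁ δ₂ Γ) (0, t) (1, 0)
      = 2 * (δ₁ * inner ℝ (covDerivAlong cov γ V t) (velocity (m := m) γ t)
        + δ₂ * inner ℝ (covDerivAlong cov γ (covDerivAlong cov γ V) t
          + ((inner ℝ (velocity (m := m) γ t) (velocity γ t) : ℝ) • V t
            - (inner ℝ (V t) (velocity γ t) : ℝ) • velocity γ t)) (tensionField cov γ t)) := by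
  have hs : (0 : ℝ) ∈ Ioo (-ε) ε := ⟨by linarith, hε⟩
  have h₁ := mem_extChartAt_source (I := 𝓡 m) (γ t)
  have h₁' : Γ 0 t ∈ (extChartAt (𝓡 m) (γ t)).source := by rwa [h.initial t ht]
  have hVs := h.smoothFieldAlongOn hJ hε hγ
  have eV := h.coordAlong_variationField_eventuallyEq hJ hε hγ ht h₁
  rw [← hV] at hVs eV
  have eT := coordAlong_velocity_eventuallyEq hγ hJ ht h₁
  have ec : (fun s => extChartAt (𝓡 m) (γ t) (γ s)) =ᶠ[𝓝 t]
      fun s => extChartAt (𝓡 m) (γ t) (Γ 0 s) := by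
    filter_upwards [hJ.mem_nhds ht] with s hs
    rw [h.initial s hs]
  have eDV := coordAlong_covDerivAlong_eventuallyEq cov hJ hVs ht h₁
  have eDDV := coframe_covDerivAlong cov hJ (smoothFieldAlongOn_covDerivAlong hcov hJ hVs) ht h₁
  have eτ : coframe (γ t) (γ t) (tensionField cov γ t) = _ :=
    coframe_covDerivAlong cov hJ (smoothFieldAlongOn_velocity hγ hJ) ht h₁
  rw [(localCovDeriv_congr Filter.EventuallyEq.rfl eDV).eq_of_nhds] at eDDV
  rw [(localCovDeriv_congr Filter.EventuallyEq.rfl eT).eq_of_nhds] at eτ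
  have hp : (fun p : ℝ × ℝ => extChartAt (𝓡 m) (γ t) (Γ p.1 p.2)) (0, t)
      ∈ (extChartAt (𝓡 m) (γ t)).target := (extChartAt (𝓡 m) (γ t)).map_source h₁'
  rw [(h.variationDensity_eventuallyEq cov δ₁ δ₂ hJ hs ht h₁').fderiv_eq,
    (hcov.localLeviCivita (γ t)).fderiv_localLagrangian δ₁ δ₂
      (c := fun p => extChartAt (𝓡 m) (γ t) (Γ p.1 p.2))
      (h.contDiffAt_extChartAt hJ hs ht h₁') hp ec eV, hR, ← eDDV, ← eτ, ← eDV.eq_of_nhds,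
    ← eT.eq_of_nhds]
  simp only [coordAlong]
  rw [metricCoeff_coframe h₁, metricCoeff_coframe h₁, metricCoeff_coframe h₁, ← map_smul,
    ← map_smul, ← map_sub, ← map_add, metricCoeff_coframe h₁]

/-- Differentiate ⟨T, T⟩ = 1. -/
theorem IsLeviCivita.inner_velocity_tensionField {cov : AffineConnection m M}
    (hcov : IsLeviCivita cov) (hJ : IsOpen J) (hγ : SmoothCurveOn m γ J)
    (hT : ∀ t ∈ J, inner ℝ (velocity (m := m) γ t) (velocity γ t) = (1 : ℝ)) (ht : t ∈ J) :
    inner ℝ (velocity γ t) (tensionField cov γ t) = (0 : ℝ) := by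
  have h := smoothFieldAlongOn_velocity hγ hJ
  have h1 : HasDerivAt (fun t => (inner ℝ (velocity (m := m) γ t) (velocity γ t) : ℝ))
      (inner ℝ (tensionField cov γ t) (velocity γ t) + inner ℝ (velocity γ t) (tensionField cov γ t))
      t := hcov.hasDerivAt_inner hJ h h ht
  have h2 : (fun t => (inner ℝ (velocity (m := m) γ t) (velocity γ t) : ℝ)) =ᶠ[𝓝 t] fun _ => 1 := by
    filter_upwards [hJ.mem_nhds ht] with s hs using hT s hs
  have h3 := h1.unique ((hasDerivAt_const t (1 : ℝ)).congr_of_eventuallyEq h2)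
  rw [real_inner_comm] at h3
  linarith

/-- The first variation of the sesqui-harmonic energy at a curve parametrized by arc length in a
space of constant curvature `1`. -/
theorem IsVariation.hasDerivAt_sesquiEnergy (h : IsVariation m γ J a b ε Γ)
    {cov : AffineConnection m M} (hcov : IsLeviCivita cov) (hR : HasUnitCurvature cov) (δ₁ δ₂ : ℝ)
    (hJ : IsOpen J) (hε : 0 < ε) (hγ : SmoothCurveOn m γ J) (hab : a < b) (habJ : Icc a b ⊆ J)
    (hT : ∀ t ∈ J, inner ℝ (velocity (m := m) γ t) (velocity γ t) = (1 : ℝ)) :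
    HasDerivAt (fun s => sesquiEnergy cov δ₁ δ₂ a b (Γ s))
      (2 * ∫ t in a..b, (inner ℝ (variationField γ Γ t) (eulerLagrangeField cov δ₁ δ₂ γ t) : ℝ))
      0 := by
  have h0 : (0 : ℝ) ∈ Ioo (-ε) ε := ⟨by linarith, hε⟩
  have hL : ∀ q ∈ Ioo (-ε) ε ×ˢ Icc a b, ContDiffAt ℝ ∞ (variationDensity cov δ₁ δ₂ Γ) q :=
    fun q hq => h.contDiffAt_variationDensity hcov δ₁ δ₂ hJ hq.1 (habJ hq.2)
  have h1 := hasDerivAt_integral_of_contDiffAt hε hab.le hL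
  have h2 : (fun s => sesquiEnergy cov δ₁ δ₂ a b (Γ s)) =ᶠ[𝓝 0]
      fun s => ∫ t in a..b, variationDensity cov δ₁ δ₂ Γ (s, t) := by
    filter_upwards [isOpen_Ioo.mem_nhds h0] with s hs
    exact h.sesquiEnergy_eq hcov δ₁ δ₂ hJ hs hab.le habJ
  refine (h1.congr_of_eventuallyEq h2).congr_deriv ?_
  obtain ⟨V, hV⟩ : ∃ V : ∀ t, TangentSpace (𝓡 m) (γ t), V = variationField γ Γ := ⟨_, rfl⟩
  have sV := h.smoothFieldAlongOn hJ hε hγ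
  rw [← hV] at sV ⊢
  have sDV := smoothFieldAlongOn_covDerivAlong hcov hJ sV
  have sT := smoothFieldAlongOn_velocity hγ hJ
  have sτ := smoothFieldAlongOn_tensionField hcov hJ hγ
  have sDτ := smoothFieldAlongOn_covDerivAlong hcov hJ sτ
  have sP := smoothFieldAlongOn_eulerLagrangeField hcov δ₁ δ₂ hJ hγ
  -- B collects the boundary terms of all the integrations by parts, so that B′ is half the first
  -- variation density minus the Euler–Lagrange pairing. The component of the curvature term along T
  -- drops out because τ ⊥ T.
  set B : ℝ → ℝ := fun t => δ₁ * inner ℝ (V t) (velocity γ t)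
    + δ₂ * (inner ℝ (covDerivAlong cov γ V t) (tensionField cov γ t)
      - inner ℝ (V t) (covDerivAlong cov γ (tensionField cov γ) t)) with hB
  set Q : ℝ → ℝ := fun t => inner ℝ (V t) (eulerLagrangeField cov δ₁ δ₂ γ t) with hQ
  set F : ℝ → ℝ := fun t => fderiv ℝ (variationDensity cov δ₁ δ₂ Γ) (0, t) (1, 0) with hF
  have hBQ : ∀ t ∈ J, HasDerivAt B (F t / 2 - Q t) t := fun t ht => by
    have b1 : HasDerivAt (fun t => (inner ℝ (V t) (velocity γ t) : ℝ))
        (inner ℝ (covDerivAlong cov γ V t) (velocity γ t)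
          + inner ℝ (V t) (tensionField cov γ t)) t := hcov.hasDerivAt_inner hJ sV sT ht
    have b2 := hcov.hasDerivAt_inner hJ sDV sτ ht
    have b3 := hcov.hasDerivAt_inner hJ sV sDτ ht
    refine ((b1.const_mul δ₁).fun_add ((b2.fun_sub b3).const_mul δ₂)).congr_deriv ?_
    simp only [hF, hQ]
    rw [h.fderiv_variationDensity hcov hR δ₁ δ₂ hJ hε hγ ht hV, hT t ht, eulerLagrangeField,
      inner_add_left, inner_sub_left, inner_sub_right, real_inner_smul_left, real_inner_smul_left,
      real_inner_smul_right, real_inner_smul_right, inner_add_right,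
      hcov.inner_velocity_tensionField hJ hγ hT ht]
    ring
  have hB0 : ∀ t ∈ J, t ∉ Icc a b → B t = 0 := fun t ht htab => by
    -- V vanishes near t; writing it as 0 • V lets the product rule show that ∇V vanishes too.
    have hz : ∀ᶠ s in 𝓝 t, V s = (fun s => (0 : ℝ) • V s) s := by
      filter_upwards [hJ.mem_nhds ht, isClosed_Icc.isOpen_compl.mem_nhds htab] with s hs hs'
      rw [hV, h.variationField_eq_zero hε hs hs', smul_zero]
    have hDz : covDerivAlong cov γ V t = 0 := by
      rw [covDerivAlong_congr cov hz, covDerivAlong_smul cov sV hJ contDiffOn_const ht]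
      simp
    have hVz : V t = 0 := by rw [hV, h.variationField_eq_zero hε ht htab]
    simp only [hB, hDz, hVz, inner_zero_left]
    ring
  have aJ := habJ (left_mem_Icc.2 hab.le)
  have bJ := habJ (right_mem_Icc.2 hab.le)
  -- The support condition says nothing at the endpoints themselves. Since J is open, B vanishes
  -- just outside [a, b], and continuity gives the endpoint values.
  have hBa : B a = 0 := by
    refine tendsto_nhds_unique_of_eventuallyEq
      ((hBQ a aJ).continuousAt.tendsto.mono_left nhdsWithin_le_nhds : Filter.Tendsto B (𝓝[<] a) _)
      tendsto_const_nhds ?_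
    filter_upwards [nhdsWithin_le_nhds (hJ.mem_nhds aJ), self_mem_nhdsWithin] with t ht hta
    exact hB0 t ht fun h => absurd h.1 (not_le.2 hta)
  have hBb : B b = 0 := by
    refine tendsto_nhds_unique_of_eventuallyEq
      ((hBQ b bJ).continuousAt.tendsto.mono_left nhdsWithin_le_nhds : Filter.Tendsto B (𝓝[>] b) _)
      tendsto_const_nhds ?_
    filter_upwards [nhdsWithin_le_nhds (hJ.mem_nhds bJ), self_mem_nhdsWithin] with t ht htb
    exact hB0 t ht fun h => absurd h.2 (not_le.2 htb)
  have cF : ContinuousOn F (uIcc a b) := by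
    rw [uIcc_of_le hab.le]
    exact (continuousOn_fderiv_apply hL (1, 0)).comp (Continuous.prodMk_right (0 : ℝ)).continuousOn
      fun t ht => ⟨h0, ht⟩
  have cQ : ContinuousOn Q (uIcc a b) := by
    rw [uIcc_of_le hab.le]
    exact (sV.contDiffOn_inner hJ sP).continuousOn.mono habJ
  have iF := (cF.div_const 2).intervalIntegrable (μ := MeasureTheory.volume)
  have iQ := cQ.intervalIntegrable (μ := MeasureTheory.volume)
  have h3 := intervalIntegral.integral_eq_sub_of_hasDerivAt (a := a) (b := b) (fun t ht =>
    hBQ t (habJ (by rwa [uIcc_of_le hab.le] at ht))) (iF.sub iQ)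
  rw [intervalIntegral.integral_sub iF iQ, hBa, hBb, intervalIntegral.integral_div] at h3
  linarith

end FirstVariationFormula

/-! ### Construction of localized variations. -/

section BumpVariations

variable {m : ℕ} {M : Type*} [TopologicalSpace M]
  [ChartedSpace (EuclideanSpace ℝ (Fin m)) M] [IsManifold (𝓡 m) ∞ M]
  {γ : ℝ → M} {J : Set ℝ} {t₀ : ℝ}

/-- Every tangent direction is realized, up to a bump function, by a variation supported in a
small interval. -/
theorem exists_isVariation (hJ : IsOpen J) (hγ : SmoothCurveOn m γ J) (ht₀ : t₀ ∈ J)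
    (w : EuclideanSpace ℝ (Fin m)) {U : Set ℝ} (hU : U ∈ 𝓝 t₀) :
    ∃ (a b ε : ℝ) (Γ : ℝ → ℝ → M) (β : ℝ → ℝ), a < b ∧ Icc a b ⊆ J ∩ U ∧ 0 < ε ∧
      IsVariation m γ J a b ε Γ ∧ (∀ t ∈ Ioo a b, 0 < β t) ∧
      ∀ t ∈ Icc a b, variationField γ Γ t = β t • frame (γ t₀) (γ t) w := by
  have hN : J ∩ U ∩ γ ⁻¹' (extChartAt (𝓡 m) (γ t₀)).source ∈ 𝓝 t₀ :=
    Filter.inter_mem (Filter.inter_mem (hJ.mem_nhds ht₀) hU)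
      ((hγ.contMDiffAt hJ ht₀).eventually_source (mem_extChartAt_source (γ t₀)))
  obtain ⟨r, hr, hrN⟩ := Metric.nhds_basis_closedBall.mem_iff.1 hN
  have hK : ∀ t, |t - t₀| ≤ r → t ∈ J ∩ U ∩ γ ⁻¹' (extChartAt (𝓡 m) (γ t₀)).source :=
    fun t ht => hrN (by rwa [Metric.mem_closedBall, Real.dist_eq])
  set φ := extChartAt (𝓡 m) (γ t₀) with hφ
  set c : ℝ → EuclideanSpace ℝ (Fin m) := fun t => φ (γ t) with hc
  have hcs : ∀ t, |t - t₀| ≤ r → ContDiffAt ℝ ∞ c t := fun t ht =>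
    (hγ.contMDiffAt hJ (hK t ht).1.1).contDiffAt_extChartAt (hK t ht).2
  have hcK : ContinuousOn c (Metric.closedBall t₀ r) := fun t ht =>
    (hcs t (by rwa [Metric.mem_closedBall, Real.dist_eq] at ht)).continuousAt.continuousWithinAt
  -- The coordinate curve over the closed ball is compact, so some ρ-neighbourhood of it stays in
  -- the chart target.
  obtain ⟨ρ, hρ, hρt⟩ := ((isCompact_closedBall t₀ r).image_of_continuousOn
    hcK).exists_cthickening_subset_open (isOpen_extChartAt_target (I := 𝓡 m) (γ t₀)) (by
      rintro _ ⟨t, ht, rfl⟩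
      exact φ.map_source (hrN ht).2)
  -- Chosen so that |s β(t)| ‖w‖ ≤ ρ whenever |s| < ε; the added 1 covers w = 0.
  set ε : ℝ := ρ / (‖w‖ + 1) with hε
  have hw : 0 < ‖w‖ + 1 := by positivity
  have hε0 : 0 < ε := by positivity
  let β : ContDiffBump t₀ := ⟨r / 4, r / 2, by positivity, by linarith⟩
  have hβ0 : ∀ t, r / 2 ≤ |t - t₀| → β t = 0 := fun t ht =>
    β.zero_of_le_dist (by rwa [Real.dist_eq])
  have hmem : ∀ s ∈ Ioo (-ε) ε, ∀ t, |t - t₀| ≤ r → c t + (s * β t) • w ∈ φ.target :=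
    fun s hs t ht => by
    refine hρt (Metric.mem_cthickening_of_dist_le _ (c t) _ _
      ⟨t, by rwa [Metric.mem_closedBall, Real.dist_eq], rfl⟩ ?_)
    rw [dist_eq_norm, add_sub_cancel_left, norm_smul, Real.norm_eq_abs, abs_mul,
      abs_of_nonneg β.nonneg]
    have h1 : |s| ≤ ε := (abs_lt.2 hs).le
    calc |s| * β t * ‖w‖ ≤ ε * 1 * (‖w‖ + 1) := by
          have h2 := β.le_one (x := t)
          have h3 := β.nonneg (x := t)
          gcongr
          linarith
      _ = ρ := by rw [hε]; field_simp
  classical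
  -- A straight-line displacement in coordinates, switched off by β. The cut is at r while β already
  -- vanishes from r/2 on, so both branches agree on an overlap and the two definitions glue
  -- smoothly.
  set Γ : ℝ → ℝ → M := fun s t =>
    if |t - t₀| < r then φ.symm (c t + (s * β t) • w) else γ t with hΓ
  have hΓ0 : ∀ s t, s * β t = 0 → Γ s t = γ t := fun s t h => by
    simp only [hΓ]
    split_ifs with h1
    · rw [h, zero_smul, add_zero]
      exact φ.left_inv (hK t h1.le).2
    · rfl
  have hvar : IsVariation m γ J (t₀ - r / 2) (t₀ + r / 2) ε Γ := by
    refine ⟨fun q hq => ?_, fun t _ => hΓ0 0 t (zero_mul _), fun s _ t _ htab => hΓ0 s t ?_⟩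
    · obtain ⟨s, t⟩ := q
      refine ContMDiffAt.contMDiffWithinAt ?_
      have hcont : Continuous fun p : ℝ × ℝ => |p.2 - t₀| := by fun_prop
      rcases lt_or_ge |t - t₀| r with h1 | h1
      · have h2 : ContDiffAt ℝ ∞ (fun p : ℝ × ℝ => c p.2 + (p.1 * β p.2) • w) (s, t) :=
          ((hcs t h1.le).comp (s, t) contDiffAt_snd).add
            ((contDiffAt_fst.mul (β.contDiffAt.comp (s, t) contDiffAt_snd)).smul contDiffAt_const)
        refine ((contMDiffAt_extChartAt_symm (hmem s hq.1 t h1.le)).comp (s, t)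
          h2.contMDiffAt).congr_of_eventuallyEq ?_
        filter_upwards [(isOpen_lt hcont continuous_const).mem_nhds h1] with p hp
        exact if_pos hp
      · refine ((hγ.contMDiffAt hJ hq.2).comp (s, t)
          (contDiffAt_snd : ContDiffAt ℝ ∞ (Prod.snd : ℝ × ℝ → ℝ) (s, t)).contMDiffAt).congr_of_eventuallyEq ?_
        have h2 : r / 2 < |t - t₀| := by linarith
        filter_upwards [(isOpen_lt continuous_const hcont).mem_nhds h2] with p hp
        exact hΓ0 p.1 p.2 (by rw [hβ0 p.2 (le_of_lt hp), mul_zero])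
    · rw [hβ0 t ?_, mul_zero]
      by_contra! h
      have := abs_lt.1 h
      exact htab ⟨by linarith, by linarith⟩
  have hsmall : ∀ t ∈ Icc (t₀ - r / 2) (t₀ + r / 2), |t - t₀| < r := fun t ht =>
    abs_lt.2 ⟨by linarith [ht.1], by linarith [ht.2]⟩
  refine ⟨t₀ - r / 2, t₀ + r / 2, ε, Γ, β, by linarith, fun t ht => (hK t (hsmall t ht).le).1, hε0,
    hvar, fun t ht => β.pos_of_mem_ball (by rwa [Real.ball_eq_Ioo]), fun t ht => ?_⟩
  have ht' := hK t (hsmall t ht).le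
  have h1 := hvar.coordAlong_variationField hJ hε0 ht'.1.1 ht'.2
  have h2 : (fun s => φ (Γ s t)) =ᶠ[𝓝 0] fun s => c t + (s * β t) • w := by
    filter_upwards [Ioo_mem_nhds (by linarith : -ε < 0) hε0] with s hs
    simp only [hΓ, if_pos (hsmall t ht)]
    exact φ.right_inv (hmem s hs t (hsmall t ht).le)
  have h3 : HasDerivAt (fun s => c t + (s * β t) • w) (β t • w) 0 := by
    simpa using (((hasDerivAt_id (0 : ℝ)).mul_const (β t)).smul_const w).const_add (c t)
  rw [h2.deriv_eq, h3.deriv] at h1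
  rw [← frame_coframe ht'.2 (variationField γ Γ t), ← map_smul, ← h1, coordAlong]

end BumpVariations

/-! ### The Euler–Lagrange equation. -/

section EulerLagrange

variable {m : ℕ} {M : Type*} [TopologicalSpace M]
  [ChartedSpace (EuclideanSpace ℝ (Fin m)) M] [IsManifold (𝓡 m) ∞ M]
  [RiemannianBundle (fun x : M => TangentSpace (𝓡 m) x)]
  [IsContMDiffRiemannianBundle (𝓡 m) ∞ (EuclideanSpace ℝ (Fin m))
      (fun x : M => TangentSpace (𝓡 m) x)]
  {γ : ℝ → M} {J : Set ℝ}

/-- The Euler-Lagrange equation of interpolating sesqui-harmonic curves in a space of constant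
curvature `1`. -/
theorem isInterpolatingSesquiHarmonic_iff {cov : AffineConnection m M} (hcov : IsLeviCivita cov)
    (hR : HasUnitCurvature cov) (δ₁ δ₂ : ℝ) (hJ : IsOpen J) (hγ : SmoothCurveOn m γ J)
    (hT : ∀ t ∈ J, inner ℝ (velocity (m := m) γ t) (velocity γ t) = (1 : ℝ)) :
    IsInterpolatingSesquiHarmonic cov δ₁ δ₂ γ J ↔
      ∀ t ∈ J, eulerLagrangeField cov δ₁ δ₂ γ t = 0 := by
  refine ⟨fun h t₀ ht₀ => ?_, fun h => ⟨hγ, fun a b hab habJ ε hε Γ hΓ => ?_⟩⟩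
  · by_contra hP
    have h₁ := mem_extChartAt_source (I := 𝓡 m) (γ t₀)
    have sP := smoothFieldAlongOn_eulerLagrangeField hcov δ₁ δ₂ hJ hγ
    -- The Euler–Lagrange vector at t₀ is extended with constant components. Its pairing with the
    -- field is positive at t₀, hence nearby, so a bump variation in this direction has positive
    -- first variation.
    set w := coframe (γ t₀) (γ t₀) (eulerLagrangeField cov δ₁ δ₂ γ t₀) with hw
    have e : (fun t => (inner ℝ (frame (γ t₀) (γ t) w) (eulerLagrangeField cov δ₁ δ₂ γ t) : ℝ))
        =ᶠ[𝓝 t₀] fun t => metricCoeff (γ t₀) (extChartAt (𝓡 m) (γ t₀) (γ t)) w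
          (coordAlong (γ t₀) γ (eulerLagrangeField cov δ₁ δ₂ γ) t) := by
      filter_upwards [(hγ.contMDiffAt hJ ht₀).eventually_source h₁] with t ht
      rw [coordAlong, metricCoeff_apply ht, frame_coframe ht]
    have hg := ((contDiffOn_metricCoeff (γ t₀)).contDiffAt
      ((isOpen_extChartAt_target (γ t₀)).mem_nhds ((extChartAt (𝓡 m) (γ t₀)).map_source h₁)))
    have hcont : ContinuousAt (fun t => (inner ℝ (frame (γ t₀) (γ t) w)
        (eulerLagrangeField cov δ₁ δ₂ γ t) : ℝ)) t₀ := by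
      refine ContinuousAt.congr (ContDiffAt.continuousAt (𝕜 := ℝ) (n := ∞) ?_) e.symm
      exact ((ContDiffAt.comp (g := metricCoeff (γ t₀)) t₀ hg
        ((hγ.contMDiffAt hJ ht₀).contDiffAt_extChartAt h₁)).clm_apply contDiffAt_const).clm_apply
        (sP.contDiffAt_coordAlong hJ ht₀ h₁)
    have hpos : (0 : ℝ) < inner ℝ (frame (γ t₀) (γ t₀) w)
        (eulerLagrangeField cov δ₁ δ₂ γ t₀) := by
      rw [hw, frame_coframe h₁]
      exact real_inner_self_pos.2 hP
    obtain ⟨a, b, ε, Γ, β, hab, habJ, hε, hΓ, hβ, hV⟩ :=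
      exists_isVariation hJ hγ ht₀ w (hcont.eventually (lt_mem_nhds hpos))
    have habJ' : Icc a b ⊆ J := habJ.trans inter_subset_left
    have h1 := (hΓ.hasDerivAt_sesquiEnergy hcov hR δ₁ δ₂ hJ hε hγ hab habJ' hT).unique
      (h.2 a b hab habJ' ε hε Γ hΓ)
    have sV := hΓ.smoothFieldAlongOn hJ hε hγ
    have h2 : 0 < ∫ t in a..b,
        (inner ℝ (variationField γ Γ t) (eulerLagrangeField cov δ₁ δ₂ γ t) : ℝ) := by
      refine intervalIntegral.intervalIntegral_pos_of_pos_on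
        (ContinuousOn.intervalIntegrable ?_) (fun t ht => ?_) hab
      · rw [uIcc_of_le hab.le]
        exact (sV.contDiffOn_inner hJ sP).continuousOn.mono habJ'
      · rw [hV t (Ioo_subset_Icc_self ht), real_inner_smul_left]
        exact mul_pos (hβ t ht) (habJ (Ioo_subset_Icc_self ht)).2
    linarith
  · refine (hΓ.hasDerivAt_sesquiEnergy hcov hR δ₁ δ₂ hJ hε hγ hab habJ hT).congr_deriv ?_
    rw [intervalIntegral.integral_congr (g := fun _ => (0 : ℝ))]
    · simp
    · intro t ht
      rw [uIcc_of_le hab.le] at ht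
      simp only [h t (habJ ht), inner_zero_right]

end EulerLagrange

/-! ### Frenet curves and the curvature equations. -/

section FrenetCurves

/-- The curvatures of a Frenet curve of osculating order `r`, extended by zero. -/
def frenetCurvature (r : ℕ) (k : ℕ → ℝ → ℝ) (i : ℕ) (t : ℝ) : ℝ :=
  if 1 ≤ i ∧ i < r then k i t else 0

theorem frenetCurvature_of_lt {r : ℕ} {k : ℕ → ℝ → ℝ} {i : ℕ} (hi : 1 ≤ i) (hr : i < r) :
    frenetCurvature r k i = k i := by
  funext t
  exact if_pos ⟨hi, hr⟩

theorem frenetCurvature_of_le {r : ℕ} {k : ℕ → ℝ → ℝ} {i : ℕ} (hr : r ≤ i) :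
    frenetCurvature r k i = fun _ => 0 := by
  funext t
  exact if_neg fun h => absurd h.2 (not_lt.2 hr)

variable {m : ℕ} {M : Type*} [TopologicalSpace M]
  [ChartedSpace (EuclideanSpace ℝ (Fin m)) M] {γ : ℝ → M}

/-- The Frenet frame of a Frenet curve of osculating order `r`, extended by zero. -/
def frenetVector (r : ℕ) (E : ℕ → ∀ t, TangentSpace (𝓡 m) (γ t)) (i : ℕ) (t : ℝ) :
    TangentSpace (𝓡 m) (γ t) :=
  if i ≤ r then E i t else 0

theorem frenetVector_of_le {r : ℕ} {E : ℕ → ∀ t, TangentSpace (𝓡 m) (γ t)} {i : ℕ} (hr : i ≤ r) :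
    frenetVector r E i = E i := by
  funext t
  exact if_pos hr

theorem frenetVector_of_lt {r : ℕ} {E : ℕ → ∀ t, TangentSpace (𝓡 m) (γ t)} {i : ℕ} (hr : r < i) :
    frenetVector r E i = fun _ => 0 := by
  funext t
  exact if_neg (not_le.2 hr)

/-- Smoothness and the covariant derivative of the zero field then follow from the product lemmas
applied to E 1, which belongs to the frame for every r ≥ 1. -/
theorem zero_eq_zero_smul (E : ℕ → ∀ t, TangentSpace (𝓡 m) (γ t)) :
    (fun _ => 0 : ∀ t, TangentSpace (𝓡 m) (γ t)) = fun t => (fun _ : ℝ => (0 : ℝ)) t • E 1 t := by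
  funext t
  exact (zero_smul ℝ (E 1 t)).symm

variable [IsManifold (𝓡 m) ∞ M] [RiemannianBundle (fun x : M => TangentSpace (𝓡 m) x)]
  {cov : AffineConnection m M} {J : Set ℝ} {r : ℕ} {k : ℕ → ℝ → ℝ}
  {E : ℕ → ∀ t, TangentSpace (𝓡 m) (γ t)} {t : ℝ}

namespace IsFrenetFrame

theorem contDiffOn_frenetCurvature (h : IsFrenetFrame cov γ J r k E) (i : ℕ) :
    ContDiffOn ℝ ∞ (frenetCurvature r k i) J := by
  by_cases hi : 1 ≤ i ∧ i < r
  · rw [frenetCurvature_of_lt hi.1 hi.2]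
    exact h.smooth_curvature i hi.1 hi.2
  · have : frenetCurvature r k i = fun _ => 0 := by
      funext t
      exact if_neg hi
    rw [this]
    exact contDiffOn_const

theorem smoothFieldAlongOn_frenetVector (h : IsFrenetFrame cov γ J r k E) (hJ : IsOpen J) {i : ℕ}
    (hi : 1 ≤ i) : SmoothFieldAlongOn γ (frenetVector r E i) J := by
  rcases le_or_gt i r with hr | hr
  · rw [frenetVector_of_le hr]
    exact h.smooth_frame i hi hr
  · rw [frenetVector_of_lt hr, zero_eq_zero_smul E]
    exact (h.smooth_frame 1 le_rfl h.one_le).smul hJ contDiffOn_const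

/-- The Frenet equations for the frame extended by zero. -/
theorem covDerivAlong_frenetVector (h : IsFrenetFrame cov γ J r k E) (hJ : IsOpen J) {i : ℕ}
    (hi : 1 ≤ i) (ht : t ∈ J) :
    covDerivAlong cov γ (frenetVector r E i) t
      = frenetCurvature r k i t • frenetVector r E (i + 1) t
        - frenetCurvature r k (i - 1) t • frenetVector r E (i - 1) t := by
  rcases le_or_gt i r with hr | hr
  · rw [frenetVector_of_le hr, h.frenet t ht i hi hr, sub_eq_neg_add]
    congr 1
    · rcases hi.eq_or_lt with rfl | hi'
      · simp [frenetCurvature]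
      · rw [if_neg (by omega), frenetCurvature_of_lt (by omega) (by omega),
          frenetVector_of_le (by omega)]
    · rcases hr.eq_or_lt with rfl | hr'
      · simp [frenetCurvature]
      · rw [if_neg (by omega), frenetCurvature_of_lt hi hr', frenetVector_of_le hr']
  · rw [frenetVector_of_lt hr, frenetCurvature_of_le hr.le, frenetCurvature_of_le (by omega),
      zero_eq_zero_smul E, covDerivAlong_smul cov (h.smooth_frame 1 le_rfl h.one_le) hJ contDiffOn_const ht]
    simp

theorem tensionField_eq (h : IsFrenetFrame cov γ J r k E) (hJ : IsOpen J) (ht : t ∈ J) :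
    tensionField cov γ t = frenetCurvature r k 1 t • frenetVector r E 2 t := by
  have h1 : ∀ᶠ s in 𝓝 t, velocity γ s = frenetVector r E 1 s := by
    filter_upwards [hJ.mem_nhds ht] with s hs
    rw [frenetVector_of_le h.one_le, h.tangent s hs]
  rw [tensionField, covDerivAlong_congr cov h1, h.covDerivAlong_frenetVector hJ le_rfl ht]
  simp [frenetCurvature]

theorem inner_velocity (h : IsFrenetFrame cov γ J r k E) :
    ∀ t ∈ J, inner ℝ (velocity (m := m) γ t) (velocity γ t) = (1 : ℝ) := fun t ht => by
  rw [← h.tangent t ht, h.orthonormal t ht 1 1 le_rfl h.one_le le_rfl h.one_le, if_pos rfl]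

theorem covDerivAlong_tensionField_eq (h : IsFrenetFrame cov γ J r k E) (hJ : IsOpen J)
    (ht : t ∈ J) :
    covDerivAlong cov γ (tensionField cov γ) t
      = (-frenetCurvature r k 1 t ^ 2) • frenetVector r E 1 t
        + deriv (frenetCurvature r k 1) t • frenetVector r E 2 t
        + (frenetCurvature r k 1 t * frenetCurvature r k 2 t) • frenetVector r E 3 t := by
  have h1 : ∀ᶠ s in 𝓝 t, tensionField cov γ s
      = (fun s => frenetCurvature r k 1 s • frenetVector r E 2 s) s := by
    filter_upwards [hJ.mem_nhds ht] with s hs using h.tensionField_eq hJ hs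
  rw [covDerivAlong_congr cov h1, covDerivAlong_smul cov
    (h.smoothFieldAlongOn_frenetVector hJ (by norm_num)) hJ (h.contDiffOn_frenetCurvature 1) ht,
    h.covDerivAlong_frenetVector hJ (by norm_num) ht]
  simp only [Nat.reduceAdd, Nat.reduceSub]
  module

/-- Repeated use of the Frenet equations on τ = k₁E₂. With frame and curvatures extended by zero the
same formula holds for every osculating order. -/
theorem eulerLagrangeField_eq (h : IsFrenetFrame cov γ J r k E) (hJ : IsOpen J) (δ₁ δ₂ : ℝ)
    (ht : t ∈ J) :
    eulerLagrangeField cov δ₁ δ₂ γ t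
      = (δ₂ * (-3 * frenetCurvature r k 1 t * deriv (frenetCurvature r k 1) t))
          • frenetVector r E 1 t
        + (δ₂ * (deriv (deriv (frenetCurvature r k 1)) t - frenetCurvature r k 1 t ^ 3
            - frenetCurvature r k 1 t * frenetCurvature r k 2 t ^ 2 + frenetCurvature r k 1 t)
            - δ₁ * frenetCurvature r k 1 t) • frenetVector r E 2 t
        + (δ₂ * (2 * deriv (frenetCurvature r k 1) t * frenetCurvature r k 2 t
            + frenetCurvature r k 1 t * deriv (frenetCurvature r k 2) t)) • frenetVector r E 3 t
        + (δ₂ * (frenetCurvature r k 1 t * frenetCurvature r k 2 t * frenetCurvature r k 3 t))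
          • frenetVector r E 4 t := by
  set κ := frenetCurvature r k with hκ
  set F := frenetVector r E with hF
  have sκ : ∀ i, ContDiffOn ℝ ∞ (κ i) J := h.contDiffOn_frenetCurvature
  have sF : ∀ {i}, 1 ≤ i → SmoothFieldAlongOn γ (F i) J := h.smoothFieldAlongOn_frenetVector hJ
  have dF : ∀ {i}, 1 ≤ i → covDerivAlong cov γ (F i) t
      = κ i t • F (i + 1) t - κ (i - 1) t • F (i - 1) t := fun hi =>
    h.covDerivAlong_frenetVector hJ hi ht
  have dκ : ∀ i, HasDerivAt (κ i) (deriv (κ i) t) t := fun i =>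
    (((sκ i).contDiffAt (hJ.mem_nhds ht)).differentiableAt (by simp)).hasDerivAt
  have s1 : ContDiffOn ℝ ∞ (fun s => -κ 1 s ^ 2) J := ((sκ 1).pow 2).neg
  have s2 : ContDiffOn ℝ ∞ (fun s => deriv (κ 1) s) J := fun s hs =>
    (((sκ 1).contDiffAt (hJ.mem_nhds hs)).derivWithin (m := ∞) (by norm_cast)).contDiffWithinAt
  have s3 : ContDiffOn ℝ ∞ (fun s => κ 1 s * κ 2 s) J := (sκ 1).mul (sκ 2)
  have d1 : deriv (fun s => -κ 1 s ^ 2) t = -(2 * κ 1 t * deriv (κ 1) t) := by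
    have := ((dκ 1).fun_pow 2).fun_neg.deriv
    simpa using this
  have d3 : deriv (fun s => κ 1 s * κ 2 s) t = deriv (κ 1) t * κ 2 t + κ 1 t * deriv (κ 2) t :=
    ((dκ 1).fun_mul (dκ 2)).deriv
  have h1 : ∀ᶠ s in 𝓝 t, covDerivAlong cov γ (tensionField cov γ) s
      = (fun s => (fun s => (fun s => (-κ 1 s ^ 2) • F 1 s) s + (fun s => deriv (κ 1) s • F 2 s) s) s
        + (fun s => (κ 1 s * κ 2 s) • F 3 s) s) s := by
    filter_upwards [hJ.mem_nhds ht] with s hs using h.covDerivAlong_tensionField_eq hJ hs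
  have f1 := (sF (i := 1) le_rfl).smul hJ s1
  have f2 := (sF (i := 2) (by norm_num)).smul hJ s2
  have f3 := (sF (i := 3) (by norm_num)).smul hJ s3
  rw [eulerLagrangeField, covDerivAlong_congr cov h1, covDerivAlong_add cov (f1.add hJ f2) hJ f3 ht,
    covDerivAlong_add cov f1 hJ f2 ht, covDerivAlong_smul cov (sF le_rfl) hJ s1 ht,
    covDerivAlong_smul cov (sF (by norm_num)) hJ s2 ht,
    covDerivAlong_smul cov (sF (by norm_num)) hJ s3 ht, d1, d3, dF le_rfl, dF (by norm_num),
    dF (by norm_num), h.tensionField_eq hJ ht]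
  have hκ0 : κ 0 t = 0 := by simp [hκ, frenetCurvature]
  simp only [Nat.reduceAdd, Nat.reduceSub, hκ0]
  module

theorem inner_frenetVector (h : IsFrenetFrame cov γ J r k E) (ht : t ∈ J) {i j : ℕ} (hi : 1 ≤ i)
    (hj : 1 ≤ j) (hjr : j ≤ r) :
    inner ℝ (frenetVector r E i t) (frenetVector r E j t) = if i = j then (1 : ℝ) else 0 := by
  rw [frenetVector_of_le hjr]
  rcases le_or_gt i r with hr | hr
  · rw [frenetVector_of_le hr, h.orthonormal t ht i j hi hr hj hjr]
  · rw [frenetVector_of_lt hr, inner_zero_left, if_neg (by omega)]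

/-- The Euler-Lagrange equation in terms of the curvatures of a Frenet curve. -/
theorem curvature_equations (h : IsFrenetFrame cov γ J r k E) (hJ : IsOpen J) {δ₁ δ₂ : ℝ}
    (hδ₂ : δ₂ ≠ 0) (hr : 2 ≤ r) (ht : t ∈ J) (hP : eulerLagrangeField cov δ₁ δ₂ γ t = 0) :
    frenetCurvature r k 1 t * deriv (frenetCurvature r k 1) t = 0 ∧
    deriv (deriv (frenetCurvature r k 1)) t - frenetCurvature r k 1 t ^ 3
      - frenetCurvature r k 1 t * frenetCurvature r k 2 t ^ 2
      + (1 - δ₁ / δ₂) * frenetCurvature r k 1 t = 0 ∧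
    (3 ≤ r → 2 * deriv (frenetCurvature r k 1) t * frenetCurvature r k 2 t
      + frenetCurvature r k 1 t * deriv (frenetCurvature r k 2) t = 0) ∧
    (4 ≤ r → frenetCurvature r k 1 t * frenetCurvature r k 2 t * frenetCurvature r k 3 t = 0) := by
  rw [h.eulerLagrangeField_eq hJ δ₁ δ₂ ht] at hP
  -- Pairing with E j extracts the j-th coefficient only when j ≤ r, as later vectors are zero;
  -- hence the conditions 3 ≤ r and 4 ≤ r in the last two equations.
  have key : ∀ {j : ℕ}, 1 ≤ j → j ≤ r → _ := fun {j} hj hjr =>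
    congrArg (fun u => (inner ℝ u (frenetVector r E j t) : ℝ)) hP
  simp only [inner_add_left, real_inner_smul_left, inner_zero_left] at key
  refine ⟨?_, ?_, fun h3 => ?_, fun h4 => ?_⟩
  · have e := key le_rfl h.one_le
    rw [h.inner_frenetVector ht (by norm_num) (by norm_num) h.one_le,
      h.inner_frenetVector ht (by norm_num) (by norm_num) h.one_le,
      h.inner_frenetVector ht (by norm_num) (by norm_num) h.one_le,
      h.inner_frenetVector ht (by norm_num) (by norm_num) h.one_le] at e
    norm_num [hδ₂] at e
    rcases e with e | e <;> simp [e]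
  · have e := key (by norm_num) hr
    rw [h.inner_frenetVector ht (by norm_num) (by norm_num) hr,
      h.inner_frenetVector ht (by norm_num) (by norm_num) hr,
      h.inner_frenetVector ht (by norm_num) (by norm_num) hr,
      h.inner_frenetVector ht (by norm_num) (by norm_num) hr] at e
    norm_num at e
    refine mul_left_cancel₀ hδ₂ ?_
    rw [mul_zero, ← e]
    field_simp
    ring
  · have e := key (by norm_num) h3
    rw [h.inner_frenetVector ht (by norm_num) (by norm_num) h3,
      h.inner_frenetVector ht (by norm_num) (by norm_num) h3,
      h.inner_frenetVector ht (by norm_num) (by norm_num) h3,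
      h.inner_frenetVector ht (by norm_num) (by norm_num) h3] at e
    norm_num [hδ₂] at e
    exact e
  · have e := key (by norm_num) h4
    rw [h.inner_frenetVector ht (by norm_num) (by norm_num) h4,
      h.inner_frenetVector ht (by norm_num) (by norm_num) h4,
      h.inner_frenetVector ht (by norm_num) (by norm_num) h4,
      h.inner_frenetVector ht (by norm_num) (by norm_num) h4] at e
    norm_num [hδ₂] at e
    rcases e with (e | e) | e <;> simp [e]

/-- Covers circles (r = 2, k₂ = 0) and helices (r = 3) at once: constancy removes the E₁ and E₃
terms, r ≤ 3 the E₄ term, and the relation between the curvatures the E₂ term. -/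
theorem eulerLagrangeField_eq_zero (h : IsFrenetFrame cov γ J r k E) (hJ : IsOpen J) {δ₁ δ₂ : ℝ}
    (hδ₂ : δ₂ ≠ 0) {k₁ k₂ : ℝ} (h1 : ∀ t ∈ J, frenetCurvature r k 1 t = k₁)
    (h2 : ∀ t ∈ J, frenetCurvature r k 2 t = k₂) (h3 : r ≤ 3)
    (hk : k₁ ^ 2 + k₂ ^ 2 = 1 - δ₁ / δ₂) (ht : t ∈ J) :
    eulerLagrangeField cov δ₁ δ₂ γ t = 0 := by
  have e1 : frenetCurvature r k 1 =ᶠ[𝓝 t] fun _ => k₁ := by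
    filter_upwards [hJ.mem_nhds ht] with s hs using h1 s hs
  have e2 : frenetCurvature r k 2 =ᶠ[𝓝 t] fun _ => k₂ := by
    filter_upwards [hJ.mem_nhds ht] with s hs using h2 s hs
  have hk' : k₁ * (δ₂ * (k₁ ^ 2 + k₂ ^ 2) - δ₂ + δ₁) = 0 := by
    rw [hk]
    field_simp
    ring
  rw [h.eulerLagrangeField_eq hJ δ₁ δ₂ ht, e1.deriv.deriv_eq, e1.deriv_eq, e2.deriv_eq,
    frenetCurvature_of_le (i := 3) h3, h1 t ht, h2 t ht]
  have e : δ₂ * (deriv (deriv fun _ : ℝ => k₁) t - k₁ ^ 3 - k₁ * k₂ ^ 2 + k₁) - δ₁ * k₁ = 0 := by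
    simp
    linear_combination -hk'
  rw [e]
  simp

end IsFrenetFrame

theorem eq_of_deriv_eq_zero {f : ℝ → ℝ} (hJ : IsOpen J) (hJ' : J.OrdConnected)
    (hf : ContDiffOn ℝ ∞ f J) (h : ∀ t ∈ J, deriv f t = 0) {s : ℝ} (hs : s ∈ J) (ht : t ∈ J) :
    f s = f t :=
  hJ.is_const_of_deriv_eq_zero hJ'.isPreconnected (hf.differentiableOn (by simp)) h hs ht

end FrenetCurves

end

/-! ### The classification. -/

theorem theorem3p3 {n : ℕ} {M : Type*} [TopologicalSpace M] [T2Space M]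
    [ChartedSpace (EuclideanSpace ℝ (Fin (2 * n + 1))) M] [IsManifold (𝓡 (2 * n + 1)) ∞ M]
    [RiemannianBundle (fun x : M => TangentSpace (𝓡 (2 * n + 1)) x)]
    [IsContMDiffRiemannianBundle (𝓡 (2 * n + 1)) ∞ (EuclideanSpace ℝ (Fin (2 * n + 1)))
      (fun x : M => TangentSpace (𝓡 (2 * n + 1)) x)]
    (cov : AffineConnection (2 * n + 1) M) (hcov : IsLeviCivita cov)
    (S : AlmostContactMetricStructure n M) (hS : S.IsSasakian)
    (hc : S.HasConstantPhiSectionalCurvature cov 1)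
    (J : Set ℝ) (hJ_open : IsOpen J) (hJ_conn : J.OrdConnected)
    (γ : ℝ → M) (r : ℕ) (k : ℕ → ℝ → ℝ)
    (hLegendre : S.IsLegendreOn γ J) (hFrenet : IsFrenetCurve cov γ J r k)
    (hγ : ¬ IsGeodesicOn cov γ J)
    (δ₁ δ₂ : ℝ) (hδ₂ : δ₂ ≠ 0) (hδ : δ₁ / δ₂ ≠ 0) :
    (IsInterpolatingSesquiHarmonic cov δ₁ δ₂ γ J ↔
      0 < 1 - δ₁ / δ₂ ∧
        (S.IsLegendreCircle cov γ J (Real.sqrt (1 - δ₁ / δ₂)) ∨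
          ∃ k₁ k₂ : ℝ, S.IsLegendreHelix cov γ J k₁ k₂ ∧ k₁ ^ 2 + k₂ ^ 2 = 1 - δ₁ / δ₂)) ∧
    (1 - δ₁ / δ₂ < 0 → ¬ IsInterpolatingSesquiHarmonic cov δ₁ δ₂ γ J) := by
  have hR : HasUnitCurvature cov := S.curvatureTensor_eq hcov hS hc
  obtain ⟨E, hE⟩ := hFrenet
  have hEL := isInterpolatingSesquiHarmonic_iff hcov hR δ₁ δ₂ hJ_open hE.smooth_curve
    hE.inner_velocity
  -- The final clause follows from the positivity contained in the equivalence.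
  refine (fun h => ⟨h, fun hneg hharm => absurd (h.1 hharm).1 hneg.not_gt⟩) ?_
  rw [hEL]
  constructor
  · intro hP
    obtain ⟨t₀, ht₀, hτ⟩ : ∃ t ∈ J, tensionField cov γ t ≠ 0 := by
      simpa [IsGeodesicOn] using hγ
    -- For r = 1 the extended curvature k₁ is zero, so τ would vanish at t₀.
    have hr : 2 ≤ r := by
      by_contra hr
      rw [hE.tensionField_eq hJ_open ht₀, frenetCurvature_of_le (by omega), zero_smul] at hτ
      exact hτ rfl
    have eq := fun t ht => hE.curvature_equations hJ_open hδ₂ hr ht (hP t ht)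
    have hκ1 := frenetCurvature_of_lt (k := k) le_rfl (show 1 < r by omega)
    have hpos := hE.curvature_pos 1 le_rfl (by omega)
    have hs := hE.contDiffOn_frenetCurvature
    have hd1 : ∀ t ∈ J, deriv (frenetCurvature r k 1) t = 0 := fun t ht =>
      (mul_eq_zero.1 (eq t ht).1).resolve_left (by rw [hκ1]; exact (hpos t ht).ne')
    have hc1 : ∀ t ∈ J, frenetCurvature r k 1 t = k 1 t₀ := fun t ht => by
      rw [eq_of_deriv_eq_zero hJ_open hJ_conn (hs 1) hd1 ht ht₀, hκ1]
    have hk₁ := hpos t₀ ht₀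
    -- The E₂ equation with k₁″ = 0, divided by k₁ > 0. For r = 2 the extended k₂ is zero, so both
    -- orders are covered.
    have hsq : ∀ t ∈ J, k 1 t₀ ^ 2 + frenetCurvature r k 2 t ^ 2 = 1 - δ₁ / δ₂ := fun t ht => by
      have e := (eq t ht).2.1
      have hdd : deriv (deriv (frenetCurvature r k 1)) t = 0 := by
        have : deriv (frenetCurvature r k 1) =ᶠ[nhds t] fun _ => 0 := by
          filter_upwards [hJ_open.mem_nhds ht] with s hs using hd1 s hs
        rw [this.deriv_eq, deriv_const]
      rw [hdd, hc1 t ht] at e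
      refine mul_left_cancel₀ hk₁.ne' ?_
      linarith
    have hpos' : 0 < 1 - δ₁ / δ₂ := by
      rw [← hsq t₀ ht₀]
      positivity
    refine ⟨hpos', ?_⟩
    have hr3 : r ≤ 3 := by
      by_contra! hr4
      have e := (eq t₀ ht₀).2.2.2 hr4
      rw [hκ1, frenetCurvature_of_lt (by norm_num) (by omega : 2 < r),
        frenetCurvature_of_lt (by norm_num) (by omega : 3 < r)] at e
      have h2 := hE.curvature_pos 2 (by norm_num) (by omega) t₀ ht₀
      have h3 := hE.curvature_pos 3 (by norm_num) (by omega) t₀ ht₀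
      exact (by positivity : k 1 t₀ * k 2 t₀ * k 3 t₀ ≠ 0) e
    rcases hr.eq_or_lt with rfl | hr'
    · have e := hsq t₀ ht₀
      rw [frenetCurvature_of_le le_rfl, zero_pow two_ne_zero, add_zero] at e
      have hk : Real.sqrt (1 - δ₁ / δ₂) = k 1 t₀ := by rw [← e, Real.sqrt_sq hk₁.le]
      refine Or.inl ⟨hLegendre, by rwa [hk], k, ⟨E, hE⟩, fun t ht => ?_⟩
      rw [hk, ← hc1 t ht, hκ1]
    · obtain rfl : r = 3 := by omega
      have hκ2 := frenetCurvature_of_lt (k := k) one_le_two (show 2 < 3 by norm_num)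
      have hd2 : ∀ t ∈ J, deriv (frenetCurvature 3 k 2) t = 0 := fun t ht => by
        have e := (eq t ht).2.2.1 le_rfl
        rw [hd1 t ht, hc1 t ht, mul_zero, zero_mul, zero_add] at e
        exact (mul_eq_zero.1 e).resolve_left hk₁.ne'
      have hc2 : ∀ t ∈ J, frenetCurvature 3 k 2 t = k 2 t₀ := fun t ht => by
        rw [eq_of_deriv_eq_zero hJ_open hJ_conn (hs 2) hd2 ht ht₀, hκ2]
      refine Or.inr ⟨k 1 t₀, k 2 t₀, ⟨hLegendre, hk₁,
        hE.curvature_pos 2 one_le_two (by norm_num) t₀ ht₀, k, ⟨E, hE⟩, fun t ht => ?_⟩, ?_⟩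
      · rw [← hc1 t ht, ← hc2 t ht, hκ1, hκ2]
        exact ⟨rfl, rfl⟩
      · rw [← hsq t₀ ht₀, hκ2]
  -- The circle or helix comes with its own frame and curvatures. The Euler–Lagrange field depends
  -- on the curve alone, so it can be computed in that frame.
  · rintro ⟨hpos, ⟨-, -, k', ⟨E', hE'⟩, hk'⟩ | ⟨k₁, k₂, ⟨-, -, -, k', ⟨E', hE'⟩, hk'⟩, hk⟩⟩ t ht
    · refine hE'.eulerLagrangeField_eq_zero hJ_open hδ₂ (k₁ := Real.sqrt (1 - δ₁ / δ₂)) (k₂ := 0)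
        (fun t ht => ?_) (fun t _ => ?_) (by norm_num) ?_ ht
      · rw [frenetCurvature_of_lt le_rfl (by norm_num), hk' t ht]
      · rw [frenetCurvature_of_le le_rfl]
      · rw [Real.sq_sqrt hpos.le]
        ring
    · refine hE'.eulerLagrangeField_eq_zero hJ_open hδ₂
        (fun t ht => ?_) (fun t ht => ?_) le_rfl hk ht
      · rw [frenetCurvature_of_lt le_rfl (by norm_num), (hk' t ht).1]
      · rw [frenetCurvature_of_lt one_le_two (by norm_num), (hk' t ht).2]
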